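/- Let $\mathcal C$ and $\mathcal D$ be cocomplete, cofibrantly generated model categories and let $\lambda:\mathcal C\rightleftarrows\mathcal D:R$ be a Quillen pair (an adjunction $\lambda\dashv R$ such that $R$ preserves fibrations and trivial fibrations). Let $FinSet$ be the category of finite sets and bijections, and let $[FinSet,\mathcal C]$ be the category of functors $FinSet\to\mathcal C$ (symmetric sequences in $\mathcal C$). Let $\overline\lambda:[FinSet,\mathcal C]\rightleftarrows[FinSet,\mathcal D]:\overline R$ be the adjunction obtained by applying $\lambda$ and $R$ aritywise. Then $[FinSet,\mathcal C]$ and $[FinSet,\mathcal D]$ carry the projective model structures, in which the fibrations and the weak equivalences are the natural transformations that are objectwise fibrations, respectively weak equivalences, and $(\overline\lambda,\overline R)$ is a Quillen pair for these structures. Moreover: 1. If $(\lambda,R)$ is a Quillen equivalence (that is, its derived functors are equivalences between the homotopy categories), then so is $(\overline\lambda,\overline R)$. 2. Suppose that $(\mathcal C,\wedge,\mathbb I_{\mathcal C})$ and $(\mathcal D,\wedge,\mathbb I_{\mathcal D})$ are symmetric monoidal model categories (the product $\wedge$ preserves colimits in each variable, and the pushout-product axiom and the unit axiom hold). For symmetric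 sequences $M,N$ let $$(M\circ N)(J)=\operatorname*{colim}_{f:J\to I} M(I)\wedge\bigwedge_{i\in I}N(f^{-1}(i)),$$ where the colimit runs over all maps $f$ from $J$ to the sets $I=\{1,\dots,r\}$, $r\ge 0$, and the bijections $\sigma:I\to I'$ with $f'=\sigma\circ f$. Let $\mathbb I$ be the symmetric sequence with $\mathbb I(J)$ the unit object if $|J|=1$ and the initial object otherwise. Suppose that $([FinSet,\mathcal C],\circ,\mathbb I)$ and $([FinSet,\mathcal D],\circ,\mathbb I)$, with the canonical associativity and unit isomorphisms, are monoidal categories. Suppose finally that $(\lambda,R)$ is a weak monoidal Quillen pair, that is: $R$ is lax symmetric monoidal with structure maps $\varphi_{X,Y}:R(X)\wedge R(Y)\to R(X\wedge Y)$ and $\nu:\mathbb I_{\mathcal C}\to R(\mathbb I_{\mathcal D})$; for all cofibrant $X,Y$ in $\mathcal C$ the adjoint $\lambda(X\wedge Y)\to\lambda(X)\wedge\lambda(Y)$ of the composite $X\wedge Y\to R\lambda X\wedge R\lambda Y\to R(\lambda X\wedge\lambda Y)$ is a weak equivalence; and for every cofibrant replacement $\mathbb I_{\mathcal C}^c\to\mathbb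 I_{\mathcal C}$ of the unit, the composite $\lambda(\mathbb I_{\mathcal C}^c)\to\lambda(\mathbb I_{\mathcal C})\to\mathbb I_{\mathcal D}$ with the adjoint of $\nu$ is a weak equivalence. Then $(\overline\lambda,\overline R)$ is a weak monoidal Quillen pair for the (non-symmetric) composition products: the functor $\overline R$ has a lax monoidal structure with respect to $\circ$ and $\mathbb I$, given on the terms of the colimits by the iterated maps $\varphi$ of $R$ and on one-element sets by $\nu$, for which $\overline\lambda(A\circ B)\to\overline\lambda(A)\circ\overline\lambda(B)$ is a weak equivalence for all cofibrant symmetric sequences $A,B$ in $\mathcal C$, and for which $\overline\lambda(\mathbb I^c)\to\overline\lambda(\mathbb I)\to\mathbb I$ is a weak equivalence for every cofibrant replacement $\mathbb I^c\to\mathbb I$. -/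

import Mathlib

open CategoryTheory Limits MonoidalCategory HomotopicalAlgebra

universe v v₁ v₂ u u₁ u₂

namespace SymmetricSequences

section TensorProducts

variable {C : Type u} [Category.{v} C] [MonoidalCategory C] [SymmetricCategory C]
variable {ι κ μ : Type}

/-- The ordered tensor product `X a₁ ⊗ (X a₂ ⊗ (⋯ ⊗ 𝟙))` of the objects of the family `X`
along the list `[a₁, a₂, …]`. -/
def tprod (X : ι → C) : List ι → C
  | [] => 𝟙_ C
  | a :: l => X a ⊗ tprod X l

/-- The symmetry exchanging the first two factors. -/
def exch (X Y Z : C) : X ⊗ (Y ⊗ Z) ⟶ Y ⊗ (X ⊗ Z) :=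
  (α_ X Y Z).inv ≫ (β_ X Y).hom ▷ Z ≫ (α_ Y X Z).hom

lemma exch_natural {X X' Y Y' Z Z' : C} (f : X ⟶ X') (g : Y ⟶ Y') (h : Z ⟶ Z') :
    (f ⊗ₘ (g ⊗ₘ h)) ≫ exch X' Y' Z' = exch X Y Z ≫ (g ⊗ₘ (f ⊗ₘ h)) := by
  simp only [exch, Category.assoc]
  rw [associator_inv_naturality_assoc, ← associator_naturality,
    ← tensorHom_id, ← tensorHom_id, tensorHom_comp_tensorHom_assoc,
    tensorHom_comp_tensorHom_assoc, BraidedCategory.braiding_naturality]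
  simp

@[simp]
lemma exch_exch (X Y Z : C) : exch X Y Z ≫ exch Y X Z = 𝟙 _ := by
  simp [exch, ← comp_whiskerRight_assoc]

/-- The braid relation for `exch`. -/
lemma exch_braid (X Y Z W : C) :
    X ◁ exch Y Z W ≫ exch X Z (Y ⊗ W) ≫ Z ◁ exch X Y W =
      exch X Y (Z ⊗ W) ≫ Y ◁ exch X Z W ≫ exch Y Z (X ⊗ W) := by
  have h := congrArg (fun t => 𝟙 (X ⊗ Y ⊗ Z ⊗ W) ⊗≫ t ▷ W ⊗≫ 𝟙 (Z ⊗ Y ⊗ X ⊗ W))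
    (BraidedCategory.yang_baxter' X Y Z)
  calc
    _ = _ := by simp only [exch]; monoidal
    _ = _ := h.symm
    _ = _ := by simp only [exch]; monoidal

/-- `Insertion a t l`: the list `l` is obtained from `t` by inserting `a` at some place. -/
inductive Insertion (a : ι) : List ι → List ι → Type
  | here (t : List ι) : Insertion a t (a :: t)
  | there (b : ι) {t l : List ι} (i : Insertion a t l) : Insertion a (b :: t) (b :: l)

namespace Insertion

/-- Move the factor `X a` from the front to its place in the list `l`. -/
def eval (X : ι → C) {a : ι} : {t l : List ι} → Insertion a t l → (X a ⊗ tprod X t ⟶ tprod X l)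
  | _, _, .here t => 𝟙 (X a ⊗ tprod X t)
  | _, _, .there (t := t) b i => exch (X a) (X b) (tprod X t) ≫ X b ◁ eval X i

lemma mem {a : ι} {t l : List ι} (i : Insertion a t l) : a ∈ l := by
  induction i with
  | here t => simp
  | there b i ih => simp [ih]

lemma perm {a : ι} {t l : List ι} (i : Insertion a t l) : l.Perm (a :: t) := by
  induction i with
  | here t => rfl
  | there b i ih => exact (ih.cons b).trans (List.Perm.swap _ _ _)

lemma exists_of_mem {a : ι} {l : List ι} (h : a ∈ l) : ∃ t, Nonempty (Insertion a t l) := by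
  induction l with
  | nil => simp at h
  | cons b l ih =>
    rcases List.mem_cons.1 h with rfl | h
    · exact ⟨l, ⟨.here l⟩⟩
    · obtain ⟨t, ⟨i⟩⟩ := ih h
      exact ⟨b :: t, ⟨.there b i⟩⟩

lemma unique {a : ι} {t l : List ι} (i : Insertion a t l) (hl : l.Nodup) {t' : List ι}
    (j : Insertion a t' l) : t = t' ∧ HEq i j := by
  induction i generalizing t' with
  | here t =>
    cases j with
    | here => exact ⟨rfl, HEq.rfl⟩
    | there _ j => exact absurd j.mem (List.nodup_cons.1 hl).1
  | there b i ih =>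
    cases j with
    | here => exact absurd i.mem (List.nodup_cons.1 hl).1
    | there _ j =>
      obtain ⟨rfl, h⟩ := ih (List.nodup_cons.1 hl).2 j
      obtain rfl := eq_of_heq h
      exact ⟨rfl, HEq.rfl⟩

lemma exchange (X : ι → C) {a b : ι} {w l : List ι} (j : Insertion b w l) {w' : List ι}
    (i : Insertion a w' w) :
    ∃ (t : List ι) (j' : Insertion b w' t) (i' : Insertion a t l),
      X b ◁ i.eval X ≫ j.eval X =
        exch (X b) (X a) (tprod X w') ≫ X a ◁ j'.eval X ≫ i'.eval X := by
  induction j generalizing w' with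
  | here w =>
    have key : ∀ {A B W W' : C} (e : A ⊗ W ⟶ W'), B ◁ e ≫ 𝟙 (B ⊗ W') =
        exch B A W ≫ A ◁ 𝟙 (B ⊗ W) ≫ exch A B W ≫ B ◁ e := by
      intro A B W W' e
      rw [whiskerLeft_id, Category.id_comp, ← Category.assoc, exch_exch]
      simp
    exact ⟨b :: w', .here w', .there b i, key (i.eval X)⟩
  | there c j ih =>
    cases i with
    | here =>
      have key : ∀ {A B W W' : C} (e : B ⊗ W ⟶ W'), B ◁ 𝟙 (A ⊗ W) ≫ exch B A W ≫ A ◁ e =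
          exch B A W ≫ A ◁ e ≫ 𝟙 (A ⊗ W') := by
        intro A B W W' e
        simp
      exact ⟨_, j, .here _, key (j.eval X)⟩
    | there _ i =>
      obtain ⟨t, j', i', h⟩ := ih i
      refine ⟨c :: t, .there c j', .there c i', ?_⟩
      have key : ∀ {A B K W W₁ T L : C} (e : A ⊗ W ⟶ W₁) (g : B ⊗ W₁ ⟶ L)
          (g' : B ⊗ W ⟶ T) (e' : A ⊗ T ⟶ L),
          B ◁ e ≫ g = exch B A W ≫ A ◁ g' ≫ e' →
          B ◁ (exch A K W ≫ K ◁ e) ≫ exch B K W₁ ≫ K ◁ g =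
            exch B A (K ⊗ W) ≫ A ◁ (exch B K W ≫ K ◁ g') ≫ exch A K T ≫ K ◁ e' := by
        intro A B K W W₁ T L e g g' e' h
        have n₁ := exch_natural (𝟙 B) (𝟙 K) e
        have n₂ := exch_natural (𝟙 A) (𝟙 K) g'
        simp only [id_tensorHom] at n₁ n₂
        rw [whiskerLeft_comp, Category.assoc, reassoc_of% n₁, whiskerLeft_comp, Category.assoc,
          reassoc_of% n₂, ← whiskerLeft_comp, h, whiskerLeft_comp, whiskerLeft_comp,
          reassoc_of% exch_braid]
      exact key _ _ _ _ h

end Insertion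

/-- `Matching σ l l'` : the list `l'` is a rearrangement of `σ(l)`. -/
inductive Matching (σ : ι → κ) : List ι → List κ → Type
  | nil : Matching σ [] []
  | cons (a : ι) {l : List ι} {m l' : List κ} (i : Insertion (σ a) m l') (p : Matching σ l m) :
      Matching σ (a :: l) l'

namespace Matching

/-- The permutation of factors along a matching, combined with maps `X a ⟶ Y (σ a)`. -/
def eval {X : ι → C} {Y : κ → C} {σ : ι → κ} (φ : ∀ a, X a ⟶ Y (σ a)) :
    {l : List ι} → {l' : List κ} → Matching σ l l' → (tprod X l ⟶ tprod Y l')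
  | _, _, .nil => 𝟙 (𝟙_ C)
  | _, _, .cons a i p => (φ a ⊗ₘ eval φ p) ≫ i.eval Y

lemma nonempty_of_perm (σ : ι → κ) (l : List ι) {l' : List κ} (h : l'.Perm (l.map σ)) :
    Nonempty (Matching σ l l') := by
  induction l generalizing l' with
  | nil =>
    obtain rfl : l' = [] := by simpa using h
    exact ⟨.nil⟩
  | cons a l ih =>
    obtain ⟨m, ⟨i⟩⟩ := Insertion.exists_of_mem (a := σ a) (l := l') (h.mem_iff.2 (by simp))
    obtain ⟨p⟩ := ih (l' := m) ((List.perm_cons (σ a)).1 (i.perm.symm.trans (by simpa using h)))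
    exact ⟨.cons a i p⟩

lemma unique {σ : ι → κ} {l : List ι} {l' : List κ} (p q : Matching σ l l') (hl : l'.Nodup) :
    p = q := by
  induction p with
  | nil => cases q; rfl
  | cons a i p ih =>
    cases q with
    | cons _ j q =>
      obtain ⟨rfl, h⟩ := i.unique hl j
      obtain rfl := eq_of_heq h
      rw [ih q (List.nodup_cons.1 (i.perm.nodup_iff.1 hl)).2]

lemma exists_insertion {X : ι → C} {Y : κ → C} {σ : ι → κ} (φ : ∀ a, X a ⟶ Y (σ a))
    {l : List ι} {l' : List κ} (q : Matching σ l l') {a : ι} {m : List ι}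
    (i : Insertion a m l) :
    ∃ (t : List κ) (i' : Insertion (σ a) t l') (q' : Matching σ m t),
      i.eval X ≫ q.eval φ = (φ a ⊗ₘ q'.eval φ) ≫ i'.eval Y := by
  induction q generalizing m with
  | nil => cases i
  | cons b j q ih =>
    cases i with
    | here => exact ⟨_, j, q, Category.id_comp _⟩
    | there _ i =>
      obtain ⟨t, i', q', h⟩ := ih i
      obtain ⟨s, j', i'', h'⟩ := Insertion.exchange Y j i'
      refine ⟨s, i'', .cons b j' q', ?_⟩
      have key : ∀ {A B A' B' M L M' L' T S : C} (e : A ⊗ M ⟶ L) (f : A ⟶ A') (g : B ⟶ B')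
          (x : L ⟶ L') (y : M ⟶ M') (e' : A' ⊗ M' ⟶ L') (z : B' ⊗ L' ⟶ T)
          (z' : B' ⊗ M' ⟶ S) (w : A' ⊗ S ⟶ T),
          e ≫ x = (f ⊗ₘ y) ≫ e' →
          B' ◁ e' ≫ z = exch B' A' M' ≫ A' ◁ z' ≫ w →
          (exch A B M ≫ B ◁ e) ≫ (g ⊗ₘ x) ≫ z = (f ⊗ₘ ((g ⊗ₘ y) ≫ z')) ≫ w := by
        intro A B A' B' M L M' L' T S e f g x y e' z z' w h₁ h₂
        have h₃ : B ◁ e ≫ (g ⊗ₘ x) = (g ⊗ₘ (f ⊗ₘ y)) ≫ B' ◁ e' := by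
          rw [← id_tensorHom, tensorHom_comp_tensorHom, h₁, ← id_tensorHom,
            tensorHom_comp_tensorHom]
          simp
        rw [Category.assoc, reassoc_of% h₃, h₂, ← Category.assoc, ← exch_natural]
        simp only [Category.assoc]
        rw [← Category.assoc (exch A' B' M'), exch_exch, Category.id_comp, ← id_tensorHom,
          ← Category.assoc, tensorHom_comp_tensorHom, Category.comp_id]
      exact key _ _ _ _ _ _ _ _ _ h h'

lemma exists_comp {X : ι → C} {Y : κ → C} {Z : μ → C} {σ : ι → κ} {τ : κ → μ}
    (φ : ∀ a, X a ⟶ Y (σ a)) (ψ : ∀ b, Y b ⟶ Z (τ b)) {l : List ι} {l' : List κ} {l'' : List μ}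
    (p : Matching σ l l') (q : Matching τ l' l'') :
    ∃ r : Matching (fun a => τ (σ a)) l l'',
      p.eval φ ≫ q.eval ψ = r.eval (X := X) (Y := Z) (fun a => φ a ≫ ψ (σ a)) := by
  induction p generalizing l'' with
  | nil =>
    cases q
    exact ⟨.nil, Category.id_comp _⟩
  | cons a i p ih =>
    obtain ⟨t, i', q', h⟩ := q.exists_insertion ψ i
    obtain ⟨r, hr⟩ := ih q'
    refine ⟨.cons a i' r, ?_⟩
    have key : ∀ {A A' A'' L L' L'' T T' : C} (f : A ⟶ A') (g : A' ⟶ A'') (x : L ⟶ L')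
        (y : L' ⟶ L'') (z : L ⟶ L'') (e : A' ⊗ L' ⟶ T) (w : T ⟶ T') (e' : A'' ⊗ L'' ⟶ T'),
        e ≫ w = (g ⊗ₘ y) ≫ e' → x ≫ y = z →
        ((f ⊗ₘ x) ≫ e) ≫ w = (f ≫ g ⊗ₘ z) ≫ e' := by
      intro A A' A'' L L' L'' T T' f g x y z e w e' h₁ h₂
      rw [Category.assoc, h₁, ← Category.assoc, tensorHom_comp_tensorHom, h₂]
    exact key _ _ _ _ _ _ _ _ h hr

lemma exists_id (X : ι → C) (l : List ι) :
    ∃ r : Matching (fun a : ι => a) l l, r.eval (X := X) (Y := X) (fun a => 𝟙 (X a)) = 𝟙 _ := by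
  induction l with
  | nil => exact ⟨.nil, rfl⟩
  | cons a l ih =>
    obtain ⟨r, hr⟩ := ih
    refine ⟨.cons a (.here l) r, ?_⟩
    have key : ∀ {A L : C} (x : L ⟶ L), x = 𝟙 L → (𝟙 A ⊗ₘ x) ≫ 𝟙 (A ⊗ L) = 𝟙 (A ⊗ L) := by
      rintro A L _ rfl
      simp
    exact key _ hr

end Matching
/-- The map `X a₁ ⊗ (X a₂ ⊗ ⋯) ⟶ Y b₁ ⊗ (Y b₂ ⊗ ⋯)` which sends the factor `X a` to the
factor `Y (σ a)` by `φ a`, where `[b₁, b₂, …]` is a rearrangement of `[σ a₁, σ a₂, …]`.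
If the `bᵢ` are distinct, it does not depend on the choice of the matching
(see `tprodMap_eq`). -/
noncomputable def tprodMap {X : ι → C} {Y : κ → C} (σ : ι → κ) (φ : ∀ a, X a ⟶ Y (σ a))
    {l : List ι} {l' : List κ} (h : l'.Perm (l.map σ)) : tprod X l ⟶ tprod Y l' :=
  (Matching.nonempty_of_perm σ l h).some.eval φ

lemma tprodMap_eq {X : ι → C} {Y : κ → C} (σ : ι → κ) (φ : ∀ a, X a ⟶ Y (σ a))
    {l : List ι} {l' : List κ} (h : l'.Perm (l.map σ)) (hl : l'.Nodup) (p : Matching σ l l') :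
    tprodMap σ φ h = p.eval φ := by
  have h' := Matching.unique (Matching.nonempty_of_perm σ l h).some p hl
  rw [tprodMap, h']

/-- The tensor product of a family of morphisms. -/
def tprodHom {X Y : ι → C} (φ : ∀ a, X a ⟶ Y a) : (l : List ι) → (tprod X l ⟶ tprod Y l)
  | [] => 𝟙 (𝟙_ C)
  | a :: l => φ a ⊗ₘ tprodHom φ l

/-- The canonical map from a tensor product of copies of the unit object to the unit object. -/
def tprodUnit : (l : List ι) → (tprod (fun _ : ι => 𝟙_ C) l ⟶ 𝟙_ C)
  | [] => 𝟙 (𝟙_ C)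
  | _ :: l => (λ_ (tprod (fun _ : ι => 𝟙_ C) l)).hom ≫ tprodUnit l

/-- The shuffle `(⨂ X a) ⊗ (⨂ Y a) ⟶ ⨂ (X a ⊗ Y a)`. -/
def tprodZip (X Y : ι → C) : (l : List ι) →
    (tprod X l ⊗ tprod Y l ⟶ tprod (fun a => X a ⊗ Y a) l)
  | [] => (λ_ (𝟙_ C)).hom
  | a :: l => tensorμ (X a) (tprod X l) (Y a) (tprod Y l) ≫ (X a ⊗ Y a) ◁ tprodZip X Y l

/-- The tensor product along a concatenation of lists. -/
def tprodAppend (X : ι → C) (l' : List ι) : (l : List ι) →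
    (tprod X (l ++ l') ⟶ tprod X l ⊗ tprod X l')
  | [] => (λ_ (tprod X l')).inv
  | a :: l => X a ◁ tprodAppend X l' l ≫ (α_ (X a) (tprod X l) (tprod X l')).inv

/-- The tensor product along a list that is the image of another one. -/
def tprodOfMap (X : κ → C) (σ : ι → κ) : (l : List ι) →
    (tprod X (l.map σ) ⟶ tprod (fun a => X (σ a)) l)
  | [] => 𝟙 (𝟙_ C)
  | a :: l => X (σ a) ◁ tprodOfMap X σ l

/-- A tensor product over pairs, written as an iterated tensor product. -/
def tprodSigma {β : ι → Type} (X : (Σ a, β a) → C) (s : ∀ a, List (β a)) : (l : List ι) →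
    (tprod X (l.sigma s) ⟶ tprod (fun a => tprod (fun b => X ⟨a, b⟩) (s a)) l)
  | [] => 𝟙 (𝟙_ C)
  | a :: l => tprodAppend X (l.sigma s) ((s a).map (Sigma.mk a)) ≫
      (tprodOfMap X (Sigma.mk a) (s a) ⊗ₘ tprodSigma X s l)

/-- The tensor product `X 0 ⊗ (X 1 ⊗ (⋯ ⊗ 𝟙))` over the standard finite set with `n` elements. -/
abbrev tensorFin {n : ℕ} (X : Fin n → C) : C := tprod X (List.finRange n)

lemma finRange_perm {n m : ℕ} (σ : Fin n ≃ Fin m) :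
    (List.finRange m).Perm ((List.finRange n).map σ) :=
  (List.perm_ext_iff_of_nodup (List.nodup_finRange m)
    ((List.nodup_finRange n).map σ.injective)).2 (fun a => by simpa using σ.surjective a)

/-- The map of tensor products induced by a bijection of the index sets and by maps of the
factors that correspond to each other. -/
noncomputable def tensorFinMap {n m : ℕ} {X : Fin n → C} {Y : Fin m → C} (σ : Fin n ≃ Fin m)
    (φ : ∀ i, X i ⟶ Y (σ i)) : tensorFin X ⟶ tensorFin Y :=
  tprodMap σ φ (finRange_perm σ)

lemma tensorFinMap_id {n : ℕ} (X : Fin n → C) :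
    tensorFinMap (X := X) (Y := X) (Equiv.refl _) (fun i => 𝟙 (X i)) = 𝟙 _ := by
  obtain ⟨r, hr⟩ := Matching.exists_id X (List.finRange n)
  exact (tprodMap_eq _ _ _ (List.nodup_finRange n) r).trans hr

lemma tensorFinMap_comp {n m k : ℕ} {X : Fin n → C} {Y : Fin m → C} {Z : Fin k → C}
    (σ : Fin n ≃ Fin m) (φ : ∀ i, X i ⟶ Y (σ i)) (τ : Fin m ≃ Fin k) (ψ : ∀ i, Y i ⟶ Z (τ i)) :
    tensorFinMap σ φ ≫ tensorFinMap τ ψ =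
      tensorFinMap (X := X) (Y := Z) (σ.trans τ) (fun i => φ i ≫ ψ (σ i)) := by
  obtain ⟨r, hr⟩ := Matching.exists_comp φ ψ
    (Matching.nonempty_of_perm σ _ (finRange_perm σ)).some
    (Matching.nonempty_of_perm τ _ (finRange_perm τ)).some
  exact hr.trans (tprodMap_eq _ _ _ (List.nodup_finRange k) r).symm

end TensorProducts

/-! ### Symmetric sequences -/

/-- A finite set, as an object of the category of finite sets and bijections. -/
structure FinSet : Type 1 where
  /-- The underlying type. -/
  carrier : Type
  /-- It is finite. -/
  finite : Finite carrier

instance : CoeSort FinSet Type := ⟨FinSet.carrier⟩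

/-- The category of finite sets and bijections. -/
instance : Category FinSet where
  Hom J K := J ≃ K
  id J := Equiv.refl J
  comp e e' := Equiv.trans e e'

/-- The standard finite set with `n` elements. -/
def finSet (n : ℕ) : FinSet := ⟨Fin n, inferInstance⟩

/-- A bijection, as a morphism of the category of finite sets. -/
def bij {J K : FinSet} (θ : J ≃ K) : J ⟶ K := θ

/-- A bijection between standard finite sets, as a morphism of the category of finite sets. -/
def finBij {n m : ℕ} (σ : Fin n ≃ Fin m) : finSet n ⟶ finSet m := σ

/-- The fibre of a map defined on a finite set. -/
def fibre {J : FinSet} {κ : Type} (f : J → κ) (k : κ) : FinSet :=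
  ⟨{x : J // f x = k}, have := J.finite; inferInstance⟩

/-- The bijection between fibres induced by a bijection. -/
def fibreMap {J K : FinSet} {κ μ : Type} {f : J → κ} {g : K → μ} {a : κ} {b : μ} (θ : J ≃ K)
    (h : ∀ x, f x = a ↔ g (θ x) = b) : fibre f a ⟶ fibre g b :=
  θ.subtypeEquiv h

variable (C : Type u) [Category.{v} C]

/-- Symmetric sequences in `C`: functors to `C` from the category of finite sets and bijections. -/
abbrev SymSeq := FinSet ⥤ C

/-- For a finite set `J`, the maps from `J` to a standard finite set. -/
structure FinUnder (J : FinSet) where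
  /-- The number of elements of the target. -/
  n : ℕ
  /-- The map. -/
  f : J → Fin n

/-- The morphisms from `f : J → {1, …, n}` to `f' : J → {1, …, n'}` are the bijections `σ`
such that `f' = σ ∘ f`. -/
instance (J : FinSet) : Category (FinUnder J) where
  Hom x y := {σ : Fin x.n ≃ Fin y.n // ∀ j, y.f j = σ (x.f j)}
  id x := ⟨Equiv.refl _, fun _ => rfl⟩
  comp σ τ := ⟨σ.1.trans τ.1, fun j => by simp [τ.2, σ.2]⟩

variable {C}

section CompositionProduct

variable [MonoidalCategory C] [SymmetricCategory C]

/-- `M(I) ⊗ ⨂_{i ∈ I} N(f⁻¹(i))`, for `f : J → I` with `I = {1, …, n}`. -/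
abbrev compTerm (M N : SymSeq C) {J : FinSet} {n : ℕ} (f : J → Fin n) : C :=
  M.obj (finSet n) ⊗ tensorFin (fun i => N.obj (fibre f i))

/-- The map between the terms for `f : J → I` and `f' : J' → I'` induced by bijections `σ : I ≃ I'`
and `θ : J ≃ J'` with `f' ∘ θ = σ ∘ f` and by morphisms `u`, `v` of symmetric sequences. -/
noncomputable def compTermMap {M M' N N' : SymSeq C} (u : M ⟶ M') (v : N ⟶ N') {J J' : FinSet}
    {n n' : ℕ} {f : J → Fin n} {f' : J' → Fin n'} (σ : Fin n ≃ Fin n') (θ : J ≃ J')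
    (h : ∀ j, f' (θ j) = σ (f j)) : compTerm M N f ⟶ compTerm M' N' f' :=
  (M.map (finBij σ) ≫ u.app (finSet n')) ⊗ₘ
    tensorFinMap σ (fun i => N.map (fibreMap θ (by simp [h])) ≫ v.app (fibre f' (σ i)))

lemma compTermMap_id (M N : SymSeq C) {J : FinSet} {n : ℕ} (f : J → Fin n) :
    compTermMap (𝟙 M) (𝟙 N) (f := f) (f' := f) (Equiv.refl _) (Equiv.refl _) (fun _ => rfl) =
      𝟙 _ := by
  have h₁ : M.map (finBij (Equiv.refl (Fin n))) = 𝟙 _ := M.map_id _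
  have h₂ : ∀ i, N.map (fibreMap (f := f) (g := f) (a := i) (b := i) (Equiv.refl _)
    (fun _ => Iff.rfl)) = 𝟙 _ := fun i => N.map_id _
  have h₃ := tensorFinMap_id (fun i => N.obj (fibre f i))
  simp only [compTermMap, NatTrans.id_app, Category.comp_id, h₁]
  refine (congrArg (fun t => 𝟙 _ ⊗ₘ t) (Eq.trans ?_ h₃)).trans (id_tensorHom_id _ _)
  congr 1
  funext i
  exact h₂ i

lemma compTermMap_comp {M M' M'' N N' N'' : SymSeq C} (u : M ⟶ M') (v : N ⟶ N')
    (u' : M' ⟶ M'') (v' : N' ⟶ N'') {J J' J'' : FinSet}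
    {n n' n'' : ℕ} {f : J → Fin n} {f' : J' → Fin n'} {f'' : J'' → Fin n''}
    (σ : Fin n ≃ Fin n') (θ : J ≃ J') (h : ∀ j, f' (θ j) = σ (f j))
    (σ' : Fin n' ≃ Fin n'') (θ' : J' ≃ J'') (h' : ∀ j, f'' (θ' j) = σ' (f' j)) :
    compTermMap u v σ θ h ≫ compTermMap u' v' σ' θ' h' =
      compTermMap (u ≫ u') (v ≫ v') (σ.trans σ') (θ.trans θ') (fun j => by simp [h, h']) := by
  have h₁ : M.map (finBij (σ.trans σ')) =
      M.map (finBij σ) ≫ M.map (finBij σ') := M.map_comp (finBij σ) (finBij σ')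
  have h₂ : ∀ i, N.map (fibreMap (f := f) (g := f'') (a := i) (b := σ' (σ i)) (θ.trans θ')
      (by simp [h, h'])) = N.map (fibreMap (f := f) (g := f') (a := i) (b := σ i) θ
      (by simp [h])) ≫ N.map (fibreMap (f := f') (g := f'') (a := σ i) (b := σ' (σ i)) θ'
      (by simp [h'])) := fun i => N.map_comp (fibreMap θ (by simp [h])) (fibreMap θ' (by simp [h']))
  simp only [compTermMap]
  rw [tensorHom_comp_tensorHom, tensorFinMap_comp, h₁]
  congr 1
  · simp
  · congr 1
    funext i
    refine Eq.trans ?_ (congrArg (fun t => t ≫ (v ≫ v').app (fibre f'' (σ' (σ i)))) (h₂ i).symm)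
    simp

/-- The functor `(M, N)` on the category of maps from `J` to standard finite sets. -/
noncomputable def compDiagram (M N : SymSeq C) (J : FinSet) : FinUnder J ⥤ C where
  obj x := compTerm M N x.f
  map σ := compTermMap (𝟙 M) (𝟙 N) σ.1 (Equiv.refl _) σ.2
  map_id x := compTermMap_id M N x.f
  map_comp σ τ := by
    refine Eq.trans ?_ (compTermMap_comp (𝟙 M) (𝟙 N) (𝟙 M) (𝟙 N) σ.1 (Equiv.refl _) σ.2
      τ.1 (Equiv.refl _) τ.2).symm
    simp only [Category.comp_id]
    rfl

variable [HasColimits C]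

/-- The inclusion of the term for `f` in the composition product. -/
noncomputable abbrev compι (M N : SymSeq C) {J : FinSet} {n : ℕ} (f : J → Fin n) :
    compTerm M N f ⟶ colimit (compDiagram M N J) :=
  colimit.ι (compDiagram M N J) ⟨n, f⟩

lemma compTermMap_ι (M N : SymSeq C) {J : FinSet} {n n' : ℕ} {f : J → Fin n} {f' : J → Fin n'}
    (σ : Fin n ≃ Fin n') (h : ∀ j, f' j = σ (f j)) :
    compTermMap (𝟙 M) (𝟙 N) σ (Equiv.refl _) h ≫ compι M N f' = compι M N f :=
  colimit.w (compDiagram M N J) (j := FinUnder.mk n' f') (j' := FinUnder.mk n f) ⟨σ, h⟩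

/-- The map `(M ∘ N)(J) ⟶ (M' ∘ N')(J')` which maps the term for `f` to the one for `f ∘ θ⁻¹`. -/
noncomputable def compColimMap {M M' N N' : SymSeq C} (u : M ⟶ M') (v : N ⟶ N') {J J' : FinSet}
    (θ : J ≃ J') : colimit (compDiagram M N J) ⟶ colimit (compDiagram M' N' J') :=
  colimit.desc (compDiagram M N J)
    { pt := colimit (compDiagram M' N' J')
      ι :=
        { app := fun x => compTermMap u v (Equiv.refl _) θ (by simp) ≫
            compι M' N' (fun j => x.f (θ.symm j))
          naturality := by
            intro x y σ
            have h₁ := compTermMap_comp (𝟙 M) (𝟙 N) u v σ.1 (Equiv.refl _) σ.2 (Equiv.refl _) θ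
              (f'' := fun j => y.f (θ.symm j)) (by simp)
            have h₂ := compTermMap_comp u v (𝟙 M') (𝟙 N') (f := x.f) (Equiv.refl _) θ
              (f' := fun j => x.f (θ.symm j)) (by simp) (f'' := fun j => y.f (θ.symm j))
              σ.1 (Equiv.refl _) (fun j => σ.2 _)
            have h₃ := compTermMap_ι M' N' (f := fun j => x.f (θ.symm j))
              (f' := fun j => y.f (θ.symm j)) σ.1 (fun j => σ.2 _)
            simp only [Category.comp_id, Category.id_comp] at h₁ h₂
            have h₄ := h₁.trans h₂.symm
            have h₅ := congrArg (fun t => t ≫ compι M' N' (fun j => y.f (θ.symm j))) h₄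
            simp only [Category.assoc] at h₅
            rw [h₃] at h₅
            exact h₅.trans (Category.comp_id _).symm } }

lemma compι_colimMap {M M' N N' : SymSeq C} (u : M ⟶ M') (v : N ⟶ N') {J J' : FinSet}
    (θ : J ≃ J') {n : ℕ} (f : J → Fin n) :
    compι M N f ≫ compColimMap u v θ = compTermMap u v (Equiv.refl _) θ (by simp) ≫
      compι M' N' (fun j => f (θ.symm j)) :=
  colimit.ι_desc _ _

lemma compColimMap_id (M N : SymSeq C) (J : FinSet) :
    compColimMap (𝟙 M) (𝟙 N) (Equiv.refl J) = 𝟙 _ := by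
  refine colimit.hom_ext fun ⟨n, f⟩ => ?_
  refine (compι_colimMap _ _ _ f).trans ?_
  refine (congrArg (fun t => t ≫ compι M N f) (compTermMap_id M N f)).trans ?_
  exact (Category.id_comp _).trans (Category.comp_id _).symm

lemma compColimMap_comp {M M' M'' N N' N'' : SymSeq C} (u : M ⟶ M') (v : N ⟶ N')
    (u' : M' ⟶ M'') (v' : N' ⟶ N'') {J J' J'' : FinSet} (θ : J ≃ J') (θ' : J' ≃ J'') :
    compColimMap u v θ ≫ compColimMap u' v' θ' =
      compColimMap (u ≫ u') (v ≫ v') (θ.trans θ') := by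
  refine colimit.hom_ext fun ⟨n, f⟩ => ?_
  refine Eq.trans ?_ (compι_colimMap _ _ _ f).symm
  refine (Category.assoc _ _ _).symm.trans ?_
  refine (congrArg (fun t => t ≫ compColimMap u' v' θ') (compι_colimMap u v θ f)).trans ?_
  refine (Category.assoc _ _ _).trans ?_
  refine (congrArg (fun t => _ ≫ t) (compι_colimMap u' v' θ' _)).trans ?_
  refine (Category.assoc _ _ _).symm.trans ?_
  exact congrArg (fun t => t ≫ compι M'' N'' (fun j => f (θ.symm (θ'.symm j))))
    (compTermMap_comp _ _ _ _ _ _ _ _ _ _)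

/-- The composition product `M ∘ N` of symmetric sequences, with
`(M ∘ N)(J) = colim_{f : J → I} M(I) ⊗ ⨂_{i ∈ I} N(f⁻¹(i))`. -/
noncomputable def compObj (M N : SymSeq C) : SymSeq C where
  obj J := colimit (compDiagram M N J)
  map θ := compColimMap (𝟙 M) (𝟙 N) θ
  map_id J := compColimMap_id M N J
  map_comp θ θ' := by
    refine Eq.trans ?_ (compColimMap_comp (𝟙 M) (𝟙 N) (𝟙 M) (𝟙 N) θ θ').symm
    simp only [Category.comp_id]
    rfl

/-- The composition product of morphisms of symmetric sequences. -/
noncomputable def compMap {M M' N N' : SymSeq C} (u : M ⟶ M') (v : N ⟶ N') :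
    compObj M N ⟶ compObj M' N' where
  app J := compColimMap u v (Equiv.refl J)
  naturality J J' θ := by
    refine (compColimMap_comp (𝟙 M) (𝟙 N) u v θ (Equiv.refl _)).trans
      (Eq.trans ?_ (compColimMap_comp u v (𝟙 M') (𝟙 N') (Equiv.refl _) θ).symm)
    simp only [Category.comp_id, Category.id_comp]
    rfl

lemma compMap_id (M N : SymSeq C) : compMap (𝟙 M) (𝟙 N) = 𝟙 (compObj M N) := by
  ext J
  exact compColimMap_id M N J

lemma compMap_comp {M M' M'' N N' N'' : SymSeq C} (u : M ⟶ M') (v : N ⟶ N')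
    (u' : M' ⟶ M'') (v' : N' ⟶ N'') :
    compMap u v ≫ compMap u' v' = compMap (u ≫ u') (v ≫ v') := by
  ext J
  exact compColimMap_comp u v u' v' (Equiv.refl J) (Equiv.refl J)

end CompositionProduct

section Unit

variable [MonoidalCategory C] [HasColimits C]

/-- The value of the unit symmetric sequence. -/
noncomputable def unitObj (C : Type u) [Category.{v} C] [MonoidalCategory C] [HasColimits C]
    (J : FinSet) : C :=
  if Nat.card J = 1 then 𝟙_ C else ⊥_ C

lemma unitObj_congr {J K : FinSet} (θ : J ⟶ K) : unitObj C J = unitObj C K := by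
  unfold unitObj
  rw [Nat.card_congr θ]

lemma unitObj_eq {J : FinSet} (h : Nat.card J = 1) : unitObj C J = 𝟙_ C := if_pos h

/-- The unit symmetric sequence: the unit object of `C` on the sets with one element, and the
initial object on the other ones; bijections act by identities. -/
noncomputable def unitSeq (C : Type u) [Category.{v} C] [MonoidalCategory C] [HasColimits C] :
    SymSeq C where
  obj J := unitObj C J
  map θ := eqToHom (unitObj_congr θ)

end Unit

/-! ### The monoidal category of symmetric sequences -/

/-- For `J → {1, …, m} → {1, …, n}` and enumerations `e k` of the fibres `g⁻¹(k)`, the map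
`(gf)⁻¹(k) → {1, …, r k}`. -/
def fibreComp {J : FinSet} {m n : ℕ} (f : J → Fin m) (g : Fin m → Fin n) {r : Fin n → ℕ}
    (e : ∀ k, {i // g i = k} ≃ Fin (r k)) (k : Fin n) :
    fibre (J := J) (fun x => g (f x)) k → Fin (r k) :=
  fun x => e k ⟨f x.1, x.2⟩

/-- The enumeration of `{1, …, m}` by pairs `(k, j)` given by enumerations of the fibres of `g`. -/
def pairing {m n : ℕ} (g : Fin m → Fin n) {r : Fin n → ℕ}
    (e : ∀ k, {i // g i = k} ≃ Fin (r k)) : Fin m ≃ (Σ k, Fin (r k)) :=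
  (Equiv.sigmaFiberEquiv g).symm.trans (Equiv.sigmaCongrRight e)

lemma pairing_perm {m n : ℕ} (g : Fin m → Fin n) {r : Fin n → ℕ}
    (e : ∀ k, {i // g i = k} ≃ Fin (r k)) :
    ((List.finRange n).sigma (fun k => List.finRange (r k))).Perm
      ((List.finRange m).map (pairing g e)) :=
  (List.perm_ext_iff_of_nodup
    ((List.nodup_finRange n).sigma (fun k => List.nodup_finRange (r k)))
    ((List.nodup_finRange m).map (pairing g e).injective)).2 (fun ⟨k, j⟩ => by
      simpa [List.mem_sigma] using (pairing g e).surjective ⟨k, j⟩)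

/-- The bijection between `f⁻¹(i)` and the corresponding fibre of `fibreComp`. -/
def fibreCompEquiv {J : FinSet} {m n : ℕ} (f : J → Fin m) (g : Fin m → Fin n) {r : Fin n → ℕ}
    (e : ∀ k, {i // g i = k} ≃ Fin (r k)) (i : Fin m) :
    fibre f i ⟶ fibre (fibreComp f g e (pairing g e i).1) (pairing g e i).2 where
  toFun x := ⟨⟨x.1, congrArg g x.2⟩, congrArg (e (g i)) (Subtype.ext x.2)⟩
  invFun x := ⟨x.1.1, congrArg Subtype.val ((e (g i)).injective x.2)⟩
  left_inv _ := rfl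
  right_inv _ := rfl

section Monoidal

variable [MonoidalCategory C] [SymmetricCategory C] [HasColimits C]

/-- For `f : J → {1, …, m}` and `g : {1, …, m} → {1, …, n}`, the canonical map
`(M(n) ⊗ ⨂_k N(g⁻¹(k))) ⊗ ⨂_i P(f⁻¹(i)) ⟶ M(n) ⊗ ⨂_k (N(g⁻¹(k)) ⊗ ⨂_{i ∈ g⁻¹(k)} P(f⁻¹(i)))`
of the symmetric monoidal category `C`, where `g⁻¹(k)` is identified with `{1, …, r k}` in the
target. -/
noncomputable def assocShuffle (M N P : SymSeq C) {J : FinSet} {m n : ℕ} (f : J → Fin m)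
    (g : finSet m → Fin n) {r : Fin n → ℕ} (e : ∀ k, {i : Fin m // g i = k} ≃ Fin (r k)) :
    compTerm M N g ⊗ tensorFin (fun i => P.obj (fibre f i)) ⟶
      M.obj (finSet n) ⊗ tensorFin (fun k => compTerm N P (fibreComp f g e k)) :=
  (α_ _ _ _).hom ≫ M.obj (finSet n) ◁
    ((tprodHom (fun k => N.map (bij (J := fibre g k) (K := finSet (r k)) (e k))) (List.finRange n) ⊗ₘ
        (tprodMap (Y := fun p : (Σ k, Fin (r k)) => P.obj (fibre (fibreComp f g e p.1) p.2))
            (pairing g e) (fun i => P.map (fibreCompEquiv f g e i)) (pairing_perm g e) ≫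
          tprodSigma _ (fun k => List.finRange (r k)) (List.finRange n))) ≫
      tprodZip (fun k => N.obj (finSet (r k)))
        (fun k => tensorFin (fun j => P.obj (fibre (fibreComp f g e k) j))) (List.finRange n))

/-- For `f : J → {1}`, the canonical map `𝕀({1}) ⊗ M(f⁻¹(1)) ⟶ M(J)`. -/
noncomputable def leftUnitTerm (M : SymSeq C) {J : FinSet} (f : J → Fin 1) :
    compTerm (unitSeq C) M f ⟶ M.obj J :=
  (eqToHom (unitObj_eq (J := finSet 1) (Nat.card_fin 1)) ⊗ₘ
    ((ρ_ (M.obj (fibre f 0))).hom ≫ M.map (bij (J := fibre f 0) (K := J)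
      (Equiv.subtypeUnivEquiv (fun _ => Subsingleton.elim _ _))))) ≫ (λ_ (M.obj J)).hom

lemma card_fibre_equiv {J : FinSet} {n : ℕ} (f : J ≃ Fin n) (i : Fin n) :
    Nat.card (fibre f i) = 1 :=
  (Nat.card_congr (f.subtypeEquiv (p := fun x => f x = i) (q := fun k => k = i)
    (fun _ => Iff.rfl))).trans (by simp)

/-- For a bijection `f : J → {1, …, n}`, the canonical map `M(n) ⊗ ⨂_i 𝕀(f⁻¹(i)) ⟶ M(J)`. -/
noncomputable def rightUnitTerm (M : SymSeq C) {J : FinSet} {n : ℕ} (f : J ≃ Fin n) :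
    compTerm M (unitSeq C) f ⟶ M.obj J :=
  (M.map (bij (J := finSet n) (K := J) f.symm) ⊗ₘ
    (tprodHom (fun i => eqToHom (unitObj_eq (card_fibre_equiv f i))) (List.finRange n) ≫
      tprodUnit (List.finRange n))) ≫ (ρ_ (M.obj J)).hom

variable (C) in
/-- The assertion that symmetric sequences in `C` form a monoidal category for the composition
product `∘`, with the unit symmetric sequence as unit object: the associativity and unit
isomorphisms are the canonical ones, given on the terms of the colimits by the coherence
isomorphisms of `C`, and they satisfy the axioms of a monoidal category. -/
structure CompositionMonoidal where
  /-- The associativity isomorphism. -/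
  associator (M N P : SymSeq C) : compObj (compObj M N) P ≅ compObj M (compObj N P)
  /-- The left unit isomorphism. -/
  leftUnitor (M : SymSeq C) : compObj (unitSeq C) M ≅ M
  /-- The right unit isomorphism. -/
  rightUnitor (M : SymSeq C) : compObj M (unitSeq C) ≅ M
  ι_associator (M N P : SymSeq C) {J : FinSet} {m n : ℕ} (f : J → Fin m)
    (g : finSet m → Fin n) {r : Fin n → ℕ} (e : ∀ k, {i : Fin m // g i = k} ≃ Fin (r k)) :
    compι M N g ▷ tensorFin (fun i => P.obj (fibre f i)) ≫ compι (compObj M N) P f ≫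
        (associator M N P).hom.app J =
      assocShuffle M N P f g e ≫ M.obj (finSet n) ◁
        tprodHom (Y := fun k => (compObj N P).obj (fibre (J := J) (fun x => g (f x)) k))
          (fun k => compι N P (fibreComp f g e k)) (List.finRange n) ≫
          compι M (compObj N P) (fun x => g (f x))
  ι_leftUnitor (M : SymSeq C) {J : FinSet} (f : J → Fin 1) :
    compι (unitSeq C) M f ≫ (leftUnitor M).hom.app J = leftUnitTerm M f
  ι_rightUnitor (M : SymSeq C) {J : FinSet} {n : ℕ} (f : J ≃ Fin n) :
    compι M (unitSeq C) f ≫ (rightUnitor M).hom.app J = rightUnitTerm M f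
  associator_naturality {M M' N N' P P' : SymSeq C} (u : M ⟶ M') (v : N ⟶ N') (w : P ⟶ P') :
    compMap (compMap u v) w ≫ (associator M' N' P').hom =
      (associator M N P).hom ≫ compMap u (compMap v w)
  leftUnitor_naturality {M M' : SymSeq C} (u : M ⟶ M') :
    compMap (𝟙 (unitSeq C)) u ≫ (leftUnitor M').hom = (leftUnitor M).hom ≫ u
  rightUnitor_naturality {M M' : SymSeq C} (u : M ⟶ M') :
    compMap u (𝟙 (unitSeq C)) ≫ (rightUnitor M').hom = (rightUnitor M).hom ≫ u
  pentagon (M N P Q : SymSeq C) :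
    compMap (associator M N P).hom (𝟙 Q) ≫ (associator M (compObj N P) Q).hom ≫
        compMap (𝟙 M) (associator N P Q).hom =
      (associator (compObj M N) P Q).hom ≫ (associator M N (compObj P Q)).hom
  triangle (M N : SymSeq C) :
    (associator M (unitSeq C) N).hom ≫ compMap (𝟙 M) (leftUnitor N).hom =
      compMap (rightUnitor M).hom (𝟙 N)

/-- The monoidal category of symmetric sequences with the composition product. -/
@[reducible]
noncomputable def CompositionMonoidal.monoidalCategory (h : CompositionMonoidal C) :
    MonoidalCategory (SymSeq C) :=
  letI : MonoidalCategoryStruct (SymSeq C) :=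
    { tensorObj := compObj
      tensorHom := fun u v => compMap u v
      whiskerLeft := fun M _ _ v => compMap (𝟙 M) v
      whiskerRight := fun u N => compMap u (𝟙 N)
      tensorUnit := unitSeq C
      associator := h.associator
      leftUnitor := h.leftUnitor
      rightUnitor := h.rightUnitor }
  MonoidalCategory.ofTensorHom
    (id_tensorHom_id := compMap_id)
    (id_tensorHom := fun _ _ _ _ => rfl)
    (tensorHom_id := fun _ _ => rfl)
    (tensorHom_comp_tensorHom := fun u v u' v' => compMap_comp u v u' v')
    (associator_naturality := h.associator_naturality)
    (leftUnitor_naturality := h.leftUnitor_naturality)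
    (rightUnitor_naturality := h.rightUnitor_naturality)
    (pentagon := h.pentagon)
    (triangle := h.triangle)

end Monoidal

/-! ### Model categories and Quillen pairs -/

section Model

/-- A model category is cofibrantly generated if there are sets `I` and `J` of morphisms that
permit the small object argument, such that the fibrations are the morphisms with the right
lifting property with respect to `J`, and the trivial fibrations are those with the right lifting
property with respect to `I`. -/
def IsCofibrantlyGenerated (C : Type u) [Category.{v} C] [ModelCategory C] : Prop :=
  ∃ I J : MorphismProperty C,
    MorphismProperty.HasSmallObjectArgument.{v} I ∧
    MorphismProperty.HasSmallObjectArgument.{v} J ∧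
    fibrations C = J.rlp ∧ trivialFibrations C = I.rlp

/-- A symmetric monoidal model category: the tensor product preserves colimits in each variable
(by symmetry, it is enough to require this for one of them), the pushout-product axiom holds, and
so does the unit axiom. -/
class IsSymmetricMonoidalModelCategory (C : Type u) [Category.{v} C] [ModelCategory C]
    [MonoidalCategory C] [SymmetricCategory C] : Prop where
  preservesColimits (X : C) : PreservesColimits (tensorLeft X)
  pushoutProduct_cofibration {A B X Y : C} (i : A ⟶ B) (j : X ⟶ Y) [Cofibration i]
    [Cofibration j] :
    Cofibration ((MonoidalCategory.Arrow.pushoutProduct.obj (Arrow.mk i)).obj (Arrow.mk j)).hom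
  pushoutProduct_weakEquivalence_left {A B X Y : C} (i : A ⟶ B) (j : X ⟶ Y) [Cofibration i]
    [Cofibration j] [WeakEquivalence i] :
    WeakEquivalence
      ((MonoidalCategory.Arrow.pushoutProduct.obj (Arrow.mk i)).obj (Arrow.mk j)).hom
  pushoutProduct_weakEquivalence_right {A B X Y : C} (i : A ⟶ B) (j : X ⟶ Y) [Cofibration i]
    [Cofibration j] [WeakEquivalence j] :
    WeakEquivalence
      ((MonoidalCategory.Arrow.pushoutProduct.obj (Arrow.mk i)).obj (Arrow.mk j)).hom
  unit_weakEquivalence {Q : C} (q : Q ⟶ 𝟙_ C) [IsCofibrant Q] [WeakEquivalence q] (X : C)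
    [IsCofibrant X] : WeakEquivalence (q ▷ X)

variable {C : Type u₁} [Category.{v₁} C] {D : Type u₂} [Category.{v₂} D]
variable {F : C ⥤ D} {R : D ⥤ C}

/-- An adjoint pair `F ⊣ R` between model categories is a Quillen pair if `R` preserves fibrations
and trivial fibrations. -/
structure IsQuillenPair [ModelCategory C] [ModelCategory D] (_ : F ⊣ R) : Prop where
  map_fibration {X Y : D} (p : X ⟶ Y) [Fibration p] : Fibration (R.map p)
  map_trivialFibration {X Y : D} (p : X ⟶ Y) [Fibration p] [WeakEquivalence p] :
    WeakEquivalence (R.map p)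

/-- A Quillen pair is a Quillen equivalence if the derived functors between the homotopy
categories are equivalences of categories. -/
structure IsQuillenEquivalence [ModelCategory C] [ModelCategory D] (adj : F ⊣ R) : Prop where
  isQuillenPair : IsQuillenPair adj
  leftDerived : ∃ (LF : (weakEquivalences C).Localization ⥤ (weakEquivalences D).Localization)
    (α : (weakEquivalences C).Q ⋙ LF ⟶ F ⋙ (weakEquivalences D).Q),
    LF.IsLeftDerivedFunctor α (weakEquivalences C) ∧ LF.IsEquivalence
  rightDerived : ∃ (RR : (weakEquivalences D).Localization ⥤ (weakEquivalences C).Localization)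
    (β : R ⋙ (weakEquivalences C).Q ⟶ (weakEquivalences D).Q ⋙ RR),
    RR.IsRightDerivedFunctor β (weakEquivalences D) ∧ RR.IsEquivalence

/-- A Quillen pair whose right adjoint is lax monoidal is a weak monoidal Quillen pair if the
adjoint `F (X ⊗ Y) ⟶ F X ⊗ F Y` of `X ⊗ Y ⟶ R (F X) ⊗ R (F Y) ⟶ R (F X ⊗ F Y)` is a weak
equivalence for all cofibrant `X` and `Y`, and if `F Q ⟶ F 𝟙 ⟶ 𝟙` is a weak equivalence for all
cofibrant replacements `Q ⟶ 𝟙` of the unit object. -/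
structure IsWeakMonoidalQuillenPair [ModelCategory C] [ModelCategory D] [MonoidalCategory C]
    [MonoidalCategory D] (adj : F ⊣ R) [R.LaxMonoidal] : Prop where
  isQuillenPair : IsQuillenPair adj
  tensor (X Y : C) [IsCofibrant X] [IsCofibrant Y] :
    WeakEquivalence ((adj.homEquiv (X ⊗ Y) (F.obj X ⊗ F.obj Y)).symm
      ((adj.unit.app X ⊗ₘ adj.unit.app Y) ≫ Functor.LaxMonoidal.μ R (F.obj X) (F.obj Y)))
  unit {Q : C} (q : Q ⟶ 𝟙_ C) [IsCofibrant Q] [WeakEquivalence q] :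
    WeakEquivalence (F.map q ≫
      (adj.homEquiv (𝟙_ C) (𝟙_ D)).symm (Functor.LaxMonoidal.ε R))

/-- The projective model structure on symmetric sequences: the fibrations and the weak equivalences
are defined objectwise. -/
structure IsProjective (C : Type u) [Category.{v} C] [ModelCategory C]
    [ModelCategory (SymSeq C)] : Prop where
  fibration_iff {M N : SymSeq C} (p : M ⟶ N) : Fibration p ↔ ∀ J, Fibration (p.app J)
  weakEquivalence_iff {M N : SymSeq C} (p : M ⟶ N) :
    WeakEquivalence p ↔ ∀ J, WeakEquivalence (p.app J)

/-- The functor on symmetric sequences which applies a functor aritywise. -/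
abbrev aritywise (F : C ⥤ D) : SymSeq C ⥤ SymSeq D := (Functor.whiskeringRight FinSet C D).obj F

/-- The adjoint pair on symmetric sequences which is aritywise a given one. -/
abbrev aritywiseAdj (adj : F ⊣ R) : aritywise F ⊣ aritywise R := adj.whiskerRight FinSet

/-- The iterated lax monoidal structure map `⨂ R (X a) ⟶ R (⨂ X a)`. -/
def laxTprod [MonoidalCategory C] [MonoidalCategory D] (R : D ⥤ C) [R.LaxMonoidal] {ι : Type}
    (X : ι → D) : (l : List ι) → (tprod (fun a => R.obj (X a)) l ⟶ R.obj (tprod X l))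
  | [] => Functor.LaxMonoidal.ε R
  | a :: l => R.obj (X a) ◁ laxTprod R X l ≫ Functor.LaxMonoidal.μ R (X a) (tprod X l)

/-- A lax monoidal structure, with respect to the composition product, on the aritywise extension
of `R` to symmetric sequences is induced by the one of `R` if it is given by the structure maps
of `R` on the terms of the composition product, and on the sets with one element. -/
structure IsInducedLaxMonoidal [MonoidalCategory C] [SymmetricCategory C] [HasColimits C]
    [MonoidalCategory D] [SymmetricCategory D] [HasColimits D] (R : D ⥤ C) [R.LaxMonoidal]
    (hC : CompositionMonoidal C) (hD : CompositionMonoidal D)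
    (lax : @Functor.LaxMonoidal (SymSeq D) _ hD.monoidalCategory (SymSeq C) _ hC.monoidalCategory
      (aritywise R)) : Prop where
  ι_μ (A B : SymSeq D) {J : FinSet} {n : ℕ} (f : J → Fin n) :
    compι ((aritywise R).obj A) ((aritywise R).obj B) f ≫ NatTrans.app (lax.μ A B) J =
      R.obj (A.obj (finSet n)) ◁
          laxTprod R (fun i => B.obj (fibre f i)) (List.finRange n) ≫
        Functor.LaxMonoidal.μ R (A.obj (finSet n)) (tensorFin (fun i => B.obj (fibre f i))) ≫
          R.map (compι A B f)
  ε_app {J : FinSet} (h : Nat.card J = 1) :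
    NatTrans.app lax.ε J = eqToHom (unitObj_eq h) ≫ Functor.LaxMonoidal.ε R ≫
      R.map (eqToHom (unitObj_eq h).symm)

end Model

end SymmetricSequences

/-! Projective structures. Let `K` have finite hom sets and a small family of representatives `k s`
of its isomorphism classes. Evaluation at `k s` has a left adjoint, the free diagram functor, so
objectwise (trivial) fibrations are the maps with the right lifting property against the free
diagrams on generating (trivial) cofibrations. These permit the small object argument, because
evaluation turns a cell complex built from them into one built from the original generators.
Evaluation also has a right adjoint, given by finite products; hence a map lifting against all
objectwise fibrations is objectwise a trivial cofibration, which is the acyclicity condition needed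
for the transfer. The same argument shows that projectively cofibrant diagrams have cofibrant
values.

Quillen equivalences. A Quillen pair is a Quillen equivalence exactly when, for `X` cofibrant and
`Y` fibrant, a map `F X ⟶ Y` is a weak equivalence if and only if its adjoint `X ⟶ R Y` is
(`weakEquivalence_homEquiv_iff`, `isQuillenEquivalence`). This rests on the saturation of weak
equivalences, `weakEquivalence_iff_isIso_map`, and on the derived adjunction. For diagrams the
criterion is checked objectwise.

Composition products. The maps `φ` and `ν` act on each term of the colimit and are compatible with
every coherence map of `C` and `D`, so they descend to a lax structure for `∘`. At `J`, the
comparison `λ̄(A ∘ B) ⟶ λ̄A ∘ λ̄B` is the colimit over `FinUnder J` of the maps `λ(A(n) ∧ ⋀ B(f⁻¹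
i)) ⟶ λA(n) ∧ ⋀ λB(f⁻¹ i)`. Each of them is a weak equivalence, by induction on the number of
factors. Both diagrams are projectively cofibrant (`isCofibrant_compDiagram`), and `colim` is left
Quillen for the projective structure, so Ken Brown's lemma gives a weak equivalence on colimits. For
the unit, one-element sets give the unit condition on `(λ, R)`, and all other sets give initial
objects. -/

namespace SymmetricSequences

/-! ### Projective model structures on categories of diagrams -/

section Projective

universe w v' u'

variable {K : Type u'} [Category.{0} K] [∀ x y : K, Finite (x ⟶ y)]
variable {C : Type u} [Category.{v} C]

/-- The maps of free diagrams on the maps of `I`, generated at the objects `k s`. -/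
noncomputable def freeMaps [HasFiniteCoproducts C] {S : Type} (k : S → K)
    (I : MorphismProperty C) : MorphismProperty (K ⥤ C) :=
  ⨆ s, MorphismProperty.ofHoms (fun i : I.toSet => (evaluationLeftAdjoint C (k s)).map i.1.hom)

lemma freeMaps_iff [HasFiniteCoproducts C] {S : Type} (k : S → K)
    (I : MorphismProperty C) {X Y : K ⥤ C} (f : X ⟶ Y) :
    freeMaps k I f ↔ ∃ (s : S) (A B : C) (i : A ⟶ B) (_ : I i),
      CategoryTheory.Arrow.mk f =
        CategoryTheory.Arrow.mk ((evaluationLeftAdjoint C (k s)).map i) := by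
  simp only [freeMaps, MorphismProperty.iSup_iff, MorphismProperty.ofHoms_iff]
  constructor
  · rintro ⟨s, ⟨i, hi⟩, h⟩
    exact ⟨s, _, _, i.hom, hi, h⟩
  · rintro ⟨s, A, B, i, hi, h⟩
    exact ⟨s, ⟨CategoryTheory.Arrow.mk i, hi⟩, h⟩

lemma freeMaps_mk [HasFiniteCoproducts C] {S : Type} (k : S → K)
    (I : MorphismProperty C) (s : S) {A B : C} (i : A ⟶ B) (hi : I i) :
    freeMaps k I ((evaluationLeftAdjoint C (k s)).map i) :=
  (freeMaps_iff k I _).2 ⟨s, A, B, i, hi, rfl⟩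

/-- The free diagram functor at `k s` is left adjoint to evaluation there, so lifting against a free
map amounts to lifting at the component `k s`. The other components are isomorphic to these as
arrows. -/
lemma rlp_freeMaps [HasFiniteCoproducts C] {S : Type} (k : S → K)
    (hk : ∀ x, ∃ s, Nonempty (k s ≅ x)) (I : MorphismProperty C) :
    (freeMaps k I).rlp = I.rlp.functorCategory K := by
  ext X Y p
  constructor
  · intro hp x
    obtain ⟨s, ⟨e⟩⟩ := hk x
    refine (I.rlp.arrow_mk_iso_iff (CategoryTheory.Arrow.isoMk (X.mapIso e) (Y.mapIso e)
      (f := CategoryTheory.Arrow.mk (p.app (k s)))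
      (g := CategoryTheory.Arrow.mk (p.app x)) (by simp))).1 ?_
    intro A B i hi
    have := hp _ (freeMaps_mk k I s i hi)
    exact ((evaluationAdjunctionRight C (k s)).hasLiftingProperty_iff i p).1 this
  · intro hp A B f hf
    obtain ⟨s, A', B', i, hi, h⟩ := (freeMaps_iff k I f).1 hf
    have h₁ : HasLiftingProperty i (p.app (k s)) := hp (k s) i hi
    have h₂ : HasLiftingProperty ((evaluationLeftAdjoint C (k s)).map i) p :=
      ((evaluationAdjunctionRight C (k s)).hasLiftingProperty_iff i p).2 h₁
    exact HasLiftingProperty.of_arrow_iso_left (eqToIso h.symm) p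

lemma coproducts_of_cofan {W : MorphismProperty C} {ι : Type w} {A B : ι → C} {X Y : C}
    {c : ∀ i, A i ⟶ X} {d : ∀ i, B i ⟶ Y} (hc : IsColimit (Cofan.mk X c))
    (hd : IsColimit (Cofan.mk Y d)) (g : ∀ i, A i ⟶ B i) (hg : ∀ i, W (g i))
    (f : X ⟶ Y) (hf : ∀ i, c i ≫ f = g i ≫ d i) :
    MorphismProperty.coproducts.{w} W f :=
  MorphismProperty.colimitsOfShape_le_coproducts _ ι _
    (.mk' _ _ _ _ hc hd (Discrete.natTrans fun i => g i.as) (fun i => hg i.as) f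
      (fun i => hf i.as))

lemma exists_cofan_of_coproducts {W : MorphismProperty C} {X Y : C} (f : X ⟶ Y)
    (hf : MorphismProperty.coproducts.{w} W f) :
    ∃ (ι : Type w) (A B : ι → C) (c : ∀ i, A i ⟶ X) (d : ∀ i, B i ⟶ Y)
      (_ : IsColimit (Cofan.mk X c)) (_ : IsColimit (Cofan.mk Y d)) (g : ∀ i, A i ⟶ B i),
      (∀ i, W (g i)) ∧ ∀ i, c i ≫ f = g i ≫ d i := by
  rw [MorphismProperty.coproducts_iff] at hf
  obtain ⟨ι, ⟨X₁, X₂, c₁, c₂, h₁, h₂, φ, hφ⟩⟩ := hf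
  let e₁ : Discrete.functor (fun i => X₁.obj ⟨i⟩) ≅ X₁ := Discrete.natIso (fun _ => Iso.refl _)
  let e₂ : Discrete.functor (fun i => X₂.obj ⟨i⟩) ≅ X₂ := Discrete.natIso (fun _ => Iso.refl _)
  refine ⟨ι, fun i => X₁.obj ⟨i⟩, fun i => X₂.obj ⟨i⟩, fun i => c₁.ι.app ⟨i⟩,
    fun i => c₂.ι.app ⟨i⟩,
    ((IsColimit.precomposeHomEquiv e₁ _).symm h₁).ofIsoColimit (Cocone.ext (Iso.refl _) ?_),
    ((IsColimit.precomposeHomEquiv e₂ _).symm h₂).ofIsoColimit (Cocone.ext (Iso.refl _) ?_),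
    fun i => φ.app ⟨i⟩, fun i => hφ ⟨i⟩, fun i => ?_⟩
  · rintro ⟨i⟩; simp [e₁]
  · rintro ⟨i⟩; simp [e₂]
  · simp

lemma coproducts_coproducts (W : MorphismProperty C) :
    MorphismProperty.coproducts.{w} (MorphismProperty.coproducts.{w} W) ≤
      MorphismProperty.coproducts.{w} W := by
  intro X Y f hf
  obtain ⟨ι, A, B, c, d, hc, hd, g, hg, hf⟩ := exists_cofan_of_coproducts f hf
  choose κ A' B' c' d' hc' hd' g' hg' hf' using fun i => exists_cofan_of_coproducts _ (hg i)
  refine coproducts_of_cofan (Cofan.isColimitTrans _ hc c' hc')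
    (Cofan.isColimitTrans _ hd d' hd') (fun p : (Σ i, κ i) => g' p.1 p.2) (fun p => hg' _ _) f ?_
  rintro ⟨i, j⟩
  have h₁ : c i ≫ f = g i ≫ d i := hf i
  change (c' i j ≫ c i) ≫ f = g' i j ≫ d' i j ≫ d i
  rw [Category.assoc, h₁, reassoc_of% hf' i j]

/-- The free diagram on `A` generated at `k s` takes at `x` the value `∐ A` over the finite set `k s
⟶ x`, so a free map on `i` is at `x` a coproduct of copies of `i`. This and the next two lemmas let
evaluation carry cells to cells. -/
lemma freeMaps_app [HasFiniteCoproducts C] {S : Type} (k : S → K)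
    (I : MorphismProperty C) {X Y : K ⥤ C} (f : X ⟶ Y) (hf : freeMaps k I f) (x : K) :
    MorphismProperty.coproducts.{w} I (f.app x) := by
  obtain ⟨s, A, B, i, hi, h⟩ := (freeMaps_iff k I f).1 hf
  have h₁ : MorphismProperty.coproducts.{w} I (((evaluationLeftAdjoint C (k s)).map i).app x) := by
    refine MorphismProperty.coproducts_of_small _ _
      (MorphismProperty.colimitsOfShape.mk' _ _ _ _
        (coproductIsCoproduct (fun _ : k s ⟶ x => A)) (coproductIsCoproduct (fun _ : k s ⟶ x => B))
        (Discrete.natTrans fun _ => i) (fun _ => hi) _ ?_)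
    rintro ⟨g⟩
    simp [evaluationLeftAdjoint]
  have e : CategoryTheory.Arrow.mk (f.app x) =
      CategoryTheory.Arrow.mk (((evaluationLeftAdjoint C (k s)).map i).app x) :=
    congrArg (((evaluation K C).obj x).mapArrow.obj) h
  exact (MorphismProperty.arrow_mk_mem_toSet_iff _ _).1
    (e ▸ (MorphismProperty.arrow_mk_mem_toSet_iff _ _).2 h₁)

lemma coproducts_freeMaps_app [HasColimits C] {S : Type} (k : S → K)
    (I : MorphismProperty C) {X Y : K ⥤ C} (f : X ⟶ Y)
    (hf : MorphismProperty.coproducts.{v} (freeMaps k I) f) (x : K) :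
    MorphismProperty.coproducts.{v} I (f.app x) := by
  obtain ⟨ι, A, B, c, d, hc, hd, g, hg, hf⟩ := exists_cofan_of_coproducts f hf
  refine coproducts_coproducts I _ (coproducts_of_cofan
    (isColimitCofanMkObjOfIsColimit ((evaluation K C).obj x) _ _ hc)
    (isColimitCofanMkObjOfIsColimit ((evaluation K C).obj x) _ _ hd)
    (fun i => (g i).app x) (fun i => freeMaps_app k I _ (hg i) x) _ fun i => ?_)
  exact NatTrans.congr_app (hf i) x

lemma pushouts_freeMaps_app [HasColimits C] {S : Type} (k : S → K)
    (I : MorphismProperty C) {X Y : K ⥤ C} (f : X ⟶ Y)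
    (hf : (MorphismProperty.coproducts.{v} (freeMaps k I)).pushouts f) (x : K) :
    (MorphismProperty.coproducts.{v} I).pushouts (f.app x) := by
  obtain ⟨_, _, m, a, b, hm, sq⟩ := hf
  exact MorphismProperty.pushouts_mk _ (sq.map ((evaluation K C).obj x))
    (coproducts_freeMaps_app k I m hm x)

-- A natural transformation is determined by its components at the representatives. This is needed
-- because the objects of `K`, for example of `FinSet`, may live in a larger universe.
omit [∀ x y : K, Finite (x ⟶ y)] in
lemma locallySmall_functor {S : Type} (k : S → K) (hk : ∀ x, ∃ s, Nonempty (k s ≅ x)) :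
    LocallySmall.{v} (K ⥤ C) where
  hom_small X Y := by
    refine small_of_injective (β := ∀ s, X.obj (k s) ⟶ Y.obj (k s)) (f := fun f s => f.app (k s)) ?_
    intro f g h
    ext x
    obtain ⟨s, ⟨e⟩⟩ := hk x
    have := congrFun h s
    dsimp at this
    rw [← cancel_epi (X.map e.hom), f.naturality, g.naturality, this]

/-- Maps from the free diagram on `A'` at `k s` to `Z` are maps `A' ⟶ Z (k s)`. Evaluation preserves
colimits and sends cell complexes of free maps to cell complexes of `I`, so the smallness of `A'`
with respect to `I` passes to the free diagram. -/
lemma hasSmallObjectArgument_freeMaps [HasColimits C] {S : Type} (k : S → K)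
    (hk : ∀ x, ∃ s, Nonempty (k s ≅ x)) (I : MorphismProperty C)
    [h : MorphismProperty.HasSmallObjectArgument.{v} I] :
    MorphismProperty.HasSmallObjectArgument.{v} (freeMaps k I) := by
  obtain ⟨κ, hκ, hκ', h⟩ := h
  have := locallySmall_functor (C := C) k hk
  have := h.isSmall
  refine ⟨κ, hκ, hκ', ⟨?_, inferInstance, inferInstance, inferInstance, inferInstance, ?_⟩⟩
  · unfold freeMaps
    have : Small.{v} S := small_of_injective (β := ULift.{v} S) ULift.up_injective
    infer_instance
  · intro A B X Y i hi f hf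
    obtain ⟨s, A', B', i', hi', e⟩ := (freeMaps_iff k I i).1 hi
    obtain rfl : A = (evaluationLeftAdjoint C (k s)).obj A' := congrArg (fun t => t.left) e
    let c : RelativeCellComplex.{v} (fun (_ : κ.ord.ToType) ↦ I.homFamily) (f.app (k s)) :=
      { toTransfiniteCompositionOfShape :=
          hf.toTransfiniteCompositionOfShape.map ((evaluation K C).obj (k s))
        attachCells j hj := Nonempty.some ((nonempty_attachCells_iff _ _).2 (by
          rw [MorphismProperty.ofHoms_homFamily]
          refine pushouts_freeMaps_app k I _ ?_ (k s)
          have := (hf.attachCells j hj).pushouts_coproducts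
          rwa [MorphismProperty.ofHoms_homFamily] at this)) }
    have h₁ : PreservesColimit (hf.F ⋙ (evaluation K C).obj (k s))
      (coyoneda.obj (Opposite.op A')) := h.preservesColimit i' hi' _ c
    -- Morphisms of diagrams form a type in a universe that also contains the objects of `K`; the
    -- lift makes the two hom functors comparable.
    have h₂ : PreservesColimit hf.F (((evaluation K C).obj (k s) ⋙ coyoneda.obj (Opposite.op A')) ⋙
        uliftFunctor.{u'}) := by
      have : PreservesColimit hf.F
        ((evaluation K C).obj (k s) ⋙ coyoneda.obj (Opposite.op A')) := inferInstance
      infer_instance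
    have e' : ((evaluation K C).obj (k s) ⋙ coyoneda.obj (Opposite.op A')) ⋙
        uliftFunctor.{u'} ≅
        coyoneda.obj (Opposite.op ((evaluationLeftAdjoint C (k s)).obj A')) :=
      NatIso.ofComponents (fun Z => (Equiv.ulift.trans
        ((evaluationAdjunctionRight C (k s)).homEquiv A' Z).symm).toIso) ?_
    · exact preservesColimit_of_natIso _ e'
    · intro Z Z' g
      ext ⟨a⟩
      exact (evaluationAdjunctionRight C (k s)).homEquiv_naturality_right_symm _ _

/-- A model structure on a category of functors is projective if the fibrations and the weak
equivalences are defined objectwise. -/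
structure IsProjectiveModel (K : Type u') [Category.{v'} K] (C : Type u) [Category.{v} C]
    [ModelCategory C] [ModelCategory (K ⥤ C)] : Prop where
  fibration_iff {M N : K ⥤ C} (p : M ⟶ N) : Fibration p ↔ ∀ x, Fibration (p.app x)
  weakEquivalence_iff {M N : K ⥤ C} (p : M ⟶ N) :
    WeakEquivalence p ↔ ∀ x, WeakEquivalence (p.app x)

lemma hasTwoOutOfThreeProperty_functorCategory {K : Type u'} [Category.{v'} K]
    (W : MorphismProperty C) [W.HasTwoOutOfThreeProperty] :
    (W.functorCategory K).HasTwoOutOfThreeProperty where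
  comp_mem _ _ hf hg x := W.comp_mem _ _ (hf x) (hg x)
  of_postcomp _ _ hg hfg x := W.of_postcomp _ _ (hg x) (hfg x)
  of_precomp _ _ hf hfg x := W.of_precomp _ _ (hf x) (hfg x)

/-- Evaluation at `x` has a right adjoint, sending `p` to the map of diagrams which at `y` is the
product of copies of `p` over the finite set `y ⟶ x`. That map is objectwise in `W`, so `f` lifts
against it, and by adjunction `f.app x` lifts against `p`. -/
lemma llp_functorCategory_app {W : MorphismProperty C} [HasFiniteProducts C]
    (hW : ∀ (ι : Type) [Finite ι], W.IsStableUnderProductsOfShape ι) {X Y : K ⥤ C} (f : X ⟶ Y)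
    (hf : (W.functorCategory K).llp f) (x : K) : W.llp (f.app x) := by
  intro A B p hp
  refine ((evaluationAdjunctionLeft C x).hasLiftingProperty_iff f p).2 (hf _ fun y => ?_)
  have := hW (y ⟶ x)
  exact MorphismProperty.limitsOfShape_le _ (MorphismProperty.limitsOfShape.mk' _ _ _ _
    (productIsProduct (fun _ : y ⟶ x => A)) (productIsProduct (fun _ : y ⟶ x => B))
    (Discrete.natTrans fun _ => p) (fun _ => hp) _ (fun ⟨g⟩ => by simp [evaluationRightAdjoint]))

/-- Kan's transfer. Both factorizations come from the small object argument for the free maps. It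
remains to see that the maps with the left lifting property against fibrations are precisely the
trivial cofibrations; `llp_functorCategory_app` shows that they are objectwise weak equivalences,
with no analysis of cell complexes. -/
lemma exists_isProjectiveModel [HasColimits C] [ModelCategory C] (hC : IsCofibrantlyGenerated C)
    {S : Type} (k : S → K) (hk : ∀ x, ∃ s, Nonempty (k s ≅ x)) :
    ∃ _ : ModelCategory (K ⥤ C), IsProjectiveModel K C := by
  obtain ⟨I, J, hI, hJ, hJ', hI'⟩ := hC
  let _ : CategoryWithFibrations (K ⥤ C) := ⟨(fibrations C).functorCategory K⟩
  let _ : CategoryWithWeakEquivalences (K ⥤ C) := ⟨(weakEquivalences C).functorCategory K⟩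
  let _ : CategoryWithCofibrations (K ⥤ C) := ⟨((trivialFibrations C).functorCategory K).llp⟩
  have := hasSmallObjectArgument_freeMaps k hk I
  have := hasSmallObjectArgument_freeMaps k hk J
  have h₂ : (freeMaps k J).rlp = fibrations (K ⥤ C) := by rw [rlp_freeMaps k hk, ← hJ']; rfl
  have h₁ : (freeMaps k I).rlp = trivialFibrations (K ⥤ C) := by
    rw [rlp_freeMaps k hk, ← hI']
    ext X Y f
    exact ⟨fun h => ⟨fun x => (h x).1, fun x => (h x).2⟩, fun h x => ⟨h.1 x, h.2 x⟩⟩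
  have h₀ : cofibrations (K ⥤ C) = (trivialFibrations (K ⥤ C)).llp := by
    rw [← h₁, rlp_freeMaps k hk, ← hI']; rfl
  have : (weakEquivalences (K ⥤ C)).HasTwoOutOfThreeProperty :=
    hasTwoOutOfThreeProperty_functorCategory _
  have : (weakEquivalences (K ⥤ C)).IsStableUnderRetracts :=
    inferInstanceAs ((weakEquivalences C).functorCategory K).IsStableUnderRetracts
  have h₃ : trivialCofibrations (K ⥤ C) = (fibrations (K ⥤ C)).llp := by
    have : MorphismProperty.HasFactorization (fibrations (K ⥤ C)).llp (fibrations (K ⥤ C)) := by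
      rw [← h₂]; infer_instance
    have h₄ : (fibrations (K ⥤ C)).llp ≤ trivialCofibrations (K ⥤ C) := by
      intro X Y f hf
      refine ⟨h₀ ▸ fun _ _ p hp => hf p hp.1, fun x => ?_⟩
      have := llp_functorCategory_app (W := fibrations C) (fun ι _ => by
        rw [← MorphismProperty.rlp_eq_of_wfs (trivialCofibrations C) (fibrations C)]
        infer_instance) f hf x
      rw [MorphismProperty.llp_eq_of_wfs (trivialCofibrations C) (fibrations C)] at this
      exact this.2
    -- The retract argument: in a factorization of a trivial cofibration into a map of the left
    -- class followed by a fibration, the fibration is trivial by two-out-of-three, so the map lifts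
    -- against it and is a retract of the first factor.
    refine le_antisymm (fun X Y f hf => ?_) h₄
    have d := MorphismProperty.factorizationData (fibrations (K ⥤ C)).llp (fibrations (K ⥤ C)) f
    have hp : trivialFibrations (K ⥤ C) d.p := ⟨d.hp, (weakEquivalences (K ⥤ C)).of_precomp d.i d.p
      (h₄ _ d.hi).2 (d.fac.symm ▸ hf.2)⟩
    have hf₁ := hf.1
    rw [h₀] at hf₁
    have := hf₁ _ hp
    exact MorphismProperty.of_retract (RetractArrow.ofLeftLiftingProperty d.fac) d.hi
  have : MorphismProperty.IsWeakFactorizationSystem (cofibrations (K ⥤ C))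
      (trivialFibrations (K ⥤ C)) := by
    rw [h₀, ← h₁]
    exact { rlp := by simp, llp := rfl }
  have : MorphismProperty.IsWeakFactorizationSystem (trivialCofibrations (K ⥤ C))
      (fibrations (K ⥤ C)) := by
    rw [h₃, ← h₂]
    exact { rlp := by simp, llp := rfl }
  let m : ModelCategory (K ⥤ C) := ModelCategory.mk' _
  refine ⟨m, ⟨fun p => ?_, fun p => ?_⟩⟩
  · simp only [fibration_iff]; rfl
  · simp only [weakEquivalence_iff]; rfl

lemma cofibration_iff_llp [ModelCategory C] {X Y : C} (f : X ⟶ Y) :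
    Cofibration f ↔ (trivialFibrations C).llp f := by
  rw [MorphismProperty.llp_eq_of_wfs (cofibrations C)]
  exact cofibration_iff f

lemma trivialCofibration_iff_llp [ModelCategory C] {X Y : C} (f : X ⟶ Y) :
    (Cofibration f ∧ WeakEquivalence f) ↔ (fibrations C).llp f := by
  rw [MorphismProperty.llp_eq_of_wfs (trivialCofibrations C)]
  exact (mem_trivialCofibrations_iff f).symm

namespace IsProjectiveModel

variable [ModelCategory C]

omit [∀ x y : K, Finite (x ⟶ y)] in
lemma trivialFibrations_eq [ModelCategory (K ⥤ C)] (h : IsProjectiveModel K C) :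
    trivialFibrations (K ⥤ C) = (trivialFibrations C).functorCategory K := by
  ext X Y f
  rw [mem_trivialFibrations_iff, h.fibration_iff, h.weakEquivalence_iff, ← forall_and]
  exact forall_congr' fun x => (mem_trivialFibrations_iff _).symm

lemma cofibration_app [ModelCategory (K ⥤ C)] (h : IsProjectiveModel K C) {X Y : K ⥤ C}
    (f : X ⟶ Y) [hf : Cofibration f] (x : K) : Cofibration (f.app x) := by
  rw [cofibration_iff_llp, h.trivialFibrations_eq] at hf
  rw [cofibration_iff_llp]
  refine llp_functorCategory_app (fun ι _ => ?_) f hf x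
  rw [← MorphismProperty.rlp_eq_of_wfs (cofibrations C) (trivialFibrations C)]
  infer_instance

lemma isCofibrant_obj [ModelCategory (K ⥤ C)] (h : IsProjectiveModel K C) (X : K ⥤ C)
    [IsCofibrant X] (x : K) : IsCofibrant (X.obj x) := by
  have := h.cofibration_app (initial.to X) x
  exact (isCofibrant_iff_of_isInitial _
    (initialIsInitial.isInitialObj ((evaluation K C).obj x) _)).2 this

end IsProjectiveModel

/-! ### Quillen pairs and Ken Brown's lemma -/

section Quillen

variable {C : Type u₁} [Category.{v₁} C] [ModelCategory C]
  {D : Type u₂} [Category.{v₂} D] [ModelCategory D] {F : C ⥤ D} {R : D ⥤ C} {adj : F ⊣ R}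

namespace IsQuillenPair

variable (h : IsQuillenPair adj)
include h

lemma map_cofibration {X Y : C} (f : X ⟶ Y) [hf : Cofibration f] : Cofibration (F.map f) := by
  rw [cofibration_iff_llp]
  intro A B p hp
  obtain ⟨_, _⟩ := (mem_trivialFibrations_iff p).1 hp
  have := h.map_fibration p
  have := h.map_trivialFibration p
  exact (adj.hasLiftingProperty_iff f p).2 inferInstance

lemma map_trivialCofibration {X Y : C} (f : X ⟶ Y) [Cofibration f] [WeakEquivalence f] :
    WeakEquivalence (F.map f) := by
  refine ((trivialCofibration_iff_llp _).2 ?_).2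
  intro A B p hp
  have := (fibration_iff p).2 hp
  have := h.map_fibration p
  exact (adj.hasLiftingProperty_iff f p).2 inferInstance

lemma isCofibrant_obj (X : C) [IsCofibrant X] : IsCofibrant (F.obj X) := by
  have := adj.leftAdjoint_preservesColimits
  exact (isCofibrant_iff_of_isInitial (F.map (initial.to X))
    (initialIsInitial.isInitialObj F _)).2 (h.map_cofibration _)

/-- Ken Brown's lemma. Write `f = i ≫ p` with `i` a cofibration, here trivial, and `p` having a
section `s` that is a trivial cofibration. The functor `F` preserves both trivial cofibrations, and
two-out-of-three applied to `s ≫ p = 𝟙` handles `p`. -/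
lemma map_weakEquivalence_of_isCofibrant {X Y : C} (f : X ⟶ Y) [IsCofibrant X] [IsCofibrant Y]
    [WeakEquivalence f] : WeakEquivalence (F.map f) := by
  let b : CofibrantBrownFactorization f := Classical.arbitrary _
  have hi : Cofibration b.i := (cofibration_iff _).2 b.hi
  have := h.map_trivialCofibration b.i
  have := h.map_trivialCofibration b.s
  have : WeakEquivalence (F.map b.p) := by
    refine weakEquivalence_of_precomp_of_fac (f := F.map b.s) (fg := 𝟙 _) ?_
    rw [← F.map_comp, b.s_p, F.map_id]
  rw [← b.fac, F.map_comp]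
  infer_instance

lemma map_weakEquivalence_of_isFibrant {X Y : D} (f : X ⟶ Y) [IsFibrant X] [IsFibrant Y]
    [WeakEquivalence f] : WeakEquivalence (R.map f) := by
  let b : FibrantBrownFactorization f := Classical.arbitrary _
  have hp : Fibration b.p := (fibration_iff _).2 b.hp
  have := h.map_trivialFibration b.p
  have := h.map_trivialFibration b.r
  have : WeakEquivalence (R.map b.i) := by
    refine weakEquivalence_of_postcomp_of_fac (g := R.map b.r) (fg := 𝟙 _) ?_
    rw [← R.map_comp, b.i_r, R.map_id]
  rw [← b.fac, R.map_comp]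
  infer_instance

end IsQuillenPair

lemma IsQuillenPair.whiskerRight {K : Type u'} [Category.{v'} K] [ModelCategory (K ⥤ C)]
    [ModelCategory (K ⥤ D)] (hC : IsProjectiveModel K C) (hD : IsProjectiveModel K D)
    (h : IsQuillenPair adj) : IsQuillenPair (adj.whiskerRight K) where
  map_fibration p _ := (hC.fibration_iff _).2 fun x => by
    have := (hD.fibration_iff p).1 inferInstance x
    exact h.map_fibration (p.app x)
  map_trivialFibration p _ _ := (hC.weakEquivalence_iff _).2 fun x => by
    have := (hD.fibration_iff p).1 inferInstance x
    have := (hD.weakEquivalence_iff p).1 inferInstance x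
    exact h.map_trivialFibration (p.app x)

end Quillen

end Projective
-- Weak equivalences are the maps inverted in the homotopy category
section Saturation

variable {C : Type u} [Category.{v} C] [ModelCategory C] {H : Type*} [Category* H]
  (L : C ⥤ H) [L.IsLocalization (weakEquivalences C)]

lemma isIso_map_of_weakEquivalence {X Y : C} (f : X ⟶ Y) [WeakEquivalence f] :
    IsIso (L.map f) :=
  Localization.inverts L (weakEquivalences C) f (mem_weakEquivalences f)

/-- Between bifibrant objects the inverse in the homotopy category is represented by a map, which
covering homotopy deforms into a strict section `s'` of `p`. Then `p ≫ s'` is homotopic to the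
identity, and `p` is a retract of it. -/
lemma weakEquivalence_of_isIso_map_of_fibration {X Y : C} (p : X ⟶ Y) [Fibration p]
    [IsCofibrant X] [IsFibrant X] [IsCofibrant Y] [IsFibrant Y] (hp : IsIso (L.map p)) :
    WeakEquivalence p := by
  obtain ⟨s, hs⟩ := map_surjective_of_isLocalization L Y X (inv (L.map p))
  have h₁ : LeftHomotopyRel (s ≫ p) (𝟙 Y) := by
    rw [LeftHomotopyRel.iff_map_eq L, L.map_comp, hs, L.map_id, IsIso.inv_hom_id]
  obtain ⟨P, _, ⟨h⟩⟩ := h₁.exists_good_cylinder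
  -- The homotopy from `s ≫ p` to the identity is lifted along the fibration `p`, starting at `s`;
  -- its other end is the section.
  obtain ⟨s', h', hh⟩ := h.covering_homotopy p s
  have hs' : s' ≫ p = 𝟙 Y := by
    rw [← h'.h₁, Category.assoc, hh, h.h₁]
  have hs₂ : L.map s' = inv (L.map p) := by
    rw [← cancel_mono (L.map p), ← L.map_comp, hs', L.map_id, IsIso.inv_hom_id]
  have h₂ : LeftHomotopyRel (p ≫ s') (𝟙 X) := by
    rw [LeftHomotopyRel.iff_map_eq L, L.map_comp, hs₂, L.map_id, IsIso.hom_inv_id]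
  obtain ⟨Q, ⟨k⟩⟩ := h₂
  have : WeakEquivalence (p ≫ s') := k.weakEquivalence_iff.2 inferInstance
  have r : RetractArrow p (p ≫ s') :=
    { i := Arrow.homMk (𝟙 X) s' (by simp)
      r := Arrow.homMk (𝟙 X) p (by simp [hs'])
      retract := by ext <;> simp [hs'] }
  rw [weakEquivalence_iff] at this ⊢
  exact MorphismProperty.of_retract r this

lemma weakEquivalence_of_isIso_map_of_bifibrant {X Y : C} (f : X ⟶ Y)
    [IsCofibrant X] [IsFibrant X] [IsCofibrant Y] [IsFibrant Y] (hf : IsIso (L.map f)) :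
    WeakEquivalence f := by
  let d := MorphismProperty.factorizationData (trivialCofibrations C) (fibrations C) f
  have := isCofibrant_of_cofibration d.i
  have := isFibrant_of_fibration d.p
  have := isIso_map_of_weakEquivalence L d.i
  have : IsIso (L.map d.p) := by
    have h : L.map d.i ≫ L.map d.p = L.map f := by rw [← L.map_comp, d.fac]
    exact IsIso.of_isIso_fac_left h
  have := weakEquivalence_of_isIso_map_of_fibration L d.p this
  rw [← d.fac]
  infer_instance

lemma exists_fibrant_replacement (X : C) :
    ∃ (Y : C) (_ : IsFibrant Y) (i : X ⟶ Y), Cofibration i ∧ WeakEquivalence i := by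
  let d := MorphismProperty.factorizationData (trivialCofibrations C) (fibrations C)
    (terminal.from X)
  refine ⟨d.Z, ?_, d.i, inferInstance, inferInstance⟩
  rw [isFibrant_iff_of_isTerminal d.p terminalIsTerminal]
  infer_instance

/-- Replacing source and target along weak equivalences, which are inverted by `L`, reduces to
bifibrant objects. There `f` factors as a trivial cofibration followed by a fibration, and the
previous lemmas apply. -/
lemma weakEquivalence_iff_isIso_map {X Y : C} (f : X ⟶ Y) :
    WeakEquivalence f ↔ IsIso (L.map f) := by
  refine ⟨fun _ => isIso_map_of_weakEquivalence L f, fun hf => ?_⟩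
  wlog _ : IsFibrant Y generalizing Y with ih
  · obtain ⟨Y', _, i, _, _⟩ := exists_fibrant_replacement Y
    have := isIso_map_of_weakEquivalence L i
    have := ih (f ≫ i) (by rw [L.map_comp]; infer_instance) inferInstance
    exact weakEquivalence_of_postcomp f i
  wlog _ : IsCofibrant X generalizing X with ih
  · obtain ⟨X', _, p, _, _⟩ := CofibrantObject.HoCat.exists_resolution X
    have := isIso_map_of_weakEquivalence L p
    have := ih (p ≫ f) (by rw [L.map_comp]; infer_instance) inferInstance
    exact weakEquivalence_of_precomp p f
  wlog _ : IsCofibrant Y generalizing Y with ih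
  · obtain ⟨Y', _, p, _, _⟩ := CofibrantObject.HoCat.exists_resolution Y
    have := isFibrant_of_fibration p
    have := isIso_map_of_weakEquivalence L p
    -- As `X` is cofibrant and `p` is a trivial fibration, `f` lifts to `Y'`. Dually, further down,
    -- `f` extends along the trivial cofibration `X ⟶ X'` because `Y` is fibrant.
    have sq : CommSq (initial.to Y') (initial.to X) p f := ⟨by simp⟩
    have h : sq.lift ≫ p = f := sq.fac_right
    have := ih ‹_› sq.lift (by
      have h : L.map sq.lift ≫ L.map p = L.map f := by rw [← L.map_comp, h]
      exact IsIso.of_isIso_fac_right h) inferInstance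
    rw [← h]
    infer_instance
  obtain ⟨X', _, i, _, _⟩ := exists_fibrant_replacement X
  have := isCofibrant_of_cofibration i
  have := isIso_map_of_weakEquivalence L i
  have sq : CommSq f i (terminal.from Y) (terminal.from X') := ⟨by simp⟩
  have h : i ≫ sq.lift = f := sq.fac_left
  have := weakEquivalence_of_isIso_map_of_bifibrant L sq.lift (by
    have h : L.map i ≫ L.map sq.lift = L.map f := by rw [← L.map_comp, h]
    exact IsIso.of_isIso_fac_left h)
  rw [← h]
  infer_instance

end Saturation

/-! ### Derived functors computed on cofibrant and on fibrant objects -/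

section LeftDerived

variable {C : Type u} [Category.{v} C] [ModelCategory C] {H : Type*} [Category* H]
  (L : C ⥤ H) [L.IsLocalization (weakEquivalences C)] {E : Type*} [Category* E]

/-- A functor sends weak equivalences between cofibrant objects to isomorphisms. -/
def InvertsCofibrantWeakEquivalences (G : C ⥤ E) : Prop :=
  ∀ ⦃X Y : C⦄ (f : X ⟶ Y) [IsCofibrant X] [IsCofibrant Y] [WeakEquivalence f], IsIso (G.map f)

lemma InvertsCofibrantWeakEquivalences.isInvertedBy {G : C ⥤ E}
    (hG : InvertsCofibrantWeakEquivalences G) :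
    (weakEquivalences (CofibrantObject C)).IsInvertedBy (CofibrantObject.ι ⋙ G) := by
  intro X Y f hf
  rw [← weakEquivalence_iff, weakEquivalence_iff_of_objectProperty] at hf
  have : WeakEquivalence f.hom := hf
  exact hG f.hom

-- The composite of the inclusion of cofibrant objects with `L` is again a localization, so natural
-- transformations between functors on `H` are the same as between their restrictions to cofibrant
-- objects. There `a` is invertible, which makes the factorization through it exist and be unique.
variable {L} in
lemma isLeftDerivedFunctor_of_isIso {G : C ⥤ E} {LG : H ⥤ E} (a : L ⋙ LG ⟶ G)
    (ha : ∀ (X : C) [IsCofibrant X], IsIso (a.app X)) :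
    LG.IsLeftDerivedFunctor a (weakEquivalences C) := by
  let I := CofibrantObject.ι ⋙ L
  have hI : I.IsLocalization (weakEquivalences (CofibrantObject C)) := inferInstance
  have : ((Functor.whiskeringLeft _ _ E).obj I).Full :=
    Localization.full_whiskeringLeft I (weakEquivalences (CofibrantObject C)) E
  have : ((Functor.whiskeringLeft _ _ E).obj I).Faithful :=
    Localization.faithful_whiskeringLeft I (weakEquivalences (CofibrantObject C)) E
  have h₀ : ∀ (G' : H ⥤ E) (b : L ⋙ G' ⟶ G), ∃ γ : G' ⟶ LG, L.whiskerLeft γ ≫ a = b := by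
    intro G' b
    have hi : ∀ X : CofibrantObject C, IsIso (a.app X.obj) := fun X => ha X.obj
    let t : I ⋙ G' ⟶ I ⋙ LG :=
      { app := fun X => b.app X.obj ≫ inv (a.app X.obj)
        naturality := fun X Y f => by
          have h₁ := b.naturality f.hom
          have h₂ := a.naturality f.hom
          dsimp at h₁ h₂ ⊢
          rw [← cancel_mono (a.app Y.obj)]
          simp only [Category.assoc, IsIso.inv_hom_id, Category.comp_id]
          change G'.map (L.map f.hom) ≫ _ = _ ≫ _ ≫ LG.map (L.map f.hom) ≫ _
          rw [h₂, IsIso.inv_hom_id_assoc, h₁] }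
    obtain ⟨γ, hγ⟩ := ((Functor.whiskeringLeft _ _ E).obj I).map_surjective t
    have hγ' : ∀ (X : C) [IsCofibrant X], γ.app (L.obj X) ≫ a.app X = b.app X := by
      intro X _
      have h₁ : γ.app (L.obj X) = b.app X ≫ inv (a.app X) :=
        NatTrans.congr_app hγ (CofibrantObject.mk X)
      rw [h₁, Category.assoc, IsIso.inv_hom_id, Category.comp_id]
    refine ⟨γ, ?_⟩
    ext X
    -- The identity is known on cofibrant objects; naturality along a resolution `p`, which `L`
    -- inverts, carries it to `X`.
    obtain ⟨X', _, p, _, _⟩ := CofibrantObject.HoCat.exists_resolution X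
    have := isIso_map_of_weakEquivalence L p
    rw [← cancel_epi (G'.map (L.map p))]
    have h₁ := b.naturality p
    have h₂ := a.naturality p
    dsimp at h₁ h₂ ⊢
    rw [h₁, NatTrans.naturality_assoc, h₂, reassoc_of% (hγ' X')]
  have h₁ : ∀ (G' : H ⥤ E) (γ γ' : G' ⟶ LG), L.whiskerLeft γ ≫ a = L.whiskerLeft γ' ≫ a →
      γ = γ' := by
    intro G' γ γ' h
    apply ((Functor.whiskeringLeft _ _ E).obj I).map_injective
    ext X
    have := ha X.obj
    exact (cancel_mono (a.app X.obj)).1 (NatTrans.congr_app h X.obj)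
  refine ⟨⟨⟨IsTerminal.ofUniqueHom (fun T => CostructuredArrow.homMk (h₀ _ T.hom).choose
    (h₀ _ T.hom).choose_spec) fun T m => ?_⟩⟩⟩
  ext1
  exact h₁ _ _ _ ((CostructuredArrow.w m).trans (h₀ _ T.hom).choose_spec.symm)

/-- `LG` is induced by the restriction of `G` to cofibrant objects, and `a` at `X` passes through a
chosen resolution of `X`. Naturality needs only a map of resolutions covering each `f`, not a
functorial choice of such maps. -/
lemma exists_leftDerived {G : C ⥤ E} (hG : InvertsCofibrantWeakEquivalences G) :
    ∃ (LG : H ⥤ E) (a : L ⋙ LG ⟶ G), ∀ (X : C) [IsCofibrant X], IsIso (a.app X) := by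
  let I := CofibrantObject.ι ⋙ L
  have hI : I.IsLocalization (weakEquivalences (CofibrantObject C)) := inferInstance
  let LG : H ⥤ E := Localization.lift _ hG.isInvertedBy I
  let e : I ⋙ LG ≅ CofibrantObject.ι ⋙ G := Localization.fac _ hG.isInvertedBy I
  let Q (X : C) : CofibrantObject C := CofibrantObject.mk (CofibrantObject.HoCat.resolutionObj X)
  have hp (X : C) := isIso_map_of_weakEquivalence L (CofibrantObject.HoCat.pResolutionObj X)
  let a : L ⋙ LG ⟶ G :=
    { app := fun X => LG.map (inv (L.map (CofibrantObject.HoCat.pResolutionObj X))) ≫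
        e.hom.app (Q X) ≫ G.map (CofibrantObject.HoCat.pResolutionObj X)
      naturality := fun X Y f => by
        have h₁ := e.hom.naturality (X := Q X) (Y := Q Y)
          (CofibrantObject.homMk (CofibrantObject.HoCat.resolutionMap f))
        change LG.map (L.map (CofibrantObject.HoCat.resolutionMap f)) ≫ _ =
          _ ≫ G.map (CofibrantObject.HoCat.resolutionMap f) at h₁
        have h₂ : L.map f ≫ inv (L.map (CofibrantObject.HoCat.pResolutionObj Y)) =
            inv (L.map (CofibrantObject.HoCat.pResolutionObj X)) ≫
              L.map (CofibrantObject.HoCat.resolutionMap f) := by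
          rw [IsIso.comp_inv_eq, Category.assoc, ← L.map_comp,
            CofibrantObject.HoCat.resolutionMap_fac, L.map_comp, IsIso.inv_hom_id_assoc]
        dsimp
        rw [← LG.map_comp_assoc, h₂, LG.map_comp_assoc, reassoc_of% h₁, ← G.map_comp,
          CofibrantObject.HoCat.resolutionMap_fac, G.map_comp]
        simp }
  refine ⟨LG, a, fun X _ => ?_⟩
  have := hG (CofibrantObject.HoCat.pResolutionObj X)
  dsimp [a]
  infer_instance

-- A left derived functor is unique up to isomorphism over `G`, so the invertibility on cofibrant
-- objects is inherited from the one just constructed.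
variable {L} in
lemma isIso_of_isLeftDerivedFunctor {G : C ⥤ E} (hG : InvertsCofibrantWeakEquivalences G)
    {LG : H ⥤ E} (a : L ⋙ LG ⟶ G) [LG.IsLeftDerivedFunctor a (weakEquivalences C)] (X : C)
    [IsCofibrant X] : IsIso (a.app X) := by
  obtain ⟨LG', a', ha'⟩ := exists_leftDerived L hG
  have := isLeftDerivedFunctor_of_isIso a' ha'
  have h := Functor.leftDerivedNatTrans_app LG LG' a a' (weakEquivalences C) (𝟙 G) X
  have : IsIso (Functor.leftDerivedNatTrans LG LG' a a' (weakEquivalences C) (𝟙 G)) :=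
    (inferInstance : IsIso (Functor.leftDerivedNatIso LG LG' a a' (weakEquivalences C)
      (Iso.refl G)).hom)
  have := ha' X
  rw [NatTrans.id_app, Category.comp_id] at h
  rw [← h]
  infer_instance

/-- A functor sends weak equivalences between fibrant objects to isomorphisms. -/
def InvertsFibrantWeakEquivalences (G : C ⥤ E) : Prop :=
  ∀ ⦃X Y : C⦄ (f : X ⟶ Y) [IsFibrant X] [IsFibrant Y] [WeakEquivalence f], IsIso (G.map f)

lemma InvertsFibrantWeakEquivalences.derives {G : C ⥤ E}
    (hG : InvertsFibrantWeakEquivalences G) :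
    (FibrantObject.localizerMorphism C).Derives G := by
  intro X Y f hf
  rw [← weakEquivalence_iff, weakEquivalence_iff_of_objectProperty] at hf
  have : WeakEquivalence f.hom := hf
  exact hG f.hom

variable {L} in
lemma isRightDerivedFunctor_of_isIso {G : C ⥤ E} (hG : InvertsFibrantWeakEquivalences G)
    {RG : H ⥤ E} (b : G ⟶ L ⋙ RG) (hb : ∀ (X : C) [IsFibrant X], IsIso (b.app X)) :
    RG.IsRightDerivedFunctor b (weakEquivalences C) :=
  hG.derives.isRightDerivedFunctor_of_isIso b fun X =>
    hb ((FibrantObject.localizerMorphism C).functor.obj X)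

variable {L} in
lemma isIso_of_isRightDerivedFunctor {G : C ⥤ E} (hG : InvertsFibrantWeakEquivalences G)
    {RG : H ⥤ E} (b : G ⟶ L ⋙ RG) [RG.IsRightDerivedFunctor b (weakEquivalences C)] (X : C)
    [IsFibrant X] : IsIso (b.app X) :=
  hG.derives.isIso_of_isRightDerivedFunctor b (FibrantObject.mk X)

end LeftDerived

/-! ### The criterion for Quillen equivalences by adjoint maps -/

section QuillenEquivalence

variable {C : Type u₁} [Category.{v₁} C] [ModelCategory C]
  {D : Type u₂} [Category.{v₂} D] [ModelCategory D] {F : C ⥤ D} {R : D ⥤ C} {adj : F ⊣ R}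

lemma IsQuillenPair.invertsCofibrantWeakEquivalences (h : IsQuillenPair adj)
    {E : Type*} [Category* E] (L : D ⥤ E) [L.IsLocalization (weakEquivalences D)] :
    InvertsCofibrantWeakEquivalences (F ⋙ L) := fun _ _ f _ _ _ => by
  have := h.map_weakEquivalence_of_isCofibrant f
  exact isIso_map_of_weakEquivalence L (F.map f)

lemma IsQuillenPair.invertsFibrantWeakEquivalences (h : IsQuillenPair adj)
    {E : Type*} [Category* E] (L : C ⥤ E) [L.IsLocalization (weakEquivalences C)] :
    InvertsFibrantWeakEquivalences (R ⋙ L) := fun _ _ f _ _ _ => by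
  have := h.map_weakEquivalence_of_isFibrant f
  exact isIso_map_of_weakEquivalence L (R.map f)

section

variable {LF : (weakEquivalences C).Localization ⥤ (weakEquivalences D).Localization}
  {RR : (weakEquivalences D).Localization ⥤ (weakEquivalences C).Localization}
  {a : (weakEquivalences C).Q ⋙ LF ⟶ F ⋙ (weakEquivalences D).Q}
  {b : R ⋙ (weakEquivalences C).Q ⟶ (weakEquivalences D).Q ⋙ RR}

/-- The derived adjunction of a Quillen pair. -/
lemma IsQuillenPair.exists_derivedAdjunction (h : IsQuillenPair adj)
    (ha : ∀ (X : C) [IsCofibrant X], IsIso (a.app X))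
    (hb : ∀ (Y : D) [IsFibrant Y], IsIso (b.app Y)) :
    ∃ adj' : LF ⊣ RR,
      (∀ (X : C) (Y : D) (f : F.obj X ⟶ Y),
        adj'.unit.app ((weakEquivalences C).Q.obj X) ≫ RR.map (a.app X) ≫
            RR.map ((weakEquivalences D).Q.map f) =
          (weakEquivalences C).Q.map (adj.homEquiv X Y f) ≫ b.app Y) ∧
      (∀ (X : C) (Y : D) (g : X ⟶ R.obj Y),
        LF.map ((weakEquivalences C).Q.map g) ≫ LF.map (b.app Y) ≫
            adj'.counit.app ((weakEquivalences D).Q.obj Y) =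
          a.app X ≫ (weakEquivalences D).Q.map ((adj.homEquiv X Y).symm g)) := by
  have h₁ : LF.IsLeftDerivedFunctor a (weakEquivalences C) := isLeftDerivedFunctor_of_isIso a ha
  have h₂ : RR.IsRightDerivedFunctor b (weakEquivalences D) :=
    isRightDerivedFunctor_of_isIso (h.invertsFibrantWeakEquivalences _) b hb
  -- The derived unit comes from the universal property of `LF ⋙ RR` as a left derived functor, and
  -- the counit from that of `RR ⋙ LF` as a right derived functor. Both hold because whiskering
  -- keeps `a` and `b` invertible where they were.
  have h₃ : (LF ⋙ RR).IsLeftDerivedFunctor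
      ((Functor.associator _ _ _).inv ≫ Functor.whiskerRight a RR) (weakEquivalences C) := by
    refine isLeftDerivedFunctor_of_isIso _ fun X _ => ?_
    have := ha X
    dsimp
    infer_instance
  have h₄ : (RR ⋙ LF).IsRightDerivedFunctor
      (Functor.whiskerRight b LF ≫ (Functor.associator _ _ _).hom) (weakEquivalences D) := by
    refine isRightDerivedFunctor_of_isIso ?_ _ fun Y _ => ?_
    · intro X Y f _ _ _
      have := h.invertsFibrantWeakEquivalences (weakEquivalences C).Q f
      exact (inferInstance : IsIso (LF.map ((R ⋙ (weakEquivalences C).Q).map f)))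
    · have := hb Y
      dsimp
      infer_instance
  refine ⟨adj.derived (weakEquivalences C) (weakEquivalences D) a b, fun X Y f => ?_,
    fun X Y g => ?_⟩
  · have e₁ := adj.derivedη_fac_app (weakEquivalences C) a b X
    have e₂ := b.naturality f
    dsimp at e₂
    rw [Adjunction.derived_unit, reassoc_of% e₁, ← e₂, adj.homEquiv_unit,
      Functor.map_comp_assoc]
  · have e₁ := adj.derivedε_fac_app (weakEquivalences D) a b Y
    have e₂ := a.naturality g
    dsimp at e₂
    rw [Adjunction.derived_counit, e₁, reassoc_of% e₂, adj.homEquiv_counit, Functor.map_comp]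

end

/-- Up to the isomorphisms `a` at `X` and `b` at `Y`, the class of the adjoint of `f` is the derived
adjoint of the class of `f`. The derived unit is invertible because `LF` is an equivalence, so one
class is invertible exactly when the other is; saturation translates this back to weak equivalences.
-/
lemma IsQuillenEquivalence.weakEquivalence_homEquiv_iff (h : IsQuillenEquivalence adj)
    {X : C} {Y : D} [IsCofibrant X] [IsFibrant Y] (f : F.obj X ⟶ Y) :
    WeakEquivalence (adj.homEquiv X Y f) ↔ WeakEquivalence f := by
  obtain ⟨LF, a, _, _⟩ := h.leftDerived
  obtain ⟨RR, b, _, _⟩ := h.rightDerived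
  have ha : ∀ (X : C) [IsCofibrant X], IsIso (a.app X) := fun X _ =>
    isIso_of_isLeftDerivedFunctor (h.isQuillenPair.invertsCofibrantWeakEquivalences _) a X
  have hb : ∀ (Y : D) [IsFibrant Y], IsIso (b.app Y) := fun Y _ =>
    isIso_of_isRightDerivedFunctor (h.isQuillenPair.invertsFibrantWeakEquivalences _) b Y
  obtain ⟨adj', h₁, -⟩ := h.isQuillenPair.exists_derivedAdjunction ha hb
  have e := h₁ X Y f
  have := ha X
  have := hb Y
  rw [weakEquivalence_iff_isIso_map (weakEquivalences C).Q,
    weakEquivalence_iff_isIso_map (weakEquivalences D).Q]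
  refine ⟨fun _ => ?_, fun _ => ?_⟩
  · have h₂ : IsIso (adj'.unit.app ((weakEquivalences C).Q.obj X) ≫ RR.map (a.app X) ≫
        RR.map ((weakEquivalences D).Q.map f)) := by
      rw [e]; infer_instance
    have h₃ : IsIso (RR.map ((weakEquivalences D).Q.map f)) := by
      rw [← Category.assoc] at h₂
      exact IsIso.of_isIso_comp_left (adj'.unit.app ((weakEquivalences C).Q.obj X) ≫
        RR.map (a.app X)) _
    exact isIso_of_reflects_iso _ RR
  · have h₂ : IsIso ((weakEquivalences C).Q.map (adj.homEquiv X Y f) ≫ b.app Y) := by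
      rw [← e]; infer_instance
    exact IsIso.of_isIso_comp_right _ (b.app Y)

/-- The derived unit at a cofibrant `X` is represented by the adjoint of a fibrant replacement of `F
X`, and the derived counit at a fibrant `Y` by the adjoint of a cofibrant replacement of `R Y`. Both
are weak equivalences by hypothesis, and such objects represent all isomorphism classes of the
homotopy categories. -/
lemma IsQuillenPair.isQuillenEquivalence (h : IsQuillenPair adj)
    (h' : ∀ (X : C) (Y : D) [IsCofibrant X] [IsFibrant Y] (f : F.obj X ⟶ Y),
      WeakEquivalence (adj.homEquiv X Y f) ↔ WeakEquivalence f) :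
    IsQuillenEquivalence adj := by
  obtain ⟨LF, a, ha⟩ := exists_leftDerived (weakEquivalences C).Q
    (h.invertsCofibrantWeakEquivalences (weakEquivalences D).Q)
  have hR := h.invertsFibrantWeakEquivalences (weakEquivalences C).Q
  obtain ⟨RR, b, hRR⟩ : ∃ (RR : (weakEquivalences D).Localization ⥤
      (weakEquivalences C).Localization)
      (b : R ⋙ (weakEquivalences C).Q ⟶ (weakEquivalences D).Q ⋙ RR),
      RR.IsRightDerivedFunctor b (weakEquivalences D) := by
    have := hR.derives.hasPointwiseRightDerivedFunctor
    exact ⟨_, (R ⋙ (weakEquivalences C).Q).totalRightDerivedUnit (weakEquivalences D).Q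
      (weakEquivalences D), inferInstance⟩
  have hb : ∀ (Y : D) [IsFibrant Y], IsIso (b.app Y) := fun Y _ =>
    isIso_of_isRightDerivedFunctor hR b Y
  obtain ⟨adj', h₁, h₂⟩ := h.exists_derivedAdjunction ha hb
  have hη : IsIso adj'.unit := by
    rw [NatTrans.isIso_iff_isIso_app]
    intro Z
    have := Localization.essSurj (CofibrantObject.ι ⋙ (weakEquivalences C).Q)
      (weakEquivalences (CofibrantObject C))
    rw [NatTrans.isIso_app_iff_of_iso adj'.unit
      ((CofibrantObject.ι ⋙ (weakEquivalences C).Q).objObjPreimageIso Z).symm]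
    generalize (CofibrantObject.ι ⋙ (weakEquivalences C).Q).objPreimage Z = X
    change IsIso (adj'.unit.app ((weakEquivalences C).Q.obj X.obj))
    obtain ⟨Y, _, i, _, _⟩ := exists_fibrant_replacement (F.obj X.obj)
    have := (h' _ _ i).2 inferInstance
    have e := h₁ _ _ i
    have := ha X.obj
    have := hb Y
    have := isIso_map_of_weakEquivalence (weakEquivalences D).Q i
    have := isIso_map_of_weakEquivalence (weakEquivalences C).Q (adj.homEquiv _ _ i)
    have : IsIso (adj'.unit.app ((weakEquivalences C).Q.obj X.obj) ≫ RR.map (a.app X.obj) ≫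
        RR.map ((weakEquivalences D).Q.map i)) := by
      rw [e]; infer_instance
    exact IsIso.of_isIso_comp_right _ (RR.map (a.app X.obj) ≫
        RR.map ((weakEquivalences D).Q.map i))
  have hε : IsIso adj'.counit := by
    rw [NatTrans.isIso_iff_isIso_app]
    intro Z
    have := Localization.essSurj (FibrantObject.ι ⋙ (weakEquivalences D).Q)
      (weakEquivalences (FibrantObject D))
    rw [NatTrans.isIso_app_iff_of_iso adj'.counit
      ((FibrantObject.ι ⋙ (weakEquivalences D).Q).objObjPreimageIso Z).symm]
    generalize (FibrantObject.ι ⋙ (weakEquivalences D).Q).objPreimage Z = Y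
    change IsIso (adj'.counit.app ((weakEquivalences D).Q.obj Y.obj))
    obtain ⟨X, _, p, _, _⟩ := CofibrantObject.HoCat.exists_resolution (R.obj Y.obj)
    have := (h' _ _ ((adj.homEquiv _ _).symm p)).1 (by simpa)
    have e := h₂ _ _ p
    have := ha X
    have := hb Y.obj
    have := isIso_map_of_weakEquivalence (weakEquivalences C).Q p
    have := isIso_map_of_weakEquivalence (weakEquivalences D).Q ((adj.homEquiv _ _).symm p)
    have : IsIso ((LF.map ((weakEquivalences C).Q.map p) ≫ LF.map (b.app Y.obj)) ≫
            adj'.counit.app ((weakEquivalences D).Q.obj Y.obj)) := by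
      rw [Category.assoc, e]; infer_instance
    exact IsIso.of_isIso_comp_left (LF.map ((weakEquivalences C).Q.map p) ≫
      LF.map (b.app Y.obj)) _
  exact
    { isQuillenPair := h
      leftDerived := ⟨LF, a, isLeftDerivedFunctor_of_isIso a ha,
        adj'.toEquivalence.isEquivalence_functor⟩
      rightDerived := ⟨RR, b, hRR, adj'.toEquivalence.isEquivalence_inverse⟩ }

universe u' v'

lemma IsProjectiveModel.isFibrant_obj {K : Type u'} [Category.{v'} K]
    [ModelCategory (K ⥤ D)] (h : IsProjectiveModel K D) (Y : K ⥤ D) [IsFibrant Y] (x : K) :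
    IsFibrant (Y.obj x) := by
  have := (h.fibration_iff (terminal.from Y)).1 inferInstance x
  exact (isFibrant_iff_of_isTerminal _
    (terminalIsTerminal.isTerminalObj ((evaluation K D).obj x) _)).2 this

/-- The values of a projectively cofibrant diagram are cofibrant, those of a fibrant one are
fibrant, and adjoints of maps of diagrams are formed objectwise, so the criterion holds at each `x`.
-/
lemma IsQuillenEquivalence.whiskerRight {K : Type u'} [Category.{0} K]
    [∀ x y : K, Finite (x ⟶ y)] [ModelCategory (K ⥤ C)] [ModelCategory (K ⥤ D)]
    (hC : IsProjectiveModel K C) (hD : IsProjectiveModel K D) (h : IsQuillenEquivalence adj) :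
    IsQuillenEquivalence (adj.whiskerRight K) := by
  refine (h.isQuillenPair.whiskerRight hC hD).isQuillenEquivalence fun X Y _ _ f => ?_
  rw [hC.weakEquivalence_iff, hD.weakEquivalence_iff]
  refine forall_congr' fun x => ?_
  have := hC.isCofibrant_obj X x
  have := hD.isFibrant_obj Y x
  rw [← h.weakEquivalence_homEquiv_iff]
  refine iff_of_eq (congrArg (fun t => WeakEquivalence t) ?_)
  rw [adj.homEquiv_unit, (adj.whiskerRight K).homEquiv_unit]
  simp

end QuillenEquivalence

/-! ### Lax structure maps and the coherence maps of iterated tensor products -/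

section LaxCoherence

open Functor.LaxMonoidal

variable {C : Type u₁} [Category.{v₁} C] {D : Type u₂} [Category.{v₂} D] (R : D ⥤ C) {ι κ : Type}

lemma id_comp_eq_comp_map_id {A : C} {B : D} (x : A ⟶ R.obj B) : 𝟙 A ≫ x = x ≫ R.map (𝟙 B) := by
  simp

variable [MonoidalCategory C] [MonoidalCategory D]

section Lax

variable [R.LaxMonoidal]

lemma tprodHom_comp_laxTprod {X Y : ι → D} (φ : ∀ a, X a ⟶ Y a) (l : List ι) :
    tprodHom (fun a => R.map (φ a)) l ≫ laxTprod R Y l =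
      laxTprod R X l ≫ R.map (tprodHom φ l) := by
  induction l with
  | nil => exact id_comp_eq_comp_map_id R (ε R)
  | cons a l ih =>
    -- The inductive step is isolated for arbitrary objects in place of the tensor products along
    -- lists, which leaves an identity about `μ`. The later lemmas proceed in the same way.
    have key : ∀ {A B : D} {T U : C} {T' U' : D} (f : A ⟶ B) (t : T ⟶ U) (x : T ⟶ R.obj T')
        (y : U ⟶ R.obj U') (t' : T' ⟶ U'), t ≫ y = x ≫ R.map t' →
        (R.map f ⊗ₘ t) ≫ R.obj B ◁ y ≫ μ R B U' =
          (R.obj A ◁ x ≫ μ R A T') ≫ R.map (f ⊗ₘ t') := by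
      intro A B T U T' U' f t x y t' h
      rw [Category.assoc, ← μ_natural, ← id_tensorHom, ← id_tensorHom,
        tensorHom_comp_tensorHom_assoc, tensorHom_comp_tensorHom_assoc, h]
      simp
    exact key _ _ _ _ _ ih

lemma tprodUnit_comp_ε (l : List ι) :
    tprodHom (fun _ => ε R) l ≫ laxTprod R (fun _ => 𝟙_ D) l ≫ R.map (tprodUnit l) =
      tprodUnit l ≫ ε R := by
  induction l with
  | nil =>
    have key : 𝟙 (𝟙_ C) ≫ ε R ≫ R.map (𝟙 (𝟙_ D)) = 𝟙 (𝟙_ C) ≫ ε R := by simp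
    exact key
  | cons a l ih =>
    have key : ∀ {T U : C} {U' : D} (t : T ⟶ U) (x : U ⟶ R.obj U') (w : U' ⟶ 𝟙_ D)
        (z : T ⟶ 𝟙_ C), t ≫ x ≫ R.map w = z ≫ ε R →
        (ε R ⊗ₘ t) ≫ (R.obj (𝟙_ D) ◁ x ≫ μ R (𝟙_ D) U') ≫ R.map ((λ_ U').hom ≫ w) =
          ((λ_ T).hom ≫ z) ≫ ε R := by
      intro T U U' t x w z h
      simp only [Category.assoc]
      rw [← h, ← leftUnitor_naturality_assoc, ← leftUnitor_naturality_assoc, left_unitality,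
        tensorHom_def', R.map_comp]
      simp only [Category.assoc]
      rw [← whisker_exchange_assoc]
    exact key _ _ _ _ ih

lemma tprodAppend_comp_laxTprod (X : ι → D) (l' l : List ι) :
    tprodAppend (fun a => R.obj (X a)) l' l ≫ (laxTprod R X l ⊗ₘ laxTprod R X l') ≫
        μ R (tprod X l) (tprod X l') =
      laxTprod R X (l ++ l') ≫ R.map (tprodAppend X l' l) := by
  induction l with
  | nil =>
    have key : ∀ {T : C} {T' : D} (x : T ⟶ R.obj T'),
        (λ_ T).inv ≫ (ε R ⊗ₘ x) ≫ μ R (𝟙_ D) T' = x ≫ R.map (λ_ T').inv := by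
      intro T T' x
      rw [tensorHom_def', Category.assoc, ← leftUnitor_inv_naturality_assoc, left_unitality_inv]
    exact key _
  | cons a l ih =>
    have key : ∀ {A : D} {T U V : C} {T' U' V' : D} (p : T ⟶ U ⊗ V) (x : U ⟶ R.obj U')
        (y : V ⟶ R.obj V') (z : T ⟶ R.obj T') (p' : T' ⟶ U' ⊗ V'),
        p ≫ (x ⊗ₘ y) ≫ μ R U' V' = z ≫ R.map p' →
        (R.obj A ◁ p ≫ (α_ (R.obj A) U V).inv) ≫ (R.obj A ◁ x ≫ μ R A U' ⊗ₘ y) ≫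
            μ R (A ⊗ U') V' =
          (R.obj A ◁ z ≫ μ R A T') ≫ R.map (A ◁ p' ≫ (α_ A U' V').inv) := by
      intro A T U V T' U' V' p x y z p' h
      rw [← cancel_mono (R.map (α_ A U' V').hom)]
      simp only [Category.assoc, ← R.map_comp, Iso.inv_hom_id, Category.comp_id]
      rw [← Category.comp_id y, ← tensorHom_comp_tensorHom]
      simp only [tensorHom_id, Category.assoc, associativity]
      rw [← μ_natural_right, ← whiskerLeft_comp_assoc, ← h, ← id_tensorHom (R.obj A) x,
        associator_naturality_assoc]
      simp
    exact key _ _ _ _ _ ih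

lemma tprodOfMap_comp_laxTprod (X : κ → D) (σ : ι → κ) (l : List ι) :
    tprodOfMap (fun a => R.obj (X a)) σ l ≫ laxTprod R (fun a => X (σ a)) l =
      laxTprod R X (l.map σ) ≫ R.map (tprodOfMap X σ l) := by
  induction l with
  | nil => exact id_comp_eq_comp_map_id R (ε R)
  | cons a l ih =>
    have key : ∀ {A : D} {T U : C} {T' U' : D} (t : T ⟶ U) (x : T ⟶ R.obj T')
        (y : U ⟶ R.obj U') (t' : T' ⟶ U'), t ≫ y = x ≫ R.map t' →
        R.obj A ◁ t ≫ R.obj A ◁ y ≫ μ R A U' =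
          (R.obj A ◁ x ≫ μ R A T') ≫ R.map (A ◁ t') := by
      intro A T U T' U' t x y t' h
      rw [Category.assoc, ← μ_natural_right, ← whiskerLeft_comp_assoc, h]
      simp
    exact key _ _ _ _ ih

lemma tprodSigma_comp_laxTprod {β : ι → Type} (X : (Σ a, β a) → D) (s : ∀ a, List (β a))
    (l : List ι) :
    tprodSigma (fun p => R.obj (X p)) s l ≫
        tprodHom (fun a => laxTprod R (fun b => X ⟨a, b⟩) (s a)) l ≫
          laxTprod R (fun a => tprod (fun b => X ⟨a, b⟩) (s a)) l =
      laxTprod R X (l.sigma s) ≫ R.map (tprodSigma X s l) := by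
  induction l with
  | nil => exact (Category.id_comp _).trans (id_comp_eq_comp_map_id R (ε R))
  | cons a l ih =>
    have h₁ := tprodAppend_comp_laxTprod R X (l.sigma s) ((s a).map (Sigma.mk a))
    have h₂ := tprodOfMap_comp_laxTprod R X (Sigma.mk a) (s a)
    have key : ∀ {S T U S' U' V' : C} {P Q Y Z W : D} (p : S ⟶ T ⊗ U) (q : T ⟶ S')
        (r : U ⟶ U') (x : S' ⟶ R.obj Y) (y : U' ⟶ V') (w : V' ⟶ R.obj Z)
        (t : T ⟶ R.obj P) (t' : U ⟶ R.obj Q) (z : S ⟶ R.obj W) (p' : W ⟶ P ⊗ Q)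
        (q' : P ⟶ Y) (r' : Q ⟶ Z),
        p ≫ (t ⊗ₘ t') ≫ μ R P Q = z ≫ R.map p' →
        q ≫ x = t ≫ R.map q' →
        r ≫ y ≫ w = t' ≫ R.map r' →
        (p ≫ (q ⊗ₘ r)) ≫ (x ⊗ₘ y) ≫ R.obj Y ◁ w ≫ μ R Y Z =
          z ≫ R.map (p' ≫ (q' ⊗ₘ r')) := by
      intro S T U S' U' V' P Q Y Z W p q r x y w t t' z p' q' r' e₁ e₂ e₃
      rw [R.map_comp, ← reassoc_of% e₁, ← μ_natural, tensorHom_comp_tensorHom_assoc, ← e₂, ← e₃,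
        ← id_tensorHom, Category.assoc, tensorHom_comp_tensorHom_assoc,
        tensorHom_comp_tensorHom_assoc]
      simp
    exact key _ _ _ _ _ _ _ _ _ _ _ _ h₁ h₂ ih

end Lax

variable [SymmetricCategory C] [SymmetricCategory D] [R.LaxBraided]

/-- Here the compatibility of `R` with the symmetries enters, combined with two instances of the
associativity of `μ`. Every permutation of factors is built from such exchanges, so
`Insertion.eval_lax` and `Matching.eval_lax` follow by induction. -/
lemma exch_lax (X Y Z : D) :
    R.obj X ◁ μ R Y Z ≫ μ R X (Y ⊗ Z) ≫ R.map (exch X Y Z) =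
      exch (R.obj X) (R.obj Y) (R.obj Z) ≫ R.obj Y ◁ μ R X Z ≫ μ R Y (X ⊗ Z) := by
  have h₁ := associativity R X Y Z
  have h₂ := associativity R Y X Z
  have h₃ := Functor.LaxBraided.braided (F := R) X Y
  have h₄ : R.obj X ◁ μ R Y Z ≫ μ R X (Y ⊗ Z) =
      (α_ _ _ _).inv ≫ μ R X Y ▷ R.obj Z ≫ μ R (X ⊗ Y) Z ≫ R.map (α_ X Y Z).hom := by
    rw [h₁, Iso.inv_hom_id_assoc]
  rw [reassoc_of% h₄, exch, exch]
  simp only [Category.assoc]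
  rw [← h₂, ← R.map_comp, Iso.hom_inv_id_assoc, R.map_comp, ← μ_natural_left_assoc,
    ← comp_whiskerRight_assoc, h₃, comp_whiskerRight_assoc]

lemma Insertion.eval_lax (X : ι → D) {a : ι} {t l : List ι} (i : Insertion a t l) :
    i.eval (fun a => R.obj (X a)) ≫ laxTprod R X l =
      R.obj (X a) ◁ laxTprod R X t ≫ μ R (X a) (tprod X t) ≫ R.map (i.eval X) := by
  induction i with
  | here t =>
    exact (id_comp_eq_comp_map_id R _).trans (Category.assoc _ _ _)
  | there b i ih =>
    have key : ∀ {A B : D} {T L : C} {T' L' : D} (e : R.obj A ⊗ T ⟶ L) (x : L ⟶ R.obj L')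
        (y : T ⟶ R.obj T') (e' : A ⊗ T' ⟶ L'), e ≫ x = R.obj A ◁ y ≫ μ R A T' ≫ R.map e' →
        (exch (R.obj A) (R.obj B) T ≫ R.obj B ◁ e) ≫ R.obj B ◁ x ≫ μ R B L' =
        R.obj A ◁ (R.obj B ◁ y ≫ μ R B T') ≫ μ R A (B ⊗ T') ≫
          R.map (exch A B T' ≫ B ◁ e') := by
      intro A B T L T' L' e x y e' h
      have n := exch_natural (𝟙 (R.obj A)) (𝟙 (R.obj B)) y
      simp only [id_tensorHom] at n
      have n' := exch_lax R A B T'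
      rw [Category.assoc, ← whiskerLeft_comp_assoc, h, R.map_comp]
      simp only [whiskerLeft_comp, Category.assoc]
      rw [reassoc_of% n', reassoc_of% n, μ_natural_right]
    exact key _ _ _ _ ih

lemma Matching.eval_lax {X : ι → D} {Y : κ → D} {σ : ι → κ} (φ : ∀ a, X a ⟶ Y (σ a))
    {l : List ι} {l' : List κ} (p : Matching σ l l') :
    p.eval (X := fun a => R.obj (X a)) (Y := fun a => R.obj (Y a)) (fun a => R.map (φ a)) ≫
        laxTprod R Y l' = laxTprod R X l ≫ R.map (p.eval φ) := by
  induction p with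
  | nil => exact id_comp_eq_comp_map_id R _
  | cons a i p ih =>
    have h := i.eval_lax R Y
    have key : ∀ {A B : D} {T U V : C} {T' U' V' : D} (f : A ⟶ B) (t : T ⟶ U)
        (e : R.obj B ⊗ U ⟶ V) (x : V ⟶ R.obj V') (y : U ⟶ R.obj U') (z : T ⟶ R.obj T')
        (t' : T' ⟶ U') (e' : B ⊗ U' ⟶ V'),
        e ≫ x = R.obj B ◁ y ≫ μ R B U' ≫ R.map e' → t ≫ y = z ≫ R.map t' →
        ((R.map f ⊗ₘ t) ≫ e) ≫ x = (R.obj A ◁ z ≫ μ R A T') ≫ R.map ((f ⊗ₘ t') ≫ e') := by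
      intro A B T U V T' U' V' f t e x y z t' e' e₁ e₂
      rw [Category.assoc, Category.assoc, e₁, R.map_comp, ← μ_natural_assoc, ← id_tensorHom,
        ← id_tensorHom, tensorHom_comp_tensorHom_assoc, tensorHom_comp_tensorHom_assoc, e₂]
      simp
    exact key _ _ _ _ _ _ _ _ h ih

lemma tprodMap_lax {X : ι → D} {Y : κ → D} (σ : ι → κ) (φ : ∀ a, X a ⟶ Y (σ a))
    {l : List ι} {l' : List κ} (h : l'.Perm (l.map σ)) :
    tprodMap (X := fun a => R.obj (X a)) (Y := fun a => R.obj (Y a)) σ (fun a => R.map (φ a)) h ≫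
        laxTprod R Y l' = laxTprod R X l ≫ R.map (tprodMap σ φ h) :=
  Matching.eval_lax R φ _

lemma tprodZip_lax (X Y : ι → D) (l : List ι) :
    tprodZip (fun a => R.obj (X a)) (fun a => R.obj (Y a)) l ≫
        tprodHom (fun a => μ R (X a) (Y a)) l ≫ laxTprod R (fun a => X a ⊗ Y a) l =
      (laxTprod R X l ⊗ₘ laxTprod R Y l) ≫ μ R (tprod X l) (tprod Y l) ≫
        R.map (tprodZip X Y l) := by
  induction l with
  | nil =>
    have key : (λ_ (𝟙_ C)).hom ≫ 𝟙 (𝟙_ C) ≫ ε R =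
        (ε R ⊗ₘ ε R) ≫ μ R (𝟙_ D) (𝟙_ D) ≫ R.map (λ_ (𝟙_ D)).hom := by
      rw [tensorHom_def', Category.assoc, ← left_unitality, leftUnitor_naturality,
        Category.id_comp]
    exact key
  | cons a l ih =>
    have key : ∀ {A B : D} {S T U V : C} {S' T' U' : D} (z : S ⊗ T ⟶ U) (m : U ⟶ V)
        (x : V ⟶ R.obj U') (s : S ⟶ R.obj S') (t : T ⟶ R.obj T') (z' : S' ⊗ T' ⟶ U'),
        z ≫ m ≫ x = (s ⊗ₘ t) ≫ μ R S' T' ≫ R.map z' →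
        (tensorμ (R.obj A) S (R.obj B) T ≫ (R.obj A ⊗ R.obj B) ◁ z) ≫
          (μ R A B ⊗ₘ m) ≫ R.obj (A ⊗ B) ◁ x ≫ μ R (A ⊗ B) U' =
        (R.obj A ◁ s ≫ μ R A S' ⊗ₘ R.obj B ◁ t ≫ μ R B T') ≫ μ R (A ⊗ S') (B ⊗ T') ≫
          R.map (tensorμ A S' B T' ≫ (A ⊗ B) ◁ z') := by
      intro A B S T U V S' T' U' z m x s t z' h
      have n₁ : (R.obj A ◁ s ⊗ₘ R.obj B ◁ t) ≫ tensorμ (R.obj A) (R.obj S') (R.obj B) (R.obj T') =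
          tensorμ (R.obj A) S (R.obj B) T ≫ (R.obj A ⊗ R.obj B) ◁ (s ⊗ₘ t) := by
        simpa using tensorμ_natural (𝟙 (R.obj A)) s (𝟙 (R.obj B)) t
      have n₂ := tensorμ_comp_μ_tensorHom_μ_comp_μ R A S' B T'
      rw [← tensorHom_comp_tensorHom, R.map_comp, Category.assoc, Category.assoc, ← reassoc_of% n₂,
        ← μ_natural_right]
      rw [reassoc_of% n₁]
      congr 1
      simp only [← id_tensorHom, tensorHom_comp_tensorHom_assoc]
      rw [h]
    exact key _ _ _ _ _ _ ih

end LaxCoherence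

/-! ### Tensor products, initial objects and maps out of colimits -/

section TensorPreservesColimits

variable {C : Type u} [Category.{v} C] [MonoidalCategory C] [SymmetricCategory C]
  [∀ X : C, PreservesColimits (tensorLeft X)] {ι : Type}

instance preservesColimits_tensorRight (X : C) : PreservesColimits (tensorRight X) :=
  preservesColimits_of_natIso (BraidedCategory.tensorLeftIsoTensorRight X)

/-- The tensor product with an initial object is initial. -/
noncomputable def isInitialTensorLeft (X : C) {Z : C} (h : IsInitial Z) : IsInitial (X ⊗ Z) :=
  have := preservesSmallestColimits_of_preservesColimits (tensorLeft X)
  h.isInitialObj (tensorLeft X)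

/-- The tensor product with an initial object is initial. -/
noncomputable def isInitialTensorRight {Z : C} (h : IsInitial Z) (X : C) : IsInitial (Z ⊗ X) :=
  have := preservesSmallestColimits_of_preservesColimits (tensorRight X)
  h.isInitialObj (tensorRight X)

/-- This disposes of the terms of `M ∘ 𝕀` for the maps that are not bijective. -/
lemma nonempty_isInitial_tprod (X : ι → C) {a : ι} (h : IsInitial (X a)) (l : List ι)
    (ha : a ∈ l) : Nonempty (IsInitial (tprod X l)) := by
  induction l with
  | nil => simp at ha
  | cons b l ih =>
    rcases List.mem_cons.1 ha with rfl | ha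
    · exact ⟨isInitialTensorRight h _⟩
    · obtain ⟨h'⟩ := ih ha
      exact ⟨isInitialTensorLeft _ h'⟩

lemma whiskerRight_colimit_hom_ext {J : Type} [SmallCategory J] (K : J ⥤ C) [HasColimit K]
    {X Y : C} {f g : colimit K ⊗ X ⟶ Y}
    (h : ∀ j, colimit.ι K j ▷ X ≫ f = colimit.ι K j ▷ X ≫ g) : f = g := by
  have := preservesSmallestColimits_of_preservesColimits (tensorRight X)
  exact (isColimitOfPreserves (tensorRight X) (colimit.isColimit K)).hom_ext h

end TensorPreservesColimits

section

variable {C : Type u} [Category.{v} C] [MonoidalCategory C] [SymmetricCategory C] {ι : Type}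

omit [SymmetricCategory C] in
lemma tprodHom_comp {X Y Z : ι → C} (φ : ∀ a, X a ⟶ Y a) (ψ : ∀ a, Y a ⟶ Z a) (l : List ι) :
    tprodHom φ l ≫ tprodHom ψ l = tprodHom (fun a => φ a ≫ ψ a) l := by
  induction l with
  | nil => exact Category.id_comp _
  | cons a l ih => exact (tensorHom_comp_tensorHom _ _ _ _).trans (congrArg (fun t => _ ⊗ₘ t) ih)

omit [SymmetricCategory C] in
lemma tprodHom_id (X : ι → C) (l : List ι) : tprodHom (fun a => 𝟙 (X a)) l = 𝟙 _ := by
  induction l with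
  | nil => rfl
  | cons a l ih => exact (congrArg (fun t => _ ⊗ₘ t) ih).trans (id_tensorHom_id _ _)

lemma tprodZip_natural {X X' Y Y' : ι → C} (φ : ∀ a, X a ⟶ X' a) (ψ : ∀ a, Y a ⟶ Y' a)
    (l : List ι) :
    tprodZip X Y l ≫ tprodHom (fun a => φ a ⊗ₘ ψ a) l =
      (tprodHom φ l ⊗ₘ tprodHom ψ l) ≫ tprodZip X' Y' l := by
  induction l with
  | nil =>
    have key : (λ_ (𝟙_ C)).hom ≫ 𝟙 (𝟙_ C) = (𝟙 (𝟙_ C) ⊗ₘ 𝟙 (𝟙_ C)) ≫ (λ_ (𝟙_ C)).hom := by simp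
    exact key
  | cons a l ih =>
    have key : ∀ {A A' B B' S S' T T' U U' : C} (f : A ⟶ A') (g : B ⟶ B') (s : S ⟶ S')
        (t : T ⟶ T') (z : S ⊗ T ⟶ U) (z' : S' ⊗ T' ⟶ U') (w : U ⟶ U'),
        z ≫ w = (s ⊗ₘ t) ≫ z' →
        (tensorμ A S B T ≫ (A ⊗ B) ◁ z) ≫ ((f ⊗ₘ g) ⊗ₘ w) =
          ((f ⊗ₘ s) ⊗ₘ (g ⊗ₘ t)) ≫ tensorμ A' S' B' T' ≫ (A' ⊗ B') ◁ z' := by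
      intro A A' B B' S S' T T' U U' f g s t z z' w h
      have n := tensorμ_natural f s g t
      rw [reassoc_of% n]
      simp only [← id_tensorHom, Category.assoc, tensorHom_comp_tensorHom, h, Category.comp_id,
        Category.id_comp]
    exact key _ _ _ _ _ _ _ ih

/-- The value does not depend on the matching, as `List.finRange n` has no repetitions, so the
matching that moves nothing may be used. -/
lemma tensorFinMap_refl {n : ℕ} {X Y : Fin n → C} (φ : ∀ i, X i ⟶ Y i) :
    tensorFinMap (Equiv.refl (Fin n)) φ = tprodHom φ (List.finRange n) := by
  have h : ∀ l : List (Fin n), ∃ r : Matching (fun a : Fin n => a) l l,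
      r.eval (X := X) (Y := Y) φ = tprodHom φ l := by
    intro l
    induction l with
    | nil => exact ⟨.nil, rfl⟩
    | cons a l ih =>
      obtain ⟨r, hr⟩ := ih
      exact ⟨.cons a (.here l) r, (Category.comp_id (φ a ⊗ₘ r.eval φ)).trans
        (congrArg (fun t => φ a ⊗ₘ t) hr)⟩
  obtain ⟨r, hr⟩ := h (List.finRange n)
  exact (tprodMap_eq _ _ _ (List.nodup_finRange n) r).trans hr

lemma compTermMap_refl {M M' N N' : SymSeq C} (u : M ⟶ M') (v : N ⟶ N') {J : FinSet} {n : ℕ}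
    (f : J → Fin n) :
    compTermMap u v (f := f) (f' := f) (Equiv.refl _) (Equiv.refl _) (fun _ => rfl) =
      u.app (finSet n) ⊗ₘ tprodHom (fun i => v.app (fibre f i)) (List.finRange n) := by
  have h₁ : M.map (finBij (Equiv.refl (Fin n))) = 𝟙 _ := M.map_id _
  have h₂ : ∀ i, N.map (fibreMap (f := f) (g := f) (a := i) (b := i) (Equiv.refl _)
    (fun _ => Iff.rfl)) = 𝟙 _ := fun i => N.map_id _
  simp only [compTermMap, h₁, Category.id_comp]
  refine congrArg (fun t => _ ⊗ₘ t) ((tensorFinMap_refl _).trans ?_)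
  congr 1
  funext i
  exact (congrArg (fun t => t ≫ v.app (fibre f i)) (h₂ i)).trans (Category.id_comp _)

lemma compι_compMap [HasColimits C] {M M' N N' : SymSeq C} (u : M ⟶ M') (v : N ⟶ N')
    {J : FinSet} {n : ℕ} (f : J → Fin n) :
    compι M N f ≫ (compMap u v).app J =
      (u.app (finSet n) ⊗ₘ tprodHom (fun i => v.app (fibre f i)) (List.finRange n)) ≫
        compι M' N' f := by
  rw [← compTermMap_refl]
  exact compι_colimMap u v (Equiv.refl _) f

end

/-! ### The lax structure maps for the composition product -/

section LaxComposition

open Functor.LaxMonoidal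

variable {C : Type u₁} [Category.{v₁} C] [MonoidalCategory C] [SymmetricCategory C]
  {D : Type u₂} [Category.{v₂} D] [MonoidalCategory D] [SymmetricCategory D]
  (R : D ⥤ C) [R.LaxBraided]

/-- The lax monoidal structure map on the terms of the composition product. -/
noncomputable def laxTerm (A B : SymSeq D) {J : FinSet} {n : ℕ} (f : J → Fin n) :
    compTerm ((aritywise R).obj A) ((aritywise R).obj B) f ⟶ R.obj (compTerm A B f) :=
  R.obj (A.obj (finSet n)) ◁ laxTprod R (fun i => B.obj (fibre f i)) (List.finRange n) ≫
    μ R (A.obj (finSet n)) (tensorFin (fun i => B.obj (fibre f i)))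

/-- One naturality statement in all variables: with `θ` the identity it makes `laxTerm` descend to
the colimit, and with general `θ`, `u`, `v` it makes the result natural in `J`, `A` and `B`. -/
lemma compTermMap_laxTerm {A A' B B' : SymSeq D} (u : A ⟶ A') (v : B ⟶ B') {J J' : FinSet}
    {n n' : ℕ} {f : J → Fin n} {f' : J' → Fin n'} (σ : Fin n ≃ Fin n') (θ : J ≃ J')
    (h : ∀ j, f' (θ j) = σ (f j)) :
    compTermMap ((aritywise R).map u) ((aritywise R).map v) σ θ h ≫ laxTerm R A' B' f' =
      laxTerm R A B f ≫ R.map (compTermMap u v σ θ h) := by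
  have h₁ := tprodMap_lax R (X := fun i => B.obj (fibre f i)) (Y := fun i => B'.obj (fibre f' i))
    σ (fun i => B.map (fibreMap θ (by simp [h])) ≫ v.app (fibre f' (σ i))) (finRange_perm σ)
  have key : ∀ {X Y : D} {S T : C} {S' T' : D} (a : X ⟶ Y) (t : S ⟶ T) (s : S ⟶ R.obj S')
      (s' : T ⟶ R.obj T') (t' : S' ⟶ T'), t ≫ s' = s ≫ R.map t' →
      (R.map a ⊗ₘ t) ≫ R.obj Y ◁ s' ≫ μ R Y T' =
        (R.obj X ◁ s ≫ μ R X S') ≫ R.map (a ⊗ₘ t') := by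
    intro X Y S T S' T' a t s s' t' h
    rw [Category.assoc, ← μ_natural, ← id_tensorHom, ← id_tensorHom,
      tensorHom_comp_tensorHom_assoc, tensorHom_comp_tensorHom_assoc, h]
    simp
  have h₂ := key (A.map (finBij σ) ≫ u.app (finSet n')) _ _ _ _ h₁
  simp only [R.map_comp] at h₂
  exact h₂

variable [HasColimits C] [HasColimits D]

/-- The lax monoidal structure map for the composition product. -/
noncomputable def laxComp (A B : SymSeq D) (J : FinSet) :
    colimit (compDiagram ((aritywise R).obj A) ((aritywise R).obj B) J) ⟶
      R.obj (colimit (compDiagram A B J)) :=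
  colimit.desc _
    { pt := R.obj (colimit (compDiagram A B J))
      ι :=
        { app := fun x => laxTerm R A B x.f ≫ R.map (compι A B x.f)
          naturality := fun x y σ => by
            have h₁ := compTermMap_laxTerm R (𝟙 A) (𝟙 B) σ.1 (Equiv.refl _) σ.2
            rw [CategoryTheory.Functor.map_id, CategoryTheory.Functor.map_id] at h₁
            have h₂ := compTermMap_ι A B (f := x.f) (f' := y.f) σ.1 σ.2
            refine ((Category.assoc _ _ _).symm.trans (congrArg (fun t => t ≫ R.map (compι A B y.f))
              h₁)).trans ?_
            rw [Category.assoc, ← R.map_comp, h₂]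
            exact (Category.comp_id _).symm } }

lemma compι_laxComp (A B : SymSeq D) {J : FinSet} {n : ℕ} (f : J → Fin n) :
    compι ((aritywise R).obj A) ((aritywise R).obj B) f ≫ laxComp R A B J =
      laxTerm R A B f ≫ R.map (compι A B f) :=
  colimit.ι_desc _ _

lemma compColimMap_laxComp {A A' B B' : SymSeq D} (u : A ⟶ A') (v : B ⟶ B') {J J' : FinSet}
    (θ : J ≃ J') :
    compColimMap ((aritywise R).map u) ((aritywise R).map v) θ ≫ laxComp R A' B' J' =
      laxComp R A B J ≫ R.map (compColimMap u v θ) := by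
  refine colimit.hom_ext fun ⟨n, f⟩ => ?_
  have key : ∀ {X X' T T' : C} {Y Y' S S' : D} (i : T ⟶ X) (c : X ⟶ X') (t : T ⟶ T')
      (i' : T' ⟶ X') (l : X ⟶ R.obj Y) (l' : X' ⟶ R.obj Y') (m : T ⟶ R.obj S)
      (m' : T' ⟶ R.obj S') (j : S ⟶ Y) (j' : S' ⟶ Y') (s : S ⟶ S') (d : Y ⟶ Y'),
      i ≫ c = t ≫ i' → i' ≫ l' = m' ≫ R.map j' → t ≫ m' = m ≫ R.map s → i ≫ l = m ≫ R.map j →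
      j ≫ d = s ≫ j' → i ≫ c ≫ l' = i ≫ l ≫ R.map d := by
    intro X X' T T' Y Y' S S' i c t i' l l' m m' j j' s d h₁ h₂ h₃ h₄ h₅
    rw [reassoc_of% h₁, h₂, reassoc_of% h₃, reassoc_of% h₄, ← R.map_comp, ← R.map_comp, h₅]
  exact key _ _ _ _ _ _ _ _ _ _ _ _ (compι_colimMap _ _ θ f) (compι_laxComp R A' B' _)
    (compTermMap_laxTerm R u v (Equiv.refl _) θ _) (compι_laxComp R A B f)
    (compι_colimMap u v θ f)

/-- The lax monoidal structure map for the composition product, as a morphism of symmetric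
sequences. -/
noncomputable def laxCompMap (A B : SymSeq D) :
    compObj ((aritywise R).obj A) ((aritywise R).obj B) ⟶ (aritywise R).obj (compObj A B) where
  app J := laxComp R A B J
  naturality J J' θ := by
    have h := compColimMap_laxComp R (𝟙 A) (𝟙 B) (J := J) (J' := J') θ
    rw [CategoryTheory.Functor.map_id, CategoryTheory.Functor.map_id] at h
    exact h

lemma compMap_laxCompMap {A A' B B' : SymSeq D} (u : A ⟶ A') (v : B ⟶ B') :
    compMap ((aritywise R).map u) ((aritywise R).map v) ≫ laxCompMap R A' B' =
      laxCompMap R A B ≫ (aritywise R).map (compMap u v) := by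
  ext J
  exact compColimMap_laxComp R u v (Equiv.refl J)

end LaxComposition

section Unit

open Functor.LaxMonoidal

variable {C : Type u₁} [Category.{v₁} C] [MonoidalCategory C] [HasColimits C]
  {D : Type u₂} [Category.{v₂} D] [MonoidalCategory D] [HasColimits D]

lemma nonempty_isInitial_unitObj (C : Type u₁) [Category.{v₁} C] [MonoidalCategory C]
    [HasColimits C] {J : FinSet} (h : Nat.card J ≠ 1) :
    Nonempty (IsInitial (unitObj C J)) := by
  have : unitObj C J = ⊥_ C := if_neg h
  exact ⟨IsInitial.ofIso initialIsInitial (eqToIso this.symm)⟩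

variable (R : D ⥤ C) [R.LaxMonoidal]

open Classical in
/-- The lax monoidal structure map for the unit symmetric sequence. -/
noncomputable def laxUnitApp (J : FinSet) : unitObj C J ⟶ R.obj (unitObj D J) :=
  if h : Nat.card J = 1 then
    eqToHom (unitObj_eq h) ≫ ε R ≫ R.map (eqToHom (unitObj_eq h).symm)
  else (nonempty_isInitial_unitObj C h).some.to _

lemma laxUnitApp_eq {J : FinSet} (h : Nat.card J = 1) :
    laxUnitApp R J = eqToHom (unitObj_eq h) ≫ ε R ≫ R.map (eqToHom (unitObj_eq h).symm) :=
  dif_pos h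

/-- The lax monoidal structure map for the unit symmetric sequence. -/
noncomputable def laxUnit : unitSeq C ⟶ (aritywise R).obj (unitSeq D) where
  app J := laxUnitApp R J
  naturality J K θ := by
    change eqToHom (unitObj_congr θ) ≫ laxUnitApp R K =
      laxUnitApp R J ≫ R.map (eqToHom (unitObj_congr θ))
    by_cases h : Nat.card J = 1
    · have h' : Nat.card K = 1 := by rw [← Nat.card_congr θ, h]
      rw [laxUnitApp_eq R h, laxUnitApp_eq R h']
      simp [← R.map_comp]
    · obtain ⟨h'⟩ := nonempty_isInitial_unitObj C h
      exact h'.hom_ext _ _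

end Unit

/-! ### Associativity and unitality of the lax structure for `∘` -/

section LaxComposition

open Functor.LaxMonoidal

variable {C : Type u₁} [Category.{v₁} C] [MonoidalCategory C] [SymmetricCategory C]
  {D : Type u₂} [Category.{v₂} D] [MonoidalCategory D] [SymmetricCategory D]
  (R : D ⥤ C) [R.LaxBraided]

/-- The shuffle is composed of the enumeration of the fibres, a permutation of the factors of `P`,
their regrouping and the interleaving with the factors of `N`. Each piece commutes with the iterated
`μ` by a lemma above, and the squares are pasted; `key₁` splits off the factor `M(n)` by
associativity and `key₂` treats the rest. -/
lemma assocShuffle_laxTerm (M N P : SymSeq D) {J : FinSet} {m n : ℕ} (f : J → Fin m)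
    (g : finSet m → Fin n) {r : Fin n → ℕ} (e : ∀ k, {i : Fin m // g i = k} ≃ Fin (r k)) :
    laxTerm R M N g ▷ tensorFin (fun i => R.obj (P.obj (fibre f i))) ≫
        R.obj (compTerm M N g) ◁ laxTprod R (fun i => P.obj (fibre f i)) (List.finRange m) ≫
          μ R (compTerm M N g) (tensorFin (fun i => P.obj (fibre f i))) ≫
            R.map (assocShuffle M N P f g e) =
      assocShuffle ((aritywise R).obj M) ((aritywise R).obj N) ((aritywise R).obj P) f g e ≫
        R.obj (M.obj (finSet n)) ◁
            (tprodHom (fun k => laxTerm R N P (fibreComp f g e k)) (List.finRange n) ≫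
              laxTprod R (fun k => compTerm N P (fibreComp f g e k)) (List.finRange n)) ≫
          μ R (M.obj (finSet n)) (tensorFin (fun k => compTerm N P (fibreComp f g e k))) := by
  have h₁ := tprodHom_comp_laxTprod R
    (fun k => N.map (bij (J := fibre g k) (K := finSet (r k)) (e k))) (List.finRange n)
  have h₂ := tprodMap_lax R (Y := fun p : (Σ k, Fin (r k)) =>
    P.obj (fibre (fibreComp f g e p.1) p.2)) (pairing g e)
    (fun i => P.map (fibreCompEquiv f g e i)) (pairing_perm g e)
  have h₃ := tprodSigma_comp_laxTprod R (fun p : (Σ k, Fin (r k)) =>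
    P.obj (fibre (fibreComp f g e p.1) p.2)) (fun k => List.finRange (r k)) (List.finRange n)
  have h₄ := tprodZip_lax R (fun k => N.obj (finSet (r k)))
    (fun k => tensorFin (fun j => P.obj (fibre (fibreComp f g e k) j))) (List.finRange n)
  have h₅ := tprodZip_natural (fun k => 𝟙 (R.obj (N.obj (finSet (r k)))))
    (fun k => laxTprod R (fun j => P.obj (fibre (fibreComp f g e k) j)) (List.finRange (r k)))
    (List.finRange n)
  have h₆ := tprodHom_comp (fun k => 𝟙 (R.obj (N.obj (finSet (r k)))) ⊗ₘ
      laxTprod R (fun j => P.obj (fibre (fibreComp f g e k) j)) (List.finRange (r k)))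
    (fun k => μ R (N.obj (finSet (r k)))
      (tensorFin (fun j => P.obj (fibre (fibreComp f g e k) j)))) (List.finRange n)
  have h₇ := tprodHom_id (fun k => R.obj (N.obj (finSet (r k)))) (List.finRange n)
  -- Separating the iterated `μ` of the factors of `P` from the last `μ` allows the naturality of
  -- `tprodZip` to be applied before `tprodZip_lax`.
  have h₈ : tprodHom (fun k => laxTerm R N P (fibreComp f g e k)) (List.finRange n) =
      tprodHom (fun k => 𝟙 (R.obj (N.obj (finSet (r k)))) ⊗ₘ
          laxTprod R (fun j => P.obj (fibre (fibreComp f g e k) j)) (List.finRange (r k)))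
        (List.finRange n) ≫ tprodHom (fun k => μ R (N.obj (finSet (r k)))
          (tensorFin (fun j => P.obj (fibre (fibreComp f g e k) j)))) (List.finRange n) := by
    rw [h₆]
    congr 1
    funext k
    rw [id_tensorHom]
    rfl
  have key₁ : ∀ {A Bt Pt W : D} {S Z W' : C} (x : S ⟶ R.obj Bt) (y : Z ⟶ R.obj Pt)
      (w' : S ⊗ Z ⟶ W') (l : W' ⟶ R.obj W) (w : Bt ⊗ Pt ⟶ W),
      w' ≫ l = (x ⊗ₘ y) ≫ μ R Bt Pt ≫ R.map w →
      (R.obj A ◁ x ≫ μ R A Bt) ▷ Z ≫ R.obj (A ⊗ Bt) ◁ y ≫ μ R (A ⊗ Bt) Pt ≫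
          R.map ((α_ A Bt Pt).hom ≫ A ◁ w) =
        ((α_ (R.obj A) S Z).hom ≫ R.obj A ◁ w') ≫ R.obj A ◁ l ≫ μ R A W := by
    intro A Bt Pt W S Z W' x y w' l w h
    rw [R.map_comp, comp_whiskerRight, Category.assoc, Category.assoc, ← whisker_exchange_assoc,
      associativity_assoc, ← whiskerLeft_comp_assoc, h, whiskerLeft_comp, whiskerLeft_comp]
    simp only [Category.assoc]
    rw [μ_natural_right]
    simp [MonoidalCategory.tensorHom_def]
  have key₂ : ∀ {Bt B' Pt P' P'' W : D} {S S' T Z Z' Z'' U V : C} (x : S ⟶ R.obj Bt)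
      (y : Z ⟶ R.obj Pt) (p : S ⟶ S') (q : Z ⟶ Z') (s : Z' ⟶ Z'') (z : S' ⊗ Z'' ⟶ U)
      (a : U ⟶ V) (b : V ⟶ T) (c : T ⟶ R.obj W) (p' : Bt ⟶ B') (q' : Pt ⟶ P') (s' : P' ⟶ P'')
      (z' : B' ⊗ P'' ⟶ W) (x' : S' ⟶ R.obj B') (y' : Z' ⟶ R.obj P') {Z₃ : C} (i : S' ⟶ S')
      (d : Z'' ⟶ Z₃) (z'' : S' ⊗ Z₃ ⟶ V) (y'' : Z₃ ⟶ R.obj P''),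
      p ≫ x' = x ≫ R.map p' → q ≫ y' = y ≫ R.map q' → s ≫ d ≫ y'' = y' ≫ R.map s' →
      z'' ≫ b ≫ c = (x' ⊗ₘ y'') ≫ μ R B' P'' ≫ R.map z' → z ≫ a = (i ⊗ₘ d) ≫ z'' → i = 𝟙 _ →
      ((p ⊗ₘ (q ≫ s)) ≫ z) ≫ (a ≫ b) ≫ c =
        (x ⊗ₘ y) ≫ μ R Bt Pt ≫ R.map ((p' ⊗ₘ (q' ≫ s')) ≫ z') := by
    intro Bt B' Pt P' P'' W S S' T Z Z' Z'' U V x y p q s z a b c p' q' s' z' x' y' Z₃ i d z'' y''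
      e₁ e₂ e₃ e₄ e₅ e₆
    subst e₆
    rw [R.map_comp, ← μ_natural_assoc, tensorHom_comp_tensorHom_assoc, R.map_comp,
      ← reassoc_of% e₂, ← e₃, ← e₁]
    simp only [Category.assoc]
    rw [reassoc_of% e₅, e₄, tensorHom_comp_tensorHom_assoc, tensorHom_comp_tensorHom_assoc]
    simp
  rw [h₈]
  exact key₁ _ _ _ _ _ (key₂ _ _ _ _ _ _ _ _ _ _ _ _ _ _ _ _ _ _ _ h₁ h₂ h₃ h₄ h₅ h₇)

variable [HasColimits C] [HasColimits D] [∀ X : C, PreservesColimits (tensorLeft X)]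

lemma laxCompMap_associativity (hC : CompositionMonoidal C) (hD : CompositionMonoidal D)
    (M N P : SymSeq D) :
    compMap (laxCompMap R M N) (𝟙 ((aritywise R).obj P)) ≫ laxCompMap R (compObj M N) P ≫
        (aritywise R).map (hD.associator M N P).hom =
      (hC.associator ((aritywise R).obj M) ((aritywise R).obj N) ((aritywise R).obj P)).hom ≫
        compMap (𝟙 ((aritywise R).obj M)) (laxCompMap R N P) ≫ laxCompMap R M (compObj N P) := by
  ext J
  -- A term of `(M ∘ N) ∘ P` has a colimit as its left tensor factor, so it is tested on the terms
  -- for pairs `J → {1, …, m} → {1, …, n}`.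
  refine colimit.hom_ext fun ⟨m, f⟩ => whiskerRight_colimit_hom_ext _ fun ⟨n, g⟩ => ?_
  have hr : ∀ k : Fin n, ∃ r : ℕ, Nonempty ({i : Fin m // g i = k} ≃ Fin r) := fun k =>
    ⟨_, ⟨Finite.equivFin _⟩⟩
  choose r e' using hr
  have e := fun k => (e' k).some
  have a₁ := compι_compMap (laxCompMap R M N) (𝟙 ((aritywise R).obj P)) f
  have a₂ := compι_laxComp R (compObj M N) P f
  have a₃ := compι_laxComp R M N g
  have a₄ := assocShuffle_laxTerm R M N P f g e
  have a₅ := hD.ι_associator M N P f g e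
  have a₆ := hC.ι_associator ((aritywise R).obj M) ((aritywise R).obj N)
    ((aritywise R).obj P) f g e
  have a₇ := compι_compMap (𝟙 ((aritywise R).obj M)) (laxCompMap R N P) (J := J)
    (fun x => g (f x))
  have a₈ := compι_laxComp R M (compObj N P) (J := J) (fun x => g (f x))
  have a₉ : tprodHom (fun k => compι ((aritywise R).obj N) ((aritywise R).obj P)
        (fibreComp f g e k)) (List.finRange n) ≫
      tprodHom (fun k => laxComp R N P (fibre (J := J) (fun x => g (f x)) k)) (List.finRange n) =
      tprodHom (fun k => laxTerm R N P (fibreComp f g e k)) (List.finRange n) ≫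
      tprodHom (fun k => R.map (compι N P (fibreComp f g e k))) (List.finRange n) := by
    rw [tprodHom_comp, tprodHom_comp]
    congr 1
    funext k
    exact compι_laxComp R N P (fibreComp f g e k)
  have a₁₀ := tprodHom_comp_laxTprod R (fun k => compι N P (fibreComp f g e k)) (List.finRange n)
  have a₁₁ := tprodHom_id (fun i => R.obj (P.obj (fibre f i))) (List.finRange m)
  have key : ∀ {A X' T' Pt F₂ G W V : D} {T X Z E E₂ E₃ E₄ W' W'' V' V'' : C}
      (ig : T ⟶ X) (jf : X ⊗ Z ⟶ E) (cm : E ⟶ E₂) (lc : E₂ ⟶ R.obj F₂) (αD : F₂ ⟶ G)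
      (αC : E ⟶ E₃) (cm' : E₃ ⟶ E₄) (lc' : E₄ ⟶ R.obj G) (l : X ⟶ R.obj X') (t : Z ⟶ Z)
      (jf₂ : R.obj X' ⊗ Z ⟶ E₂) (ll : Z ⟶ R.obj Pt) (jf' : X' ⊗ Pt ⟶ F₂) (lt : T ⟶ R.obj T')
      (ig' : T' ⟶ X') (sh : T' ⊗ Pt ⟶ A ⊗ W) (sh' : T ⊗ Z ⟶ R.obj A ⊗ W') (tl : W' ⟶ W'')
      (lw : W'' ⟶ R.obj W) (ti : W ⟶ V) (gf' : A ⊗ V ⟶ G) (ti' : W' ⟶ V')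
      (gf : R.obj A ⊗ V' ⟶ E₃) (tl' : V' ⟶ V'') (gf₂ : R.obj A ⊗ V'' ⟶ E₄)
      (lw' : V'' ⟶ R.obj V) (tr : W'' ⟶ V''),
      jf ≫ cm = (l ⊗ₘ t) ≫ jf₂ → jf₂ ≫ lc = (R.obj X' ◁ ll ≫ μ R X' Pt) ≫ R.map jf' →
      ig ≫ l = lt ≫ R.map ig' →
      lt ▷ Z ≫ R.obj T' ◁ ll ≫ μ R T' Pt ≫ R.map sh = sh' ≫ R.obj A ◁ (tl ≫ lw) ≫ μ R A W →
      ig' ▷ Pt ≫ jf' ≫ αD = sh ≫ A ◁ ti ≫ gf' → ig ▷ Z ≫ jf ≫ αC = sh' ≫ R.obj A ◁ ti' ≫ gf →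
      gf ≫ cm' = (𝟙 (R.obj A) ⊗ₘ tl') ≫ gf₂ →
      gf₂ ≫ lc' = (R.obj A ◁ lw' ≫ μ R A V) ≫ R.map gf' → ti' ≫ tl' = tl ≫ tr →
      tr ≫ lw' = lw ≫ R.map ti → t = 𝟙 Z →
      ig ▷ Z ≫ jf ≫ cm ≫ lc ≫ R.map αD = ig ▷ Z ≫ jf ≫ αC ≫ cm' ≫ lc' := by
    intro A X' T' Pt F₂ G W V T X Z E E₂ E₃ E₄ W' W'' V' V'' ig jf cm lc αD αC cm' lc' l t jf₂ ll
      jf' lt ig' sh sh' tl lw ti gf' ti' gf tl' gf₂ lw' tr b₁ b₂ b₃ b₄ b₅ b₆ b₇ b₈ b₉ b₁₀ b₁₁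
    subst b₁₁
    rw [reassoc_of% b₁, reassoc_of% b₂, reassoc_of% b₆, reassoc_of% b₇, b₈]
    simp only [tensorHom_id, id_tensorHom, Category.assoc]
    rw [← comp_whiskerRight_assoc, b₃, ← whiskerLeft_comp_assoc, ← whiskerLeft_comp_assoc,
      Category.assoc, reassoc_of% b₉, b₁₀, ← Category.assoc tl, whiskerLeft_comp, Category.assoc,
      μ_natural_right_assoc, ← R.map_comp, ← reassoc_of% b₄, ← R.map_comp, ← R.map_comp, ← b₅,
      comp_whiskerRight_assoc, ← whisker_exchange_assoc, μ_natural_left_assoc, R.map_comp,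
      R.map_comp, R.map_comp]
  exact key _ _ _ _ _ _ _ _ _ _ _ _ _ _ _ _ _ _ _ _ _ _ _ _ _ _ _ a₁ a₂ a₃ a₄ a₅ a₆ a₇ a₈
    a₉ a₁₀ a₁₁

lemma laxCompMap_leftUnitality (hC : CompositionMonoidal C) (hD : CompositionMonoidal D)
    (M : SymSeq D) :
    (hC.leftUnitor ((aritywise R).obj M)).hom =
      compMap (laxUnit R) (𝟙 ((aritywise R).obj M)) ≫ laxCompMap R (unitSeq D) M ≫
        (aritywise R).map (hD.leftUnitor M).hom := by
  ext J
  refine colimit.hom_ext fun ⟨n, f⟩ => ?_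
  by_cases h : n = 1
  · subst h
    have a₁ := hC.ι_leftUnitor ((aritywise R).obj M) f
    have a₂ := hD.ι_leftUnitor M f
    have a₃ := compι_compMap (laxUnit R) (𝟙 ((aritywise R).obj M)) f
    have a₄ := compι_laxComp R (unitSeq D) M f
    have a₅ := laxUnitApp_eq R (J := finSet 1) (Nat.card_fin 1)
    have a₆ := tprodHom_id (fun i => R.obj (M.obj (fibre f i))) (List.finRange 1)
    have key : ∀ {U X Y G : D} {U' E E₂ : C} (jf : U' ⊗ (R.obj X ⊗ 𝟙_ C) ⟶ E) (l : E ⟶ R.obj Y)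
        (x' : U' ⟶ 𝟙_ C) (x : U ⟶ 𝟙_ D) (y : 𝟙_ D ⟶ U) (a : X ⟶ Y) (jd : U ⊗ (X ⊗ 𝟙_ D) ⟶ G)
        (ld : G ⟶ Y) (cm : E ⟶ E₂) (v : U' ⟶ R.obj U) (t : R.obj X ⊗ 𝟙_ C ⟶ R.obj X ⊗ 𝟙_ C)
        (je : R.obj U ⊗ (R.obj X ⊗ 𝟙_ C) ⟶ E₂) (lc : E₂ ⟶ R.obj G),
        y ≫ x = 𝟙 _ → t = 𝟙 _ →
        jf ≫ l = (x' ⊗ₘ ((ρ_ (R.obj X)).hom ≫ R.map a)) ≫ (λ_ (R.obj Y)).hom →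
        jd ≫ ld = (x ⊗ₘ ((ρ_ X).hom ≫ a)) ≫ (λ_ Y).hom → jf ≫ cm = (v ⊗ₘ t) ≫ je →
        je ≫ lc = (R.obj U ◁ (R.obj X ◁ ε R ≫ μ R X (𝟙_ D)) ≫ μ R U (X ⊗ 𝟙_ D)) ≫ R.map jd →
        v = x' ≫ ε R ≫ R.map y → jf ≫ l = jf ≫ cm ≫ lc ≫ R.map ld := by
      intro U X Y G U' E E₂ jf l x' x y a jd ld cm v t je lc b₀ b₁ b₂ b₃ b₄ b₅ b₆
      subst b₁ b₆
      rw [b₂, reassoc_of% b₄, reassoc_of% b₅, ← R.map_comp, b₃, R.map_comp,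
        ← μ_natural_assoc, ← id_tensorHom, tensorHom_comp_tensorHom_assoc,
        tensorHom_comp_tensorHom_assoc]
      simp only [Category.assoc, Category.id_comp, ← R.map_comp, b₀]
      rw [right_unitality, left_unitality]
      simp only [Category.assoc, R.map_comp, MonoidalCategory.tensorHom_def']
      simp
    exact key _ _ _ _ _ _ _ _ _ _ _ _ _ (eqToHom_trans _ _) a₆ a₁ a₂ a₃ a₄ a₅
  -- For `n ≠ 1` the factor `𝕀(n)` is initial, hence so is the whole term, and there is nothing to
  -- compare.
  · obtain ⟨h'⟩ := nonempty_isInitial_unitObj C (J := finSet n) (by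
      rwa [show Nat.card (finSet n) = n from Nat.card_fin n])
    exact (isInitialTensorRight h' _).hom_ext _ _

lemma exists_card_fibre_ne_one {J : FinSet} {n : ℕ} (f : J → Fin n)
    (hf : ¬ Function.Bijective f) : ∃ i, Nat.card (fibre f i) ≠ 1 := by
  by_contra! h
  refine hf (Function.bijective_iff_existsUnique f |>.2 fun i => ?_)
  obtain ⟨h₁, ⟨⟨x, hx⟩⟩⟩ := Nat.card_eq_one_iff_unique.1 (h i)
  exact ⟨x, hx, fun y hy => congrArg Subtype.val
    (h₁.elim (⟨y, hy⟩ : {x : J // f x = i}) ⟨x, hx⟩)⟩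

lemma laxCompMap_rightUnitality (hC : CompositionMonoidal C) (hD : CompositionMonoidal D)
    (M : SymSeq D) :
    (hC.rightUnitor ((aritywise R).obj M)).hom =
      compMap (𝟙 ((aritywise R).obj M)) (laxUnit R) ≫ laxCompMap R M (unitSeq D) ≫
        (aritywise R).map (hD.rightUnitor M).hom := by
  ext J
  refine colimit.hom_ext fun ⟨n, f⟩ => ?_
  by_cases h : Function.Bijective f
  · obtain ⟨f, rfl⟩ : ∃ f' : J ≃ Fin n, f = f' := ⟨Equiv.ofBijective f h, rfl⟩
    have a₁ := hC.ι_rightUnitor ((aritywise R).obj M) f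
    have a₂ := hD.ι_rightUnitor M f
    have a₃ := compι_compMap (𝟙 ((aritywise R).obj M)) (laxUnit R) f
    have a₄ := compι_laxComp R M (unitSeq D) f
    have a₅ : tprodHom (fun i => (laxUnit R).app (fibre f i)) (List.finRange n) =
        tprodHom (fun i => eqToHom (unitObj_eq (card_fibre_equiv f i))) (List.finRange n) ≫
          tprodHom (fun _ => ε R) (List.finRange n) ≫
          tprodHom (fun i => R.map (eqToHom (unitObj_eq (card_fibre_equiv f i)).symm))
            (List.finRange n) := by
      rw [tprodHom_comp, tprodHom_comp]
      congr 1
      funext i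
      exact laxUnitApp_eq R (card_fibre_equiv f i)
    have a₆ := tprodHom_comp_laxTprod R
      (fun i => eqToHom (unitObj_eq (C := D) (card_fibre_equiv f i)).symm) (List.finRange n)
    have a₇ := tprodUnit_comp_ε R (List.finRange n)
    have a₈ : tprodHom (fun i => eqToHom (unitObj_eq (C := D) (card_fibre_equiv f i)).symm)
        (List.finRange n) ≫ tprodHom (fun i => eqToHom (unitObj_eq (card_fibre_equiv f i)))
          (List.finRange n) = 𝟙 _ := by
      rw [tprodHom_comp, ← tprodHom_id]
      congr 1
      funext i
      exact eqToHom_trans _ _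
    have key : ∀ {A Y G U V : D} {E E₂ U' U₁ U₂ V₁ : C} (jf : R.obj A ⊗ U' ⟶ E)
        (l : E ⟶ R.obj Y) (a : A ⟶ Y) (x' : U' ⟶ U₁) (w' : U₁ ⟶ 𝟙_ C) (jd : A ⊗ U ⟶ G)
        (ld : G ⟶ Y) (x : U ⟶ V) (w : V ⟶ 𝟙_ D) (cm : E ⟶ E₂) (v : U' ⟶ U₂)
        (je : R.obj A ⊗ U₂ ⟶ E₂) (lc : E₂ ⟶ R.obj G) (lu : U₂ ⟶ R.obj U) (lv : V₁ ⟶ R.obj V)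
        (e : U₁ ⟶ V₁) (y' : V₁ ⟶ U₂) (y : V ⟶ U),
        jf ≫ l = (R.map a ⊗ₘ (x' ≫ w')) ≫ (ρ_ (R.obj Y)).hom →
        jd ≫ ld = (a ⊗ₘ (x ≫ w)) ≫ (ρ_ Y).hom → jf ≫ cm = (𝟙 _ ⊗ₘ v) ≫ je →
        je ≫ lc = (R.obj A ◁ lu ≫ μ R A U) ≫ R.map jd → v = x' ≫ e ≫ y' →
        y' ≫ lu = lv ≫ R.map y → e ≫ lv ≫ R.map w = w' ≫ ε R → y ≫ x = 𝟙 _ →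
        jf ≫ l = jf ≫ cm ≫ lc ≫ R.map ld := by
      intro A Y G U V E E₂ U' U₁ U₂ V₁ jf l a x' w' jd ld x w cm v je lc lu lv e y' y
        b₁ b₂ b₃ b₄ b₅ b₆ b₇ b₈
      subst b₅
      rw [b₁, reassoc_of% b₃, reassoc_of% b₄, ← R.map_comp, b₂, R.map_comp,
        ← μ_natural_assoc, ← id_tensorHom, tensorHom_comp_tensorHom_assoc,
        tensorHom_comp_tensorHom_assoc]
      simp only [Category.assoc, Category.id_comp]
      rw [reassoc_of% b₆, ← R.map_comp, reassoc_of% b₈, b₇, right_unitality]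
      simp only [MonoidalCategory.tensorHom_def]
      simp
    exact key _ _ _ _ _ _ _ _ _ _ _ _ _ _ _ _ _ _ a₁ a₂ a₃ a₄ a₅ a₆ a₇ a₈
  -- If `f` is not bijective, some fibre does not have exactly one element; its factor is initial
  -- and makes the term initial.
  · obtain ⟨i, hi⟩ := exists_card_fibre_ne_one f h
    obtain ⟨h'⟩ := nonempty_isInitial_unitObj C hi
    obtain ⟨h''⟩ := nonempty_isInitial_tprod (fun i => unitObj C (fibre f i)) h'
      (List.finRange n) (List.mem_finRange i)
    exact (isInitialTensorLeft _ h'').hom_ext _ _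

/-- The lax monoidal structure, with respect to the composition product, on the aritywise
extension of a lax braided functor. -/
@[reducible]
noncomputable def laxMonoidalAritywise (hC : CompositionMonoidal C) (hD : CompositionMonoidal D) :
    @Functor.LaxMonoidal (SymSeq D) _ hD.monoidalCategory (SymSeq C) _ hC.monoidalCategory
      (aritywise R) :=
  let _ := hC.monoidalCategory
  let _ := hD.monoidalCategory
  { ε := laxUnit R
    μ := laxCompMap R
    μ_natural_left := fun u B => by
      have h := compMap_laxCompMap R u (𝟙 B)
      rw [CategoryTheory.Functor.map_id] at h
      exact h
    μ_natural_right := fun A v => by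
      have h := compMap_laxCompMap R (𝟙 A) v
      rw [CategoryTheory.Functor.map_id] at h
      exact h
    associativity := laxCompMap_associativity R hC hD
    left_unitality := laxCompMap_leftUnitality R hC hD
    right_unitality := laxCompMap_rightUnitality R hC hD }

lemma isInducedLaxMonoidal (hC : CompositionMonoidal C) (hD : CompositionMonoidal D) :
    IsInducedLaxMonoidal R hC hD (laxMonoidalAritywise R hC hD) where
  ι_μ A B _ _ f := (compι_laxComp R A B f).trans (Category.assoc _ _ _)
  ε_app h := laxUnitApp_eq R h

end LaxComposition

/-! ### Tensoring with cofibrant objects -/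

section TensorCofibrant

variable {C : Type u} [Category.{v} C] [ModelCategory C] [MonoidalCategory C]

/-- Tensoring with the object `T` on the right is a left Quillen functor. -/
structure IsTensorCofibrant (T : C) : Prop where
  cofibration {A B : C} (i : A ⟶ B) [Cofibration i] : Cofibration (i ▷ T)
  weakEquivalence {A B : C} (i : A ⟶ B) [Cofibration i] [WeakEquivalence i] :
    WeakEquivalence (i ▷ T)

-- The unit need not be cofibrant, but tensoring with it is isomorphic to the identity. Iterated
-- products `tprod`, which end in the unit, thus satisfy `IsTensorCofibrant` as soon as their
-- factors do, even if they are not cofibrant themselves.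
variable (C) in
lemma isTensorCofibrant_unit : IsTensorCofibrant (𝟙_ C) where
  cofibration {A B} i _ := by
    have : i ▷ 𝟙_ C = (ρ_ A).hom ≫ i ≫ (ρ_ B).inv := by simp
    rw [this]
    infer_instance
  weakEquivalence {A B} i _ _ := by
    have : i ▷ 𝟙_ C = (ρ_ A).hom ≫ i ≫ (ρ_ B).inv := by simp
    rw [this]
    infer_instance

namespace IsTensorCofibrant

lemma tensor {T T' : C} (h : IsTensorCofibrant T) (h' : IsTensorCofibrant T') :
    IsTensorCofibrant (T ⊗ T') where
  cofibration {A B} i _ := by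
    have := h.cofibration i
    have := h'.cofibration (i ▷ T)
    rw [MonoidalCategory.whiskerRight_tensor]
    infer_instance
  weakEquivalence {A B} i _ _ := by
    have := h.cofibration i
    have := h.weakEquivalence i
    have := h'.weakEquivalence (i ▷ T)
    rw [MonoidalCategory.whiskerRight_tensor]
    infer_instance

lemma tprod {ι : Type} {X : ι → C} (h : ∀ a, IsTensorCofibrant (X a)) (l : List ι) :
    IsTensorCofibrant (tprod X l) := by
  induction l with
  | nil => exact isTensorCofibrant_unit C
  | cons a l ih => exact (h a).tensor ih

lemma isCofibrant_tensor [SymmetricCategory C] [∀ X : C, PreservesColimits (tensorLeft X)] {T : C}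
    (h : IsTensorCofibrant T) (X : C) [IsCofibrant X] : IsCofibrant (X ⊗ T) := by
  have := h.cofibration (initial.to X)
  exact (isCofibrant_iff_of_isInitial _ (isInitialTensorRight initialIsInitial T)).2 this

lemma weakEquivalence_of_isCofibrant {T : C} (h : IsTensorCofibrant T) {X Y : C} (f : X ⟶ Y)
    [IsCofibrant X] [IsCofibrant Y] [WeakEquivalence f] : WeakEquivalence (f ▷ T) := by
  let b : CofibrantBrownFactorization f := Classical.arbitrary _
  have hi : Cofibration b.i := (cofibration_iff _).2 b.hi
  have := h.weakEquivalence b.i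
  have := h.weakEquivalence b.s
  have : WeakEquivalence (b.p ▷ T) := by
    refine weakEquivalence_of_precomp_of_fac (f := b.s ▷ T) (fg := 𝟙 _) ?_
    rw [← comp_whiskerRight, b.s_p, id_whiskerRight]
  rw [← b.fac, comp_whiskerRight]
  infer_instance

end IsTensorCofibrant

variable [SymmetricCategory C]

instance [h : IsSymmetricMonoidalModelCategory C] (X : C) : PreservesColimits (tensorLeft X) :=
  h.preservesColimits X

-- In the pushout-product of `i` with `∅ ⟶ Y`, the objects `A ⊗ ∅` and `B ⊗ ∅` are initial, so its
-- source is `A ⊗ Y` and the map is `i ▷ Y` up to isomorphism. The pushout-product axiom then shows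
-- that cofibrant objects are `IsTensorCofibrant`.
omit [SymmetricCategory C] in
lemma exists_whiskerRight_fac [∀ X : C, PreservesColimits (tensorLeft X)] {A B : C} (i : A ⟶ B)
    (Y : C) :
    ∃ (P : C) (e : A ⊗ Y ⟶ P) (_ : IsIso e) (q : P ⟶ B ⊗ Y), i ▷ Y = e ≫ q ∧
      CategoryTheory.Arrow.mk q =
        ((MonoidalCategory.Arrow.pushoutProduct.obj (CategoryTheory.Arrow.mk i)).obj
          (CategoryTheory.Arrow.mk (initial.to Y))) := by
  let s := Functor.PushoutObjObj.ofHasPushout (curriedTensor C) i (initial.to Y)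
  have : IsIso (((curriedTensor C).map i).app (⊥_ C)) :=
    isIso_of_isInitial (isInitialTensorLeft A initialIsInitial)
      (isInitialTensorLeft B initialIsInitial) _
  refine ⟨_, s.inr, s.isPushout.isIso_inr_of_isIso, s.ι, s.inr_ι.symm, rfl⟩

lemma isTensorCofibrant [h : IsSymmetricMonoidalModelCategory C] (Y : C) [IsCofibrant Y] :
    IsTensorCofibrant Y where
  cofibration {A B} i _ := by
    obtain ⟨P, e, _, q, h₁, h₂⟩ := exists_whiskerRight_fac i Y
    have h₃ := h.pushoutProduct_cofibration i (initial.to Y)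
    have : Cofibration q := by
      rw [cofibration_iff] at h₃ ⊢
      exact (MorphismProperty.arrow_mk_mem_toSet_iff _ _).1
        (h₂ ▸ (MorphismProperty.arrow_mk_mem_toSet_iff _ _).2 h₃)
    rw [h₁]
    infer_instance
  weakEquivalence {A B} i _ _ := by
    obtain ⟨P, e, _, q, h₁, h₂⟩ := exists_whiskerRight_fac i Y
    have h₃ := h.pushoutProduct_weakEquivalence_left i (initial.to Y)
    have : WeakEquivalence q := by
      rw [weakEquivalence_iff] at h₃ ⊢
      exact (MorphismProperty.arrow_mk_mem_toSet_iff _ _).1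
        (h₂ ▸ (MorphismProperty.arrow_mk_mem_toSet_iff _ _).2 h₃)
    rw [h₁]
    infer_instance

end TensorCofibrant

/-! ### Iterated comparison maps of a weak monoidal Quillen pair -/

section Comparison

open Functor.LaxMonoidal Functor.OplaxMonoidal

section

variable {C : Type u₁} [Category.{v₁} C] [MonoidalCategory C]
  {D : Type u₂} [Category.{v₂} D] [MonoidalCategory D] (F : C ⥤ D) [F.OplaxMonoidal] {ι : Type}

/-- The iterated oplax monoidal structure map. -/
def oplaxTprod (X : ι → C) : (l : List ι) → (F.obj (tprod X l) ⟶ tprod (fun a => F.obj (X a)) l)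
  | [] => η F
  | a :: l => δ F (X a) (tprod X l) ≫ F.obj (X a) ◁ oplaxTprod X l

/-- The oplax monoidal structure map for `Y ⊗ ⨂ X a`. -/
def oplaxTensorTprod (Y : C) (X : ι → C) (l : List ι) :
    F.obj (Y ⊗ tprod X l) ⟶ F.obj Y ⊗ tprod (fun a => F.obj (X a)) l :=
  δ F Y (tprod X l) ≫ F.obj Y ◁ oplaxTprod F X l

/-- This is why a leading factor `Y` is carried along: `F 𝟙 ⟶ 𝟙` need not be a weak equivalence when
`𝟙` is not cofibrant, but after tensoring with `Y` the oplax unit law turns the base case into an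
isomorphism. -/
lemma oplaxTensorTprod_nil (Y : C) (X : ι → C) :
    oplaxTensorTprod F Y X [] = F.map (ρ_ Y).hom ≫ (ρ_ (F.obj Y)).inv := by
  have key : δ F Y (𝟙_ C) ≫ F.obj Y ◁ η F = F.map (ρ_ Y).hom ≫ (ρ_ (F.obj Y)).inv := by
    rw [← right_unitality_hom]
    simp
  exact key

lemma oplaxTensorTprod_cons (Y : C) (X : ι → C) (a : ι) (l : List ι) :
    oplaxTensorTprod F Y X (a :: l) =
      F.map (α_ Y (X a) (tprod X l)).inv ≫ oplaxTensorTprod F (Y ⊗ X a) X l ≫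
        δ F Y (X a) ▷ tprod (fun a => F.obj (X a)) l ≫ (α_ _ _ _).hom := by
  have key : ∀ {A T : C} {T' : D} (o : F.obj T ⟶ T'),
      δ F Y (A ⊗ T) ≫ F.obj Y ◁ (δ F A T ≫ F.obj A ◁ o) =
        F.map (α_ Y A T).inv ≫ (δ F (Y ⊗ A) T ≫ F.obj (Y ⊗ A) ◁ o) ≫ δ F Y A ▷ T' ≫
          (α_ (F.obj Y) (F.obj A) T').hom := by
    intro A T T' o
    have h := associativity F Y A T
    rw [← cancel_epi (F.map (α_ Y A T).hom), ← F.map_comp_assoc, Iso.hom_inv_id, F.map_id,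
      Category.id_comp, whiskerLeft_comp, ← reassoc_of% h, Category.assoc,
      whisker_exchange_assoc, associator_naturality_right]
  exact key _

end

variable {C : Type u₁} [Category.{v₁} C] [ModelCategory C] [MonoidalCategory C]
  [SymmetricCategory C] {D : Type u₂} [Category.{v₂} D] [ModelCategory D] [MonoidalCategory D]
  [SymmetricCategory D] [IsSymmetricMonoidalModelCategory C]
  [IsSymmetricMonoidalModelCategory D]
  {F : C ⥤ D} {R : D ⥤ C} {adj : F ⊣ R} [R.LaxBraided]

/-- Induction on the list for all `Y`: the first factor is absorbed into `Y`, leaving a shorter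
comparison and the map `δ F Y (X a) ▷ T`. The latter is a weak equivalence by Ken Brown's lemma for
tensoring with `T`, as `δ F Y (X a)` is a weak equivalence between cofibrant objects. -/
lemma IsWeakMonoidalQuillenPair.weakEquivalence_oplaxTensorTprod
    (h : IsWeakMonoidalQuillenPair adj) {ι : Type} (X : ι → C) [∀ a, IsCofibrant (X a)] (Y : C)
    [IsCofibrant Y] (l : List ι) :
    let _ := adj.leftAdjointOplaxMonoidal
    WeakEquivalence (oplaxTensorTprod F Y X l) := by
  intro _
  induction l generalizing Y with
  | nil =>
    rw [oplaxTensorTprod_nil]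
    exact (inferInstance : WeakEquivalence (F.map (ρ_ Y).hom ≫ (ρ_ (F.obj Y)).inv))
  | cons a l ih =>
    have := (isTensorCofibrant (X a)).isCofibrant_tensor Y
    have := ih (Y ⊗ X a)
    have := fun a => h.isQuillenPair.isCofibrant_obj (X a)
    have := h.isQuillenPair.isCofibrant_obj Y
    have := h.isQuillenPair.isCofibrant_obj (Y ⊗ X a)
    have := (isTensorCofibrant (F.obj (X a))).isCofibrant_tensor (F.obj Y)
    have : WeakEquivalence (δ F Y (X a)) := h.tensor Y (X a)
    have := (IsTensorCofibrant.tprod (fun a => isTensorCofibrant (F.obj (X a)))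
      l).weakEquivalence_of_isCofibrant (δ F Y (X a))
    rw [oplaxTensorTprod_cons]
    exact (inferInstance : WeakEquivalence (F.map (α_ Y (X a) (tprod X l)).inv ≫
      oplaxTensorTprod F (Y ⊗ X a) X l ≫ δ F Y (X a) ▷ tprod (fun a => F.obj (X a)) l ≫
        (α_ _ _ _).hom))

end Comparison

instance (x y : FinSet) : Finite (x ⟶ y) :=
  have := x.finite
  have := y.finite
  inferInstanceAs (Finite (x ≃ y))

instance {J : FinSet} (x y : FinUnder J) : Finite (x ⟶ y) :=
  inferInstanceAs (Finite {σ : Fin x.n ≃ Fin y.n // ∀ j, y.f j = σ (x.f j)})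

lemma exists_iso_finSet (J : FinSet) : ∃ n, Nonempty (finSet n ≅ J) := by
  have := J.finite
  obtain ⟨n, ⟨e⟩⟩ := Finite.exists_equiv_fin J
  have h₁ : bij (J := finSet n) e.symm ≫ bij (K := finSet n) e = 𝟙 _ :=
    Equiv.ext e.apply_symm_apply
  have h₂ : bij (K := finSet n) e ≫ bij (J := finSet n) e.symm = 𝟙 _ :=
    Equiv.ext e.symm_apply_apply
  exact ⟨n, ⟨⟨_, _, h₁, h₂⟩⟩⟩

instance {J : FinSet} {x y : FinUnder J} (σ : x ⟶ y) : IsIso σ :=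
  ⟨⟨σ.1.symm, fun j => by rw [σ.2 j, Equiv.symm_apply_apply]⟩,
    Subtype.ext (Equiv.ext σ.1.symm_apply_apply), Subtype.ext (Equiv.ext σ.1.apply_symm_apply)⟩

/-! ### Projective cofibrancy of the diagram defining the composition product -/

section Twist

variable {C : Type u} [Category.{v} C] [MonoidalCategory C] {J : FinSet}

/-- The functor which sends a symmetric sequence `A` to the diagram `x ↦ A(n) ⊗ Y(x)`, for
`x : J → {1, …, n}`. -/
@[simps]
def twist (Y : FinUnder J ⥤ C) : SymSeq C ⥤ (FinUnder J ⥤ C) where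
  obj A :=
    { obj := fun x => A.obj (finSet x.n) ⊗ Y.obj x
      map := fun σ => A.map (finBij σ.1) ⊗ₘ Y.map σ
      map_id := fun x => by
        have h : A.map (finBij (Equiv.refl (Fin x.n))) = 𝟙 _ := A.map_id _
        exact (congrArg (fun t => t ⊗ₘ Y.map (𝟙 x)) h).trans (by simp)
      map_comp := fun σ τ => by
        have h : A.map (finBij (σ.1.trans τ.1)) = A.map (finBij σ.1) ≫ A.map (finBij τ.1) :=
          A.map_comp (finBij σ.1) (finBij τ.1)
        rw [tensorHom_comp_tensorHom, ← h, ← Y.map_comp]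
        rfl }
  map u :=
    { app := fun x => u.app (finSet x.n) ▷ Y.obj x
      naturality := fun x y σ => by
        dsimp
        rw [← tensorHom_id, ← tensorHom_id, tensorHom_comp_tensorHom, tensorHom_comp_tensorHom,
          u.naturality]
        simp }

/-- The value of `twist Y` at an object. -/
def twistEvaluation (Y : FinUnder J ⥤ C) (x : FinUnder J) :
    twist Y ⋙ (evaluation _ C).obj x ≅
      (evaluation _ C).obj (finSet x.n) ⋙ tensorRight (Y.obj x) :=
  Iso.refl _

lemma preservesColimits_twist [HasColimits C] [SymmetricCategory C]
    [∀ X : C, PreservesColimits (tensorLeft X)] (Y : FinUnder J ⥤ C) :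
    PreservesColimits (twist Y) where
  preservesColimitsOfShape := preservesColimitsOfShape_of_evaluation _ _ fun x =>
    preservesColimitsOfShape_of_natIso (twistEvaluation Y x).symm

end Twist

section FreeCofibration

variable {C : Type u} [Category.{v} C] [HasColimits C]

/-- The inclusion of `X` in the free symmetric sequence on `X`. -/
noncomputable def freeι (s : ℕ) (X : C) {n : ℕ} (g : finSet s ⟶ finSet n) :
    X ⟶ ((evaluationLeftAdjoint C (finSet s)).obj X).obj (finSet n) :=
  Sigma.ι (fun _ : finSet s ⟶ finSet n => X) g

lemma freeι_map (s : ℕ) {X X' : C} (i : X ⟶ X') {n : ℕ} (g : finSet s ⟶ finSet n) :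
    freeι s X g ≫ ((evaluationLeftAdjoint C (finSet s)).map i).app (finSet n) =
      i ≫ freeι s X' g := by
  simp [freeι, evaluationLeftAdjoint]

lemma freeι_obj_map (s : ℕ) (X : C) {n m : ℕ} (g : finSet s ⟶ finSet n)
    (σ : finSet n ⟶ finSet m) :
    freeι s X g ≫ ((evaluationLeftAdjoint C (finSet s)).obj X).map σ = freeι s X (g ≫ σ) := by
  simp [freeι, evaluationLeftAdjoint]

variable [MonoidalCategory C] {J : FinSet}

/-- The inclusion of `X ⊗ Y x` in the tensor product of `Y` with the free symmetric sequence
on `X`. -/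
noncomputable def freeTwistι (Y : FinUnder J ⥤ C) (s : ℕ) (X : C) (x : FinUnder J)
    (g : Fin s ≃ Fin x.n) :
    X ⊗ Y.obj x ⟶ ((twist Y).obj ((evaluationLeftAdjoint C (finSet s)).obj X)).obj x :=
  freeι s X (finBij g) ▷ Y.obj x

/-- The restriction of a map along a bijection. -/
def FinUnder.restrict {s : ℕ} (x : FinUnder J) (g : Fin s ≃ Fin x.n) : FinUnder J :=
  ⟨s, fun j => g.symm (x.f j)⟩

/-- The comparison of a map with its restriction along a bijection. -/
def FinUnder.restrictMap {s : ℕ} (x : FinUnder J) (g : Fin s ≃ Fin x.n) : x.restrict g ⟶ x :=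
  ⟨g, fun _ => (g.apply_symm_apply _).symm⟩

lemma freeTwistι_map (Y : FinUnder J ⥤ C) (s : ℕ) (X : C) {x y : FinUnder J}
    (g : Fin s ≃ Fin x.n) (σ : x ⟶ y) :
    freeTwistι Y s X x g ≫ ((twist Y).obj ((evaluationLeftAdjoint C (finSet s)).obj X)).map σ =
      X ◁ Y.map σ ≫ freeTwistι Y s X y (g.trans σ.1) := by
  have h := freeι_obj_map s X (finBij g) (finBij σ.1)
  have key : ∀ {A B B' E E' : C} (a : A ⟶ B) (b : B ⟶ B') (e : E ⟶ E') (c : A ⟶ B'),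
      a ≫ b = c → a ▷ E ≫ (b ⊗ₘ e) = A ◁ e ≫ c ▷ E' := by
    rintro A B B' E E' a b e _ rfl
    rw [whisker_exchange, ← tensorHom_id, tensorHom_comp_tensorHom, Category.id_comp,
      CategoryTheory.MonoidalCategory.tensorHom_def]
  exact key _ _ _ _ h

lemma freeTwistι_naturality (Y : FinUnder J ⥤ C) (s : ℕ) {X X' : C} (i : X ⟶ X')
    (x : FinUnder J) (g : Fin s ≃ Fin x.n) :
    freeTwistι Y s X x g ≫
        ((twist Y).map ((evaluationLeftAdjoint C (finSet s)).map i)).app x =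
      i ▷ Y.obj x ≫ freeTwistι Y s X' x g :=
  (comp_whiskerRight _ _ _).symm.trans ((congrArg (fun q => q ▷ Y.obj x)
    (freeι_map s i (finBij g))).trans (comp_whiskerRight _ _ _))

/-- The summand at `x` indexed by `g` is carried, along the isomorphism `x.restrictMap g`, from the
identity summand at `x.restrict g`. Hence a map of diagrams is determined by its restrictions to
identity summands. -/
lemma freeTwistι_comp {Y Z : FinUnder J ⥤ C} (s : ℕ) {X : C}
    (t : (twist Y).obj ((evaluationLeftAdjoint C (finSet s)).obj X) ⟶ Z)
    (x : FinUnder J) (g : Fin s ≃ Fin x.n) :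
    freeTwistι Y s X x g ≫ t.app x =
      X ◁ Y.map (inv (x.restrictMap g)) ≫ freeTwistι Y s X (x.restrict g) (Equiv.refl _) ≫
        t.app (x.restrict g) ≫ Z.map (x.restrictMap g) := by
  have h := freeTwistι_map Y s X (Equiv.refl _) (x.restrictMap g)
  rw [← t.naturality, reassoc_of% h, ← MonoidalCategory.whiskerLeft_comp_assoc, ← Y.map_comp]
  simp
  rfl

variable [SymmetricCategory C] [∀ X : C, PreservesColimits (tensorLeft X)]

/-- The tensor product of a free symmetric sequence with an object, as a coproduct. -/
noncomputable def isColimitFreeTwist (Y : FinUnder J ⥤ C) (s : ℕ) (X : C) (x : FinUnder J) :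
    IsColimit (Cofan.mk (((twist Y).obj ((evaluationLeftAdjoint C (finSet s)).obj X)).obj x)
      (freeTwistι Y s X x)) :=
  have := preservesSmallestColimits_of_preservesColimits (tensorRight (Y.obj x))
  isColimitCofanMkObjOfIsColimit (tensorRight (Y.obj x)) _ _
    (coproductIsCoproduct (fun _ : finSet s ⟶ finSet x.n => X))

/-- A bijection `g` from `Fin s` to `Fin x.n` is a morphism to `x` from exactly one object `⟨s, f⟩`.
So the twisted free sequence behaves as the coproduct, over `f : J → Fin s`, of the free diagrams on
`X ⊗ Y ⟨s, f⟩` generated at `⟨s, f⟩`. -/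
lemma exists_twist_free_hom {Y Z : FinUnder J ⥤ C} (s : ℕ) {X : C}
    (l : ∀ f : J → Fin s, X ⊗ Y.obj ⟨s, f⟩ ⟶ Z.obj ⟨s, f⟩) :
    ∃ t : (twist Y).obj ((evaluationLeftAdjoint C (finSet s)).obj X) ⟶ Z,
      ∀ f : J → Fin s,
        freeTwistι Y s X ⟨s, f⟩ (Equiv.refl _) ≫ t.app ⟨s, f⟩ = l f := by
  let c (x : FinUnder J) (g : Fin s ≃ Fin x.n) : X ⊗ Y.obj x ⟶ Z.obj x :=
    X ◁ Y.map (inv (x.restrictMap g)) ≫ l _ ≫ Z.map (x.restrictMap g)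
  -- The source of `g` is allowed to be any `f` with `x.f = g ∘ f`, which avoids transport along
  -- equalities of objects in the naturality check.
  have hc : ∀ (x : FinUnder J) (f : J → Fin s) (g : Fin s ≃ Fin x.n) (hg : ∀ j, x.f j = g (f j)),
      c x g = X ◁ Y.map (inv (Subtype.mk g hg : (⟨s, f⟩ : FinUnder J) ⟶ x)) ≫ l f ≫
        Z.map (Subtype.mk g hg : (⟨s, f⟩ : FinUnder J) ⟶ x) := by
    rintro x f g hg
    obtain rfl : f = fun j => g.symm (x.f j) := by
      funext j
      rw [hg j]
      exact (g.symm_apply_apply _).symm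
    rfl
  let d (x : FinUnder J) :
      ((twist Y).obj ((evaluationLeftAdjoint C (finSet s)).obj X)).obj x ⟶ Z.obj x :=
    Cofan.IsColimit.desc (isColimitFreeTwist Y s X x) (c x)
  have hd (x : FinUnder J) (g : Fin s ≃ Fin x.n) : freeTwistι Y s X x g ≫ d x = c x g :=
    Cofan.IsColimit.fac (isColimitFreeTwist Y s X x) (c x) g
  refine ⟨{ app := d, naturality := fun x y κ => ?_ }, fun f => ?_⟩
  · refine Cofan.IsColimit.hom_ext (isColimitFreeTwist Y s X x) _ _ fun g => ?_
    change freeTwistι Y s X x g ≫ _ = freeTwistι Y s X x g ≫ _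
    rw [reassoc_of% freeTwistι_map Y s X, hd, reassoc_of% hd]
    have h := hc y _ (g.trans κ.1) (x.restrictMap g ≫ κ).2
    refine (congrArg (fun q => X ◁ Y.map κ ≫ q) h).trans ?_
    change X ◁ Y.map κ ≫ X ◁ Y.map (inv (x.restrictMap g ≫ κ)) ≫ _ ≫
      Z.map (x.restrictMap g ≫ κ) = _
    simp only [c, ← MonoidalCategory.whiskerLeft_comp_assoc, ← Y.map_comp, IsIso.inv_comp,
      IsIso.hom_inv_id_assoc, Z.map_comp, Category.assoc]
    exact congrArg (fun q => _ ≫ q) (Category.assoc _ _ _).symm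
  · refine (hd _ _).trans ((hc ⟨s, f⟩ f (Equiv.refl _) (fun _ => rfl)).trans ?_)
    change X ◁ Y.map (inv (𝟙 _)) ≫ l f ≫ Z.map (𝟙 _) = l f
    simp

lemma twist_free_hom_ext {Y Z : FinUnder J ⥤ C} (s : ℕ) {X : C}
    {t t' : (twist Y).obj ((evaluationLeftAdjoint C (finSet s)).obj X) ⟶ Z}
    (h : ∀ f : J → Fin s, freeTwistι Y s X ⟨s, f⟩ (Equiv.refl _) ≫ t.app ⟨s, f⟩ =
      freeTwistι Y s X ⟨s, f⟩ (Equiv.refl _) ≫ t'.app ⟨s, f⟩) : t = t' := by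
  ext x
  refine Cofan.IsColimit.hom_ext (isColimitFreeTwist Y s X x) _ _ fun g => ?_
  change freeTwistι Y s X x g ≫ _ = freeTwistι Y s X x g ≫ _
  have h' := h (fun j => g.symm (x.f j))
  change freeTwistι Y s X (x.restrict g) (Equiv.refl _) ≫ t.app (x.restrict g) =
    freeTwistι Y s X (x.restrict g) (Equiv.refl _) ≫ t'.app (x.restrict g) at h'
  rw [freeTwistι_comp, freeTwistι_comp, reassoc_of% h']

lemma hasLiftingProperty_twist_free (Y : FinUnder J ⥤ C) (s : ℕ) {X X' : C} (i : X ⟶ X')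
    {Z W : FinUnder J ⥤ C} (p : Z ⟶ W)
    (h : ∀ f : J → Fin s, HasLiftingProperty (i ▷ Y.obj ⟨s, f⟩) (p.app ⟨s, f⟩)) :
    HasLiftingProperty ((twist Y).map ((evaluationLeftAdjoint C (finSet s)).map i)) p where
  sq_hasLift {t b} sq := by
    have sq' (f : J → Fin s) :
        CommSq (freeTwistι Y s X ⟨s, f⟩ (Equiv.refl _) ≫ t.app ⟨s, f⟩)
        (i ▷ Y.obj ⟨s, f⟩) (p.app ⟨s, f⟩)
        (freeTwistι Y s X' ⟨s, f⟩ (Equiv.refl _) ≫ b.app ⟨s, f⟩) := ⟨by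
      rw [← reassoc_of% freeTwistι_naturality Y s i, Category.assoc, ← NatTrans.comp_app, sq.w,
        NatTrans.comp_app]⟩
    obtain ⟨l, hl⟩ := exists_twist_free_hom s (fun f => (sq' f).lift)
    refine ⟨⟨⟨l, twist_free_hom_ext s fun f => ?_, twist_free_hom_ext s fun f => ?_⟩⟩⟩
    · rw [NatTrans.comp_app, reassoc_of% freeTwistι_naturality Y s i, hl, (sq' f).fac_left]
    · rw [NatTrans.comp_app, reassoc_of% hl f, (sq' f).fac_right]

end FreeCofibration

section Generation

universe w

variable {C : Type u₁} [Category.{v₁} C] {D : Type u₂} [Category.{v₂} D]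

/-- By the small object argument, every map of the left class is a retract of a transfinite
composition of pushouts of coproducts of generators. The functor `G` preserves these constructions,
and `P.llp` is closed under them. -/
lemma llp_map_of_generators (I : MorphismProperty C)
    [MorphismProperty.HasSmallObjectArgument.{w} I] (G : C ⥤ D)
    [PreservesColimitsOfSize.{w, w} G]
    (P : MorphismProperty D) (h : ∀ ⦃X Y : C⦄ (f : X ⟶ Y), I f → P.llp (G.map f)) {X Y : C}
    (f : X ⟶ Y) (hf : I.rlp.llp f) : P.llp (G.map f) := by
  rw [MorphismProperty.llp_rlp_of_hasSmallObjectArgument'] at hf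
  have := preservesSmallestColimits_of_preservesColimits G
  have h₁ : MorphismProperty.coproducts.{w} I ≤ P.llp.inverseImage G := by
    intro X Y f hf
    obtain ⟨ι, A, B, c, d, hc, hd, g, hg, hf⟩ := exists_cofan_of_coproducts f hf
    refine MorphismProperty.coproducts_le.{w} P.llp _ (coproducts_of_cofan
      (isColimitCofanMkObjOfIsColimit G _ _ hc) (isColimitCofanMkObjOfIsColimit G _ _ hd)
      (fun i => G.map (g i)) (fun i => h _ (hg i)) _ fun i => ?_)
    rw [← G.map_comp, hf, G.map_comp]
  have h₂ : (MorphismProperty.coproducts.{w} I).pushouts ≤ P.llp.inverseImage G := by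
    rintro X Y f ⟨_, _, m, a, b, hm, sq⟩
    exact MorphismProperty.of_isPushout (P := P.llp) (sq.map G) (h₁ _ hm)
  have h₃ : (MorphismProperty.coproducts.{w} I).pushouts.transfiniteCompositionsOfShape
      I.smallObjectκ.ord.ToType ≤ P.llp.inverseImage G := by
    intro X Y f hf
    have : PreservesWellOrderContinuousOfShape I.smallObjectκ.ord.ToType G := {}
    exact MorphismProperty.transfiniteCompositionsOfShape_le P.llp I.smallObjectκ.ord.ToType _
      (MorphismProperty.transfiniteCompositionsOfShape_map_of_preserves _ G f
        (MorphismProperty.transfiniteCompositionsOfShape_monotone _ h₂ _ hf))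
  exact (MorphismProperty.retracts_le (P.llp.inverseImage G))
    _ (MorphismProperty.retracts_monotone h₃ _ hf)

end Generation

section Twist

variable {C : Type u} [Category.{v} C] [HasColimits C] [ModelCategory C] [MonoidalCategory C]
  [SymmetricCategory C] [∀ X : C, PreservesColimits (tensorLeft X)]

/-- It is enough to treat the generating free maps. For the free map on `i` at `s`, lifting against
an objectwise trivial fibration reduces to lifting for the maps `i ▷ Y ⟨s, f⟩`, which are
cofibrations by the assumption on `Y`. -/
lemma cofibration_twist (hC : IsCofibrantlyGenerated C) {J : FinSet}
    [ModelCategory (SymSeq C)] (h : IsProjectiveModel FinSet C)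
    [ModelCategory (FinUnder J ⥤ C)] (h' : IsProjectiveModel (FinUnder J) C)
    (Y : FinUnder J ⥤ C) (hY : ∀ x, IsTensorCofibrant (Y.obj x)) {A B : SymSeq C} (f : A ⟶ B)
    [hf : Cofibration f] : Cofibration ((twist Y).map f) := by
  obtain ⟨I, _, hI, _, _, hI'⟩ := hC
  rw [cofibration_iff_llp, h.trivialFibrations_eq, hI',
    ← rlp_freeMaps finSet exists_iso_finSet] at hf
  rw [cofibration_iff_llp, h'.trivialFibrations_eq]
  have := hasSmallObjectArgument_freeMaps finSet exists_iso_finSet I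
  have := preservesColimits_twist Y
  refine llp_map_of_generators (freeMaps finSet I) (twist Y) _
    (fun X X' f hf => ?_) f hf
  obtain ⟨s, A', B', i, hi, e⟩ := (freeMaps_iff finSet I f).1 hf
  intro Z W p hp
  have h₁ : HasLiftingProperty ((twist Y).map ((evaluationLeftAdjoint C (finSet s)).map i)) p := by
    refine hasLiftingProperty_twist_free Y s i p fun g => ?_
    obtain ⟨_, _⟩ := (mem_trivialFibrations_iff _).1 (hp ⟨s, g⟩)
    have : Cofibration i := by
      rw [cofibration_iff_llp, hI']
      exact I.le_llp_rlp _ hi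
    have := (hY ⟨s, g⟩).cofibration i
    infer_instance
  exact HasLiftingProperty.of_arrow_iso_left
    (i := (twist Y).map ((evaluationLeftAdjoint C (finSet s)).map i)) (i' := (twist Y).map f)
    ((twist Y).mapArrow.mapIso (eqToIso e.symm)) p

lemma isCofibrant_twist (hC : IsCofibrantlyGenerated C) {J : FinSet}
    [ModelCategory (SymSeq C)] (h : IsProjectiveModel FinSet C)
    [ModelCategory (FinUnder J ⥤ C)] (h' : IsProjectiveModel (FinUnder J) C)
    (Y : FinUnder J ⥤ C) (hY : ∀ x, IsTensorCofibrant (Y.obj x)) (A : SymSeq C) [IsCofibrant A] :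
    IsCofibrant ((twist Y).obj A) := by
  have := preservesColimits_twist Y
  have := preservesSmallestColimits_of_preservesColimits (twist Y)
  exact (isCofibrant_iff_of_isInitial ((twist Y).map (initial.to A))
    (initialIsInitial.isInitialObj (twist Y) _)).2 (cofibration_twist hC h h' Y hY _)

/-- The tensor products of the values of a symmetric sequence at the fibres. -/
noncomputable def fibreDiagram (B : SymSeq C) (J : FinSet) : FinUnder J ⥤ C where
  obj x := tensorFin (fun i => B.obj (fibre x.f i))
  map {x y} σ := tensorFinMap σ.1
    (fun i => B.map (fibreMap (f := x.f) (g := y.f) (Equiv.refl J) (by simp [σ.2])))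
  map_id x := by
    refine Eq.trans ?_ (tensorFinMap_id (fun i => B.obj (fibre x.f i)))
    exact congrArg (tensorFinMap (Equiv.refl _)) (funext fun i => B.map_id (fibre x.f i))
  map_comp {x y z} σ τ := by
    rw [tensorFinMap_comp]
    refine congrArg (tensorFinMap (σ.1.trans τ.1)) (funext fun i => ?_)
    exact B.map_comp (fibreMap (f := x.f) (g := y.f) (Equiv.refl J) (by simp [σ.2]))
      (fibreMap (f := y.f) (g := z.f) (a := σ.1 i) (b := τ.1 (σ.1 i)) (Equiv.refl J)
        (by simp [τ.2]))

/-- The diagram that defines the composition product is the tensor product of its first factor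
with the tensor products of the values of the second one at the fibres. -/
noncomputable def twistFibreDiagramIso (A B : SymSeq C) (J : FinSet) :
    (twist (fibreDiagram B J)).obj A ≅ compDiagram A B J :=
  NatIso.ofComponents (fun _ => Iso.refl _) (fun {x y} σ => by
    simp only [Iso.refl_hom]
    refine (Category.comp_id _).trans (Eq.trans ?_ (Category.id_comp _).symm)
    refine Eq.trans ?_ (show (A.map (finBij σ.1) ≫ 𝟙 _) ⊗ₘ tensorFinMap σ.1 (fun i =>
      B.map (fibreMap (f := x.f) (g := y.f) (Equiv.refl J) (by simp [σ.2])) ≫ 𝟙 _) = _ from rfl)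
    simp only [Category.comp_id]
    rfl)

end Twist

section Composition

variable {C : Type u} [Category.{v} C] [HasColimits C] [ModelCategory C] [MonoidalCategory C]
  [SymmetricCategory C] [IsSymmetricMonoidalModelCategory C]

/-- The diagram is `A` twisted by the products of the values of `B` at the fibres. Freeness under
bijections comes from `A` alone; of `B` only the cofibrancy of its values is used. -/
lemma isCofibrant_compDiagram (hC : IsCofibrantlyGenerated C) {J : FinSet}
    [ModelCategory (SymSeq C)] (h : IsProjectiveModel FinSet C)
    [ModelCategory (FinUnder J ⥤ C)] (h' : IsProjectiveModel (FinUnder J) C)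
    (A B : SymSeq C) [IsCofibrant A] [IsCofibrant B] : IsCofibrant (compDiagram A B J) := by
  have := h.isCofibrant_obj B
  have := isCofibrant_twist hC h h' (fibreDiagram B J) (fun x =>
    IsTensorCofibrant.tprod (fun i => isTensorCofibrant (B.obj (fibre x.f i))) _) A
  rw [isCofibrant_iff] at this ⊢
  have e : initial.to (compDiagram A B J) = initial.to _ ≫ (twistFibreDiagramIso A B J).hom :=
    Subsingleton.elim _ _
  rw [e]
  infer_instance

end Composition

/-! ### The comparison map for `∘` as a colimit of comparison maps of terms -/

section Mates

open Functor.LaxMonoidal Functor.OplaxMonoidal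

variable {C : Type u₁} [Category.{v₁} C] [MonoidalCategory C]
  {D : Type u₂} [Category.{v₂} D] [MonoidalCategory D]
  {F : C ⥤ D} {R : D ⥤ C} (adj : F ⊣ R) [R.LaxMonoidal] {ι : Type}

variable (R) in
lemma tensorHom_comp_μ {A T T' : C} {B S : D} (x : A ⟶ R.obj B) (t : T ⟶ T')
    (w : T ⟶ R.obj S) (s : T' ⟶ R.obj S) (h : w = t ≫ s) :
    (x ⊗ₘ w) ≫ μ R B S = (x ⊗ₘ t) ≫ R.obj B ◁ s ≫ μ R B S := by
  rw [h, ← id_tensorHom, tensorHom_comp_tensorHom_assoc, Category.comp_id]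

lemma homEquiv_δ_comp_whiskerLeft (Y : C) {T : C} {T' : D} (o : F.obj T ⟶ T') :
    let _ := adj.leftAdjointOplaxMonoidal
    adj.homEquiv _ _ (δ F Y T ≫ F.obj Y ◁ o) =
      (adj.unit.app Y ⊗ₘ adj.homEquiv _ _ o) ≫ μ R (F.obj Y) T' := by
  intro _
  have h : adj.homEquiv _ _ (δ F Y T) = (adj.unit.app Y ⊗ₘ adj.unit.app T) ≫ μ R _ _ :=
    Equiv.apply_symm_apply _ _
  rw [adj.homEquiv_naturality_right, h, Category.assoc, ← μ_natural_right, adj.homEquiv_unit,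
    ← id_tensorHom, tensorHom_comp_tensorHom_assoc]
  exact congrArg (fun t => (t ⊗ₘ _) ≫ μ R (F.obj Y) T') (Category.comp_id (adj.unit.app Y))

/-- The oplax structure of `F` is the mate of the lax structure of `R`, and this correspondence
persists under iteration. It is used to recognize the comparison of terms, which is defined through
`R`, as `oplaxTensorTprod`. -/
lemma homEquiv_oplaxTprod (X : ι → C) (l : List ι) :
    let _ := adj.leftAdjointOplaxMonoidal
    adj.homEquiv _ _ (oplaxTprod F X l) =
      tprodHom (fun a => adj.unit.app (X a)) l ≫ laxTprod R (fun a => F.obj (X a)) l := by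
  intro _
  induction l with
  | nil => exact (Equiv.apply_symm_apply _ _).trans (Category.id_comp _).symm
  | cons a l ih =>
    refine (homEquiv_δ_comp_whiskerLeft adj (X a) (oplaxTprod F X l)).trans ?_
    exact tensorHom_comp_μ R _ _ _ _ ih

lemma homEquiv_oplaxTensorTprod (Y : C) (X : ι → C) (l : List ι) :
    let _ := adj.leftAdjointOplaxMonoidal
    adj.homEquiv _ _ (oplaxTensorTprod F Y X l) =
      (adj.unit.app Y ⊗ₘ tprodHom (fun a => adj.unit.app (X a)) l) ≫
        R.obj (F.obj Y) ◁ laxTprod R (fun a => F.obj (X a)) l ≫ μ R (F.obj Y) _ := by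
  intro _
  refine (homEquiv_δ_comp_whiskerLeft adj Y (oplaxTprod F X l)).trans ?_
  exact tensorHom_comp_μ R _ _ _ _ (homEquiv_oplaxTprod adj X l)

lemma whiskerRight_homEquiv_symm_app {C : Type u₁} [Category.{v₁} C] {D : Type u₂}
    [Category.{v₂} D] {F : C ⥤ D} {R : D ⥤ C} (adj : F ⊣ R) {K : Type u} [Category.{v} K]
    {X : K ⥤ C} {Y : K ⥤ D} (f : X ⟶ Y ⋙ R) (x : K) :
    (((adj.whiskerRight K).homEquiv X Y).symm f).app x =
      (adj.homEquiv _ _).symm (f.app x) := by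
  rw [Adjunction.homEquiv_counit, Adjunction.homEquiv_counit]
  simp

end Mates

section Comparison

open Functor.LaxMonoidal Functor.OplaxMonoidal

variable {C : Type u₁} [Category.{v₁} C] [MonoidalCategory C] [SymmetricCategory C]
  {D : Type u₂} [Category.{v₂} D] [MonoidalCategory D] [SymmetricCategory D]
  {F : C ⥤ D} {R : D ⥤ C} (adj : F ⊣ R) [R.LaxBraided]

/-- The adjoint of `compDiagramComparison`. -/
noncomputable def compDiagramComparisonAdjoint (A B : SymSeq C) (J : FinSet) :
    compDiagram A B J ⟶
      compDiagram ((aritywise F).obj A) ((aritywise F).obj B) J ⋙ R where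
  app x := compTermMap ((aritywiseAdj adj).unit.app A) ((aritywiseAdj adj).unit.app B)
      (f := x.f) (f' := x.f) (Equiv.refl _) (Equiv.refl _) (fun _ => rfl) ≫
    laxTerm R ((aritywise F).obj A) ((aritywise F).obj B) x.f
  naturality x y σ := by
    have h₁ := compTermMap_laxTerm R (𝟙 ((aritywise F).obj A)) (𝟙 ((aritywise F).obj B))
      σ.1 (Equiv.refl _) σ.2
    rw [CategoryTheory.Functor.map_id, CategoryTheory.Functor.map_id] at h₁
    have h₂ := compTermMap_comp (𝟙 A) (𝟙 B) ((aritywiseAdj adj).unit.app A)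
      ((aritywiseAdj adj).unit.app B) σ.1 (Equiv.refl _) σ.2 (Equiv.refl _) (Equiv.refl _)
      (f'' := y.f) (fun _ => rfl)
    have h₃ := compTermMap_comp ((aritywiseAdj adj).unit.app A) ((aritywiseAdj adj).unit.app B)
      (𝟙 _) (𝟙 _) (Equiv.refl _) (Equiv.refl _) (f := x.f) (f' := x.f) (fun _ => rfl)
      σ.1 (Equiv.refl _) (f'' := y.f) σ.2
    simp only [Category.comp_id, Category.id_comp] at h₂ h₃
    have h₄ := h₂.trans h₃.symm
    have key : ∀ {X Y X' Y' : C} {X'' Y'' : D} (a : X ⟶ Y) (b : Y ⟶ Y') (b' : X ⟶ X')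
        (c : X' ⟶ Y') (d : Y' ⟶ R.obj Y'') (d' : X' ⟶ R.obj X'') (e : X'' ⟶ Y''),
        a ≫ b = b' ≫ c → c ≫ d = d' ≫ R.map e → a ≫ b ≫ d = (b' ≫ d') ≫ R.map e := by
      intro X Y X' Y' X'' Y'' a b b' c d d' e h h'
      rw [reassoc_of% h, h', Category.assoc]
    exact key _ _ _ _ _ _ _ h₄ h₁

/-- The comparison map between the diagrams that define the composition products. -/
noncomputable def compDiagramComparison (A B : SymSeq C) (J : FinSet) :
    compDiagram A B J ⋙ F ⟶
      compDiagram ((aritywise F).obj A) ((aritywise F).obj B) J :=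
  ((adj.whiskerRight (FinUnder J)).homEquiv _ _).symm (compDiagramComparisonAdjoint adj A B J)

lemma compDiagramComparison_app (A B : SymSeq C) (J : FinSet) (x : FinUnder J) :
    (compDiagramComparison adj A B J).app x =
      (adj.homEquiv _ _).symm ((compDiagramComparisonAdjoint adj A B J).app x) :=
  whiskerRight_homEquiv_symm_app adj _ x

lemma compDiagramComparison_app_eq (A B : SymSeq C) (J : FinSet) (x : FinUnder J) :
    let _ := adj.leftAdjointOplaxMonoidal
    (compDiagramComparison adj A B J).app x =
      oplaxTensorTprod F (A.obj (finSet x.n)) (fun i => B.obj (fibre x.f i))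
        (List.finRange x.n) := by
  intro _
  refine (compDiagramComparison_app adj A B J x).trans
    ((Equiv.symm_apply_eq (adj.homEquiv _ _)).2 ?_)
  refine Eq.trans ?_ (homEquiv_oplaxTensorTprod adj _ _ _).symm
  refine congrArg (fun t => t ≫ laxTerm R ((aritywise F).obj A) ((aritywise F).obj B) x.f)
    ((compTermMap_refl ((aritywiseAdj adj).unit.app A) ((aritywiseAdj adj).unit.app B)
      x.f).trans ?_)
  have h (M : SymSeq C) (K : FinSet) :
      ((aritywiseAdj adj).unit.app M).app K = adj.unit.app (M.obj K) := by
    simp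
  simp only [h]

variable [HasColimits C] [HasColimits D]

/-- Since `F` preserves the colimit, maps out of `F ((A ∘ B)(J))` are tested on terms; there both
sides are adjoint to the unit followed by `laxTerm`. -/
lemma homEquiv_symm_laxCompMap_app (A B : SymSeq C) (J : FinSet)
    [PreservesColimit (compDiagram A B J) F] :
    (((aritywiseAdj adj).homEquiv (compObj A B)
      (compObj ((aritywise F).obj A) ((aritywise F).obj B))).symm
      (compMap ((aritywiseAdj adj).unit.app A) ((aritywiseAdj adj).unit.app B) ≫
        laxCompMap R ((aritywise F).obj A) ((aritywise F).obj B))).app J =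
      (preservesColimitIso F (compDiagram A B J)).hom ≫
        colimMap (compDiagramComparison adj A B J) := by
  refine (isColimitOfPreserves F (colimit.isColimit (compDiagram A B J))).hom_ext fun x => ?_
  have key : ∀ {X T : C} {Y S : D} (i : T ⟶ X) (m : X ⟶ R.obj Y) (n : T ⟶ R.obj S) (j : S ⟶ Y)
      (m' : F.obj X ⟶ Y) (n' : F.obj T ⟶ S), m' = (adj.homEquiv _ _).symm m →
      n' = (adj.homEquiv _ _).symm n → i ≫ m = n ≫ R.map j → F.map i ≫ m' = n' ≫ j := by
    rintro X T Y S i m n j _ _ rfl rfl h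
    rw [← adj.homEquiv_naturality_left_symm, h, adj.homEquiv_naturality_right_symm]
  have h₁ := key (compι A B x.f)
    ((compMap ((aritywiseAdj adj).unit.app A) ((aritywiseAdj adj).unit.app B) ≫
        laxCompMap R ((aritywise F).obj A) ((aritywise F).obj B)).app J)
    ((compDiagramComparisonAdjoint adj A B J).app x)
    (compι ((aritywise F).obj A) ((aritywise F).obj B) x.f)
    ((((aritywiseAdj adj).homEquiv (compObj A B)
      (compObj ((aritywise F).obj A) ((aritywise F).obj B))).symm
      (compMap ((aritywiseAdj adj).unit.app A) ((aritywiseAdj adj).unit.app B) ≫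
        laxCompMap R ((aritywise F).obj A) ((aritywise F).obj B))).app J) _
    (whiskerRight_homEquiv_symm_app adj _ J) (compDiagramComparison_app adj A B J x) ?_
  · refine h₁.trans ?_
    have h₂ := ι_preservesColimitIso_hom F (compDiagram A B J) x
    refine Eq.trans ?_ (Category.assoc _ _ _)
    refine Eq.trans ?_ (congrArg (fun t => t ≫ colimMap (compDiagramComparison adj A B J)) h₂.symm)
    exact (ι_colimMap _ x).symm
  · have h₃ := compι_colimMap ((aritywiseAdj adj).unit.app A) ((aritywiseAdj adj).unit.app B)
      (Equiv.refl J) x.f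
    have h₄ := compι_laxComp R ((aritywise F).obj A) ((aritywise F).obj B) x.f
    exact (Category.assoc _ _ _).symm.trans ((congrArg (fun t => t ≫
      laxComp R ((aritywise F).obj A) ((aritywise F).obj B) J) h₃).trans
        ((Category.assoc _ _ _).trans ((congrArg (fun t => _ ≫ t) h₄).trans
          (Category.assoc _ _ _).symm)))

end Comparison

/-! ### Homotopy invariance of the colimit and the weak monoidal Quillen pair -/

section Colimits

universe v' u'

/-- Fibrations and weak equivalences are objectwise, so constant diagrams preserve them. Therefore
`colim` preserves weak equivalences between projectively cofibrant diagrams. -/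
lemma isQuillenPair_colimConstAdj {K : Type u'} [Category.{v'} K] {C : Type u} [Category.{v} C]
    [ModelCategory C] [HasColimitsOfShape K C] [ModelCategory (K ⥤ C)]
    (h : IsProjectiveModel K C) :
    IsQuillenPair (colimConstAdj : (colim : (K ⥤ C) ⥤ C) ⊣ Functor.const K) where
  map_fibration p _ := (h.fibration_iff _).2 fun _ => (inferInstance : Fibration p)
  map_trivialFibration p _ _ :=
    (h.weakEquivalence_iff _).2 fun _ => (inferInstance : WeakEquivalence p)

end Colimits

section Comparison

variable {C : Type u₁} [Category.{v₁} C] [HasColimits C] [ModelCategory C]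
  [MonoidalCategory C] [SymmetricCategory C] [IsSymmetricMonoidalModelCategory C]
  {D : Type u₂} [Category.{v₂} D] [HasColimits D] [ModelCategory D]
  [MonoidalCategory D] [SymmetricCategory D] [IsSymmetricMonoidalModelCategory D]
  [ModelCategory (SymSeq C)] [ModelCategory (SymSeq D)]
  {F : C ⥤ D} {R : D ⥤ C} {adj : F ⊣ R} [R.LaxBraided]

lemma weakEquivalence_colimMap_compDiagramComparison (hC : IsCofibrantlyGenerated C)
    (hD : IsCofibrantlyGenerated D) (hC' : IsProjectiveModel FinSet C)
    (hD' : IsProjectiveModel FinSet D) (h : IsWeakMonoidalQuillenPair adj)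
    (A B : SymSeq C) [IsCofibrant A] [IsCofibrant B] (J : FinSet) :
    WeakEquivalence (colimMap (compDiagramComparison adj A B J)) := by
  -- The objects of `FinUnder J` already form a type in the lowest universe, so they can serve as
  -- their own representatives.
  obtain ⟨_, hCJ⟩ := exists_isProjectiveModel hC (id : FinUnder J → FinUnder J)
    (fun x => ⟨x, ⟨Iso.refl x⟩⟩)
  obtain ⟨_, hDJ⟩ := exists_isProjectiveModel hD (id : FinUnder J → FinUnder J)
    (fun x => ⟨x, ⟨Iso.refl x⟩⟩)
  have := isCofibrant_compDiagram (J := J) hC hC' hCJ A B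
  have q := h.isQuillenPair.whiskerRight hC' hD'
  have q' := h.isQuillenPair.whiskerRight hCJ hDJ
  have : IsCofibrant (compDiagram A B J ⋙ F) := q'.isCofibrant_obj (compDiagram A B J)
  have : IsCofibrant ((aritywise F).obj A) := q.isCofibrant_obj A
  have : IsCofibrant ((aritywise F).obj B) := q.isCofibrant_obj B
  have := isCofibrant_compDiagram (J := J) hD hD' hDJ ((aritywise F).obj A) ((aritywise F).obj B)
  have := hC'.isCofibrant_obj A
  have := hC'.isCofibrant_obj B
  have : WeakEquivalence (compDiagramComparison adj A B J) :=
    (hDJ.weakEquivalence_iff _).2 fun x => by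
      have h₁ := h.weakEquivalence_oplaxTensorTprod (fun i => B.obj (fibre x.f i))
        (A.obj (finSet x.n)) (List.finRange x.n)
      rw [compDiagramComparison_app_eq]
      exact h₁
  exact (isQuillenPair_colimConstAdj hDJ).map_weakEquivalence_of_isCofibrant
    (compDiagramComparison adj A B J)

lemma weakEquivalence_homEquiv_symm_laxCompMap (hC : IsCofibrantlyGenerated C)
    (hD : IsCofibrantlyGenerated D) (hC' : IsProjectiveModel FinSet C)
    (hD' : IsProjectiveModel FinSet D) (h : IsWeakMonoidalQuillenPair adj)
    (A B : SymSeq C) [IsCofibrant A] [IsCofibrant B] :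
    WeakEquivalence (((aritywiseAdj adj).homEquiv (compObj A B)
      (compObj ((aritywise F).obj A) ((aritywise F).obj B))).symm
      (compMap ((aritywiseAdj adj).unit.app A) ((aritywiseAdj adj).unit.app B) ≫
        laxCompMap R ((aritywise F).obj A) ((aritywise F).obj B))) := by
  refine (hD'.weakEquivalence_iff _).2 fun J => ?_
  have := adj.leftAdjoint_preservesColimits
  have := weakEquivalence_colimMap_compDiagramComparison hC hD hC' hD' h A B J
  rw [homEquiv_symm_laxCompMap_app]
  exact (inferInstance : WeakEquivalence ((preservesColimitIso F (compDiagram A B J)).hom ≫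
    colimMap (compDiagramComparison adj A B J)))

-- On one-element sets this is the unit condition for `adj`. On the others the adjoint of
-- `laxUnitApp` is an isomorphism of initial objects, and `F` preserves `q` as a weak equivalence
-- because an initial object is cofibrant.
omit [SymmetricCategory C] [IsSymmetricMonoidalModelCategory C] [SymmetricCategory D]
  [IsSymmetricMonoidalModelCategory D] [ModelCategory (SymSeq C)] [ModelCategory (SymSeq D)]
  [R.LaxBraided] in
lemma weakEquivalence_homEquiv_symm_laxUnitApp [R.LaxMonoidal]
    (h : IsWeakMonoidalQuillenPair adj) (J : FinSet)
    {Q : C} (q : Q ⟶ unitObj C J) [IsCofibrant Q] [WeakEquivalence q] :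
    WeakEquivalence (F.map q ≫ (adj.homEquiv _ _).symm (laxUnitApp R J)) := by
  by_cases hJ : Nat.card J = 1
  · have h₁ := h.unit (q ≫ eqToHom (unitObj_eq hJ))
    have e : F.map q ≫ (adj.homEquiv _ _).symm (laxUnitApp R J) =
        (F.map (q ≫ eqToHom (unitObj_eq hJ)) ≫
          (adj.homEquiv _ _).symm (Functor.LaxMonoidal.ε R)) ≫ eqToHom (unitObj_eq hJ).symm := by
      rw [laxUnitApp_eq R hJ, adj.homEquiv_naturality_left_symm,
        adj.homEquiv_naturality_right_symm, F.map_comp]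
      simp
    rw [e]
    infer_instance
  · obtain ⟨i⟩ := nonempty_isInitial_unitObj C hJ
    obtain ⟨i'⟩ := nonempty_isInitial_unitObj D hJ
    have : IsCofibrant (unitObj C J) :=
      (isCofibrant_iff_of_isInitial (𝟙 (unitObj C J)) i).2 inferInstance
    have := adj.leftAdjoint_preservesColimits
    have := isIso_of_isInitial (i.isInitialObj F _) i'
      ((adj.homEquiv _ _).symm (laxUnitApp R J))
    have := h.isQuillenPair.map_weakEquivalence_of_isCofibrant q
    infer_instance

omit [SymmetricCategory C] [IsSymmetricMonoidalModelCategory C] [SymmetricCategory D]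
  [IsSymmetricMonoidalModelCategory D] [R.LaxBraided] in
lemma weakEquivalence_homEquiv_symm_laxUnit [R.LaxMonoidal] (hC' : IsProjectiveModel FinSet C)
    (hD' : IsProjectiveModel FinSet D) (h : IsWeakMonoidalQuillenPair adj)
    {Q : SymSeq C} (q : Q ⟶ unitSeq C) [IsCofibrant Q] [WeakEquivalence q] :
    WeakEquivalence ((aritywise F).map q ≫
      ((aritywiseAdj adj).homEquiv (unitSeq C) (unitSeq D)).symm (laxUnit R)) := by
  refine (hD'.weakEquivalence_iff _).2 fun J => ?_
  have := hC'.isCofibrant_obj Q J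
  have : WeakEquivalence (C := C) (X := Q.obj J) (Y := unitObj C J) (q.app J) :=
    (hC'.weakEquivalence_iff q).1 inferInstance J
  have e : ((aritywise F).map q ≫
      ((aritywiseAdj adj).homEquiv (unitSeq C) (unitSeq D)).symm (laxUnit R)).app J =
      F.map (q.app J) ≫ (adj.homEquiv _ _).symm (laxUnitApp R J) :=
    congrArg (fun t => F.map (q.app J) ≫ t) (whiskerRight_homEquiv_symm_app adj (laxUnit R) J)
  rw [e]
  exact weakEquivalence_homEquiv_symm_laxUnitApp h J (q.app J)

lemma isWeakMonoidalQuillenPair_aritywise (hC : IsCofibrantlyGenerated C)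
    (hD : IsCofibrantlyGenerated D) (hC' : IsProjectiveModel FinSet C)
    (hD' : IsProjectiveModel FinSet D) (h : IsWeakMonoidalQuillenPair adj)
    (compC : CompositionMonoidal C) (compD : CompositionMonoidal D) :
    letI := compC.monoidalCategory
    letI := compD.monoidalCategory
    letI := laxMonoidalAritywise R compC compD
    IsWeakMonoidalQuillenPair (aritywiseAdj adj) :=
  letI := compC.monoidalCategory
  letI := compD.monoidalCategory
  letI := laxMonoidalAritywise R compC compD
  { isQuillenPair := h.isQuillenPair.whiskerRight hC' hD'
    tensor := fun A B _ _ => weakEquivalence_homEquiv_symm_laxCompMap hC hD hC' hD' h A B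
    unit := fun q _ _ => weakEquivalence_homEquiv_symm_laxUnit hC' hD' h q }

end Comparison

end SymmetricSequences

theorem mainTheorem4 {C : Type u₁} [Category.{v₁} C] [HasColimits C] [ModelCategory C]
    {D : Type u₂} [Category.{v₂} D] [HasColimits D] [ModelCategory D]
    (hC : SymmetricSequences.IsCofibrantlyGenerated C)
    (hD : SymmetricSequences.IsCofibrantlyGenerated D)
    {F : C ⥤ D} {R : D ⥤ C} (adj : F ⊣ R) (hadj : SymmetricSequences.IsQuillenPair adj) :
    ∃ (_ : ModelCategory (SymmetricSequences.SymSeq C))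
      (_ : ModelCategory (SymmetricSequences.SymSeq D)),
      SymmetricSequences.IsProjective C ∧ SymmetricSequences.IsProjective D ∧
      SymmetricSequences.IsQuillenPair (SymmetricSequences.aritywiseAdj adj) ∧
      (SymmetricSequences.IsQuillenEquivalence adj →
        SymmetricSequences.IsQuillenEquivalence (SymmetricSequences.aritywiseAdj adj)) ∧
      ∀ [MonoidalCategory C] [SymmetricCategory C] [MonoidalCategory D] [SymmetricCategory D]
        [SymmetricSequences.IsSymmetricMonoidalModelCategory C]
        [SymmetricSequences.IsSymmetricMonoidalModelCategory D]
        (compC : SymmetricSequences.CompositionMonoidal C)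
        (compD : SymmetricSequences.CompositionMonoidal D)
        [R.LaxBraided],
        SymmetricSequences.IsWeakMonoidalQuillenPair adj →
        letI := compC.monoidalCategory
        letI := compD.monoidalCategory
        ∃ lax : (SymmetricSequences.aritywise R).LaxMonoidal,
          SymmetricSequences.IsInducedLaxMonoidal R compC compD lax ∧
          SymmetricSequences.IsWeakMonoidalQuillenPair (SymmetricSequences.aritywiseAdj adj) := by
  -- `FinSet` is large, but the sets `finSet n` represent all its objects, so the generators are
  -- indexed by `ℕ`.
  obtain ⟨_, hC'⟩ := SymmetricSequences.exists_isProjectiveModel hC SymmetricSequences.finSet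
    SymmetricSequences.exists_iso_finSet
  obtain ⟨_, hD'⟩ := SymmetricSequences.exists_isProjectiveModel hD SymmetricSequences.finSet
    SymmetricSequences.exists_iso_finSet
  refine ⟨_, _, ⟨hC'.fibration_iff, hC'.weakEquivalence_iff⟩,
    ⟨hD'.fibration_iff, hD'.weakEquivalence_iff⟩, hadj.whiskerRight hC' hD',
    fun h => h.whiskerRight hC' hD', ?_⟩
  intro _ _ _ _ _ _ compC compD _ h
  exact ⟨SymmetricSequences.laxMonoidalAritywise R compC compD,
    SymmetricSequences.isInducedLaxMonoidal R compC compD,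
    SymmetricSequences.isWeakMonoidalQuillenPair_aritywise hC hD hC' hD' h compC compD⟩
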